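/- **Theorem.** Let $n$ be the number of variables and $m$ the number of terms of a DNF formula $D$. Here a DNF is a finite set of terms on the variables $x_1,\dots,x_n$ (which need not all occur in it), a term is a finite set of literals on pairwise different variables, and a model is an assignment $\{x_1,\dots,x_n\}\to\{0,1\}$ that makes all literals of at least one term of $D$ true. The machine model is the random access machine over the non-negative integers, with truncated subtraction. It reads an input word symbol by symbol, has direct and indirect addressing, jumps (unconditional, or conditional on a register being zero), addition, subtraction and multiplication, and an instruction that outputs the word $R_iR_{i+1}\cdots R_j$ of the contents of consecutive registers, where $i,j$ are themselves register contents. An arithmetic instruction takes time linear in the number of bits of its operands; every other instruction takes constant time. The space used at a step is the sum of the numbers of bits of the integers stored in the registers. The average delay of a halting run is its total time, from the reading of the input on, divided by the number of words it outputs. There are a fixed program $P$ of such a machine, a constant $C$ and a polynomial $p$ such that for every $n$ and every DNF $D$ on $x_1,\dots,x_n$ with $m$ terms the following holds. Give $P$ as input $n$, $m$ and the terms of $D$, each term once, as its number of literals followed by the index and sign of each of its literals; the order of the terms, and of the literals in a term, is arbitrary. Then $P$ halts, it outputs exactly the words $\alpha(x_1)\cdots\alpha(x_n)$ for the models $\alpha$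 of $D$, each exactly once, it uses space at most $p(n+m)$ at every step, and, if $n\ge 1$ and $m\ge 1$, its average delay is at most $$C\,n^2\,m^{1-\log_3 2}.$$ In short: the models of a DNF can be enumerated with average delay $O(n^2m^{1-\log_3 2})$ and polynomial space. -/

import Mathlib

/-! ## DNF formulas on the variables `x_0, …, x_{n-1}` -/

/-- A literal: the pair `(i, true)` is the variable `x_i`, the pair `(i, false)` its negation. -/
abbrev Literal (n : ℕ) : Type := Fin n × Bool

/-- A term: a finite set of literals, any two of which have different variables. -/
abbrev Term (n : ℕ) : Type :=
  {T : Finset (Literal n) // Set.InjOn Prod.fst (T : Set (Literal n))}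

/-- A DNF formula: a finite set of terms. -/
abbrev DNF (n : ℕ) : Type := Finset (Term n)

/-- The value of a literal under an assignment. -/
def Literal.value {n : ℕ} (α : Fin n → Bool) (l : Literal n) : Bool :=
  if l.2 then α l.1 else !(α l.1)

/-- The assignment `α` satisfies the term `T`. -/
def Term.SatisfiedBy {n : ℕ} (T : Term n) (α : Fin n → Bool) : Prop :=
  ∀ l ∈ T.1, Literal.value α l = true

/-- The set of models of a DNF formula. -/
def DNF.models {n : ℕ} (D : DNF n) : Set (Fin n → Bool) :=
  {α | ∃ T ∈ D, T.SatisfiedBy α}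

/-- The word `α(x_0) α(x_1) … α(x_{n-1})` over `{0, 1}` that represents an assignment. -/
def assignmentWord {n : ℕ} (α : Fin n → Bool) : List ℕ :=
  List.ofFn fun i => (α i).toNat

/-! ## Input words for DNF formulas -/

/-- A term, given as a list of literals, is written as its number of literals followed by,
for each literal, the index of its variable and its sign. -/
def encodeTerm {n : ℕ} (ls : List (Literal n)) : List ℕ :=
  ls.length :: ls.flatMap fun l => [(l.1 : ℕ), l.2.toNat]

/-- A formula, given as a list of terms, is written as the number of variables, the number of
terms, and then the terms one after the other. -/
def encodeTerms {n : ℕ} (Ts : List (List (Literal n))) : List ℕ :=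
  n :: Ts.length :: Ts.flatMap encodeTerm

/-- `w` is an input word for `D`: the terms of `D` are listed once each, in some order, and each
of them as a list of its literals, once each, in some order. -/
def IsInputFor {n : ℕ} (D : DNF n) (w : List ℕ) : Prop :=
  ∃ Ts : List (List (Literal n)),
    (∀ ls ∈ Ts, ls.Nodup) ∧
    (Ts.map List.toFinset).Nodup ∧
    (∀ S : Finset (Literal n), S ∈ Ts.map List.toFinset ↔ ∃ T ∈ D, T.1 = S) ∧
    w = encodeTerms Ts

/-! ## Random access machines -/

namespace RAM

/-- The instructions. `R_a` denotes the content of register `a`. -/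
inductive Instr : Type
  /-- `R_i ← c` -/
  | const (i c : ℕ)
  /-- `R_i ← R_j` -/
  | copy (i j : ℕ)
  /-- `R_i ← R_{R_j}` -/
  | load (i j : ℕ)
  /-- `R_{R_i} ← R_j` -/
  | store (i j : ℕ)
  /-- `R_i ← R_j + R_k` -/
  | add (i j k : ℕ)
  /-- `R_i ← R_j - R_k`, or `0` if this difference is negative -/
  | sub (i j k : ℕ)
  /-- `R_i ← R_j * R_k` -/
  | mul (i j k : ℕ)
  /-- `R_i ←` the next symbol of the input word (`0` when the word is exhausted) -/
  | read (i : ℕ)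
  /-- continue at line `l` -/
  | jump (l : ℕ)
  /-- if `R_i = 0`, continue at line `l` -/
  | jumpZero (i l : ℕ)
  /-- output the word `R_a R_{a+1} … R_b`, where `a = R_i` and `b = R_j` (empty if `b < a`) -/
  | output (i j : ℕ)
  /-- stop -/
  | halt

/-- A program is a finite list of instructions, with lines numbered from `0`. -/
abbrev Program : Type := List Instr

/-- A configuration of a machine, with a clock. Almost all registers contain `0`. -/
structure Config : Type where
  /-- the current line -/
  pc : ℕ
  /-- the contents of the registers -/
  reg : ℕ →₀ ℕ
  /-- the unread part of the input word -/
  input : List ℕ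
  /-- the words that have been output so far, in this order -/
  out : List (List ℕ)
  /-- the time used so far -/
  time : ℕ

/-- The start configuration on the input word `w`. -/
noncomputable def start (w : List ℕ) : Config :=
  { pc := 0, reg := 0, input := w, out := [], time := 0 }

/-- The time of an instruction: an arithmetic instruction takes time linear in the number of bits
of its two operands, every other instruction takes constant time. -/
def Instr.cost (r : ℕ →₀ ℕ) : Instr → ℕ
  | .add _ j k => 1 + (r j).size + (r k).size
  | .sub _ j k => 1 + (r j).size + (r k).size
  | .mul _ j k => 1 + (r j).size + (r k).size
  | .halt => 0
  | _ => 1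

/-- The configuration that an instruction leads to, the clock aside; `none` if it stops. -/
noncomputable def Instr.exec (c : Config) : Instr → Option Config
  | .const i a => some { c with pc := c.pc + 1, reg := c.reg.update i a }
  | .copy i j => some { c with pc := c.pc + 1, reg := c.reg.update i (c.reg j) }
  | .load i j => some { c with pc := c.pc + 1, reg := c.reg.update i (c.reg (c.reg j)) }
  | .store i j => some { c with pc := c.pc + 1, reg := c.reg.update (c.reg i) (c.reg j) }
  | .add i j k => some { c with pc := c.pc + 1, reg := c.reg.update i (c.reg j + c.reg k) }
  | .sub i j k => some { c with pc := c.pc + 1, reg := c.reg.update i (c.reg j - c.reg k) }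
  | .mul i j k => some { c with pc := c.pc + 1, reg := c.reg.update i (c.reg j * c.reg k) }
  | .read i => some { c with
      pc := c.pc + 1, reg := c.reg.update i (c.input.headD 0), input := c.input.tail }
  | .jump l => some { c with pc := l }
  | .jumpZero i l => some { c with pc := if c.reg i = 0 then l else c.pc + 1 }
  | .output i j => some { c with
      pc := c.pc + 1
      out := c.out ++ [(List.range' (c.reg i) (c.reg j + 1 - c.reg i)).map c.reg] }
  | .halt => none

/-- One step of the program `P`; `none` if `P` has stopped, that is, if the current line holds
`halt` or does not exist. -/
noncomputable def step (P : Program) (c : Config) : Option Config :=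
  P[c.pc]?.bind fun I =>
    (I.exec c).map fun c' => { c' with time := c.time + I.cost c.reg }

/-- On the input word `w`, the program `P` stops, in the configuration `c`. -/
def HaltsIn (P : Program) (w : List ℕ) (c : Config) : Prop :=
  StateTransition.Reaches (step P) (start w) c ∧ step P c = none

/-- The space used at a configuration: the total number of bits of the register contents. -/
def Config.space (c : Config) : ℕ := c.reg.sum fun _ v => v.size

/-- Total time divided by the number of words that have been output. -/
noncomputable def Config.averageDelay (c : Config) : ℝ := (c.time : ℝ) / (c.out.length : ℝ)

/-- The words that have been output are exactly the elements of `A`, without repetition. -/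
def Config.Enumerates (c : Config) (A : Set (List ℕ)) : Prop :=
  c.out.Nodup ∧ ∀ y, y ∈ c.out ↔ y ∈ A

end RAM

/-! Branch on the variables from the last to the first, keeping the set `S` of distinct terms left
after restriction and never entering a branch with `S = ∅`. Every node entered has a model below it,
but handling a node costs about `|S|` steps, so a lower bound for the number of models in terms of
`|S|` is needed.

Write `γ = log_3 2`. A formula with `|S|` distinct terms has at least `|S|^γ` models
(`rpow_card_le_modelCount`). Suppose the two restrictions on a variable have `A ≥ B` terms. The
terms without the variable survive in both, so `|S| ≤ A + 2B`, and concavity together with `3^γ = 2`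
gives `(A + 2B)^γ ≤ A^γ + B^γ` (`add_two_mul_rpow_le`). Hence a node costs `|S| = |S|^(1-γ) |S|^γ ≤
m^(1-γ) * (models below it)`. The model counts at one depth add up to the total count, and there are
`n + 1` depths, so the number of loop iterations is `O(n m^(1-γ))` per model (`workBound_le`). The
numbers involved have `O(n)` bits, which gives the second factor `n`.

The cost `O(|S|)` requires that duplicates created by a restriction be detected in a bounded number
of instructions. A term is coded as a number with ternary digits (0: variable absent, 1: negated, 2:
positive), and each set is a linked list whose cell for code `q` is located at a fixed base plus
`q`. A cell in the list is nonzero and all others are zero, so membership is a single lookup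
(`Heap`). The addresses are exponential in `n`, but zero registers take no space. Splitting a list
clears its cells, and at any time there are at most two lists per level with at most `m` cells each,
whence polynomial space.

The machine program is written in a structured language and compiled. Only the tests of loop
conditions are counted: between two tests a bounded number of instructions is executed, and in that
stretch bit lengths grow by a bounded factor only (`Stmt.BigStep.path`). It is then enough to keep
an invariant at the loop tests. The recursion on the variables is run without a stack, by a loop
that moves a level counter down and up (`sweeps`). -/

namespace RAM

/-! ### Structured programs and their semantics -/

/-- The part of a configuration that a straight-line instruction acts on. -/
structure St : Type where
  reg : ℕ →₀ ℕ
  input : List ℕ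
  out : List (List ℕ)

/-- The configuration with given state, line and clock. -/
def St.toConfig (σ : St) (pc time : ℕ) : Config :=
  { pc := pc, reg := σ.reg, input := σ.input, out := σ.out, time := time }

/-- The effect of a straight-line instruction on the state. -/
noncomputable def Instr.run (σ : St) : Instr → St
  | .const i a => { σ with reg := σ.reg.update i a }
  | .copy i j => { σ with reg := σ.reg.update i (σ.reg j) }
  | .load i j => { σ with reg := σ.reg.update i (σ.reg (σ.reg j)) }
  | .store i j => { σ with reg := σ.reg.update (σ.reg i) (σ.reg j) }
  | .add i j k => { σ with reg := σ.reg.update i (σ.reg j + σ.reg k) }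
  | .sub i j k => { σ with reg := σ.reg.update i (σ.reg j - σ.reg k) }
  | .mul i j k => { σ with reg := σ.reg.update i (σ.reg j * σ.reg k) }
  | .read i => { σ with reg := σ.reg.update i (σ.input.headD 0), input := σ.input.tail }
  | .output i j => { σ with
      out := σ.out ++ [(List.range' (σ.reg i) (σ.reg j + 1 - σ.reg i)).map σ.reg] }
  | _ => σ

/-- Neither a jump nor `halt`, and all constants have at most `c` bits. -/
def Instr.Straight (c : ℕ) : Instr → Prop
  | .const _ a => a.size ≤ c
  | .jump _ => False
  | .jumpZero _ _ => False
  | .halt => False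
  | _ => True

/-- Structured programs. -/
inductive Stmt : Type
  /-- a sequence of straight-line instructions -/
  | blk (is : List Instr)
  | seq (s t : Stmt)
  /-- if `R_r = 0` then `s` else `t` -/
  | ifz (r : ℕ) (s t : Stmt)
  /-- while `R_r ≠ 0` do `s` -/
  | loop (r : ℕ) (s : Stmt)

namespace Stmt

/-- The number of instructions of the compiled program. -/
def len : Stmt → ℕ
  | blk is => is.length
  | seq s t => s.len + t.len
  | ifz _ s t => s.len + t.len + 2
  | loop _ s => s.len + 2

/-- The instructions of the structured program, when its first line is line `l`. -/
def compile : ℕ → Stmt → List Instr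
  | _, blk is => is
  | l, seq s t => compile l s ++ compile (l + s.len) t
  -- The nonzero branch comes first and ends with a jump over the zero branch, which is the target
  -- of the test.
  | l, ifz r s t => .jumpZero r (l + 1 + t.len + 1) ::
      (compile (l + 1) t ++ .jump (l + 1 + t.len + 1 + s.len) :: compile (l + 1 + t.len + 1) s)
  | l, loop r s => .jumpZero r (l + 1 + s.len + 1) :: (compile (l + 1) s ++ [.jump l])

lemma length_compile (s : Stmt) : ∀ l, (compile l s).length = s.len := by
  induction s with
  | blk is => intro l; rfl
  | seq s t hs ht => intro l; simp [compile, len, hs, ht]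
  | ifz r s t hs ht => intro l; simp [compile, len, hs, ht]; omega
  | loop r s hs => intro l; simp [compile, len, hs]

/-- All blocks consist of straight-line instructions with constants of at most `c` bits. -/
def Straight (c : ℕ) : Stmt → Prop
  | blk is => ∀ I ∈ is, I.Straight c
  | seq s t => s.Straight c ∧ t.Straight c
  | ifz _ s t => s.Straight c ∧ t.Straight c
  | loop _ s => s.Straight c

/-- The run of a structured program, with the number of times that a loop condition is tested;
`Q` has to hold whenever this happens. -/
inductive BigStep (Q : St → Prop) : Stmt → St → ℕ → St → Prop
  | blk (is : List Instr) (σ : St) : BigStep Q (.blk is) σ 0 (is.foldl Instr.run σ)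
  | seq {s t : Stmt} {σ₁ σ₂ σ₃ : St} {a b : ℕ} (h₁ : BigStep Q s σ₁ a σ₂)
      (h₂ : BigStep Q t σ₂ b σ₃) : BigStep Q (.seq s t) σ₁ (a + b) σ₃
  | ifz_zero {r : ℕ} {s t : Stmt} {σ σ' : St} {a : ℕ} (h : σ.reg r = 0)
      (h₁ : BigStep Q s σ a σ') : BigStep Q (.ifz r s t) σ a σ'
  | ifz_pos {r : ℕ} {s t : Stmt} {σ σ' : St} {a : ℕ} (h : σ.reg r ≠ 0)
      (h₁ : BigStep Q t σ a σ') : BigStep Q (.ifz r s t) σ a σ'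
  | loop_done {r : ℕ} {s : Stmt} {σ : St} (hQ : Q σ) (h : σ.reg r = 0) :
      BigStep Q (.loop r s) σ 1 σ
  | loop_step {r : ℕ} {s : Stmt} {σ₁ σ₂ σ₃ : St} {a b : ℕ} (hQ : Q σ₁) (h : σ₁.reg r ≠ 0)
      (h₁ : BigStep Q s σ₁ a σ₂) (h₂ : BigStep Q (.loop r s) σ₂ b σ₃) :
      BigStep Q (.loop r s) σ₁ (1 + a + b) σ₃

end Stmt

/-! ### Code fragments, bit lengths and space -/

/-- The lines of `P` from `l` on begin with `is`. -/
def CodeAt (P : Program) (l : ℕ) (is : List Instr) : Prop :=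
  ∃ pre post : List Instr, P = pre ++ (is ++ post) ∧ pre.length = l

lemma CodeAt.append_left {P : Program} {l : ℕ} {is js : List Instr} (h : CodeAt P l (is ++ js)) :
    CodeAt P l is := by
  obtain ⟨pre, post, rfl, hl⟩ := h
  exact ⟨pre, js ++ post, by simp, hl⟩

lemma CodeAt.append_right {P : Program} {l : ℕ} {is js : List Instr} (h : CodeAt P l (is ++ js)) :
    CodeAt P (l + is.length) js := by
  obtain ⟨pre, post, rfl, rfl⟩ := h
  exact ⟨pre ++ is, post, by simp, by simp⟩

lemma CodeAt.tail {P : Program} {l : ℕ} {I : Instr} {is : List Instr} (h : CodeAt P l (I :: is)) :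
    CodeAt P (l + 1) is :=
  CodeAt.append_right (is := [I]) h

lemma CodeAt.head {P : Program} {l : ℕ} {I : Instr} {is : List Instr} (h : CodeAt P l (I :: is)) :
    P[l]? = some I := by
  obtain ⟨pre, post, rfl, rfl⟩ := h
  simp

/-- The number of bits of the contents of all registers. -/
def regSpace (r : ℕ →₀ ℕ) : ℕ := r.sum fun _ v => v.size

lemma regSpace_update_le (r : ℕ →₀ ℕ) (i v : ℕ) :
    regSpace (r.update i v) ≤ regSpace r + v.size := by
  classical
  have h1 : (r.update i v).support ⊆ insert i r.support := by
    intro x hx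
    by_cases hxi : x = i
    · simp [hxi]
    · simpa [hxi, Function.update_apply] using hx
  unfold regSpace
  rw [Finsupp.sum_of_support_subset _ h1 _ (by simp),
    Finsupp.sum_of_support_subset r (Finset.subset_insert i r.support) _ (by simp)]
  have h2 : v.size = ∑ x ∈ insert i r.support, if x = i then v.size else 0 := by simp
  conv_rhs => rw [h2]
  rw [← Finset.sum_add_distrib]
  refine Finset.sum_le_sum fun x _ => ?_
  by_cases hxi : x = i <;> simp [hxi]

lemma regSpace_le_card_mul (r : ℕ →₀ ℕ) (A : Finset ℕ) (M : ℕ) (hA : ∀ x, r x ≠ 0 → x ∈ A)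
    (hM : ∀ x, (r x).size ≤ M) : regSpace r ≤ A.card * M := by
  unfold regSpace
  rw [Finsupp.sum_of_support_subset r (s := A) (fun x hx => hA x (by simpa using hx)) _ (by simp)]
  simpa using Finset.sum_le_card_nsmul A (fun x => (r x).size) M (fun x _ => hM x)

lemma size_add_le {a b g : ℕ} (ha : a.size ≤ g) (hb : b.size ≤ g) : (a + b).size ≤ g + 1 := by
  rw [Nat.size_le] at *
  rw [pow_succ]; omega

lemma size_mul_le {a b g : ℕ} (ha : a.size ≤ g) (hb : b.size ≤ g) : (a * b).size ≤ 2 * g := by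
  rw [Nat.size_le] at *
  rw [two_mul, pow_add]
  exact Nat.mul_lt_mul'' ha hb

/-! ### Growth of the registers between two loop tests -/

/-- Bounds for the runs of a structured program: `M` bounds the number of bits in every register
and every input symbol, and `S` the space, whenever a loop condition is tested; `c` bounds the
bits of the constants, and `N` the length of the program. -/
structure Limits : Type where
  M : ℕ
  S : ℕ
  c : ℕ
  N : ℕ
  c_pos : 0 < c

namespace Limits

variable (L : Limits)

/-- A bound for the bits of a register after `k` straight-line instructions. -/
def bits (k : ℕ) : ℕ := 2 ^ k * (L.M + L.c)

lemma bits_mono {k k' : ℕ} (h : k ≤ k') : L.bits k ≤ L.bits k' :=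
  Nat.mul_le_mul_right _ (Nat.pow_le_pow_right (by norm_num) h)

lemma bits_succ (k : ℕ) : L.bits (k + 1) = 2 * L.bits k := by
  simp [bits, pow_succ]; ring

lemma M_add_c_le_bits (k : ℕ) : L.M + L.c ≤ L.bits k :=
  Nat.le_mul_of_pos_left _ (by positivity)

/-- The condition at a test of a loop condition. -/
def Check (σ : St) : Prop := (∀ x, (σ.reg x).size ≤ L.M) ∧ regSpace σ.reg ≤ L.S

/-- A bound for the space at all times. -/
def space : ℕ := L.S + L.N * L.bits L.N

/-- The condition `k` straight-line instructions after a test of a loop condition. -/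
structure Ok (k : ℕ) (σ : St) : Prop where
  size_le : ∀ x, (σ.reg x).size ≤ L.bits k
  space_le : regSpace σ.reg ≤ L.S + k * L.bits L.N
  input_le : ∀ v ∈ σ.input, v.size ≤ L.M

variable {L}

lemma Check.ok {σ : St} (h : L.Check σ) (hi : ∀ v ∈ σ.input, v.size ≤ L.M) : L.Ok 0 σ :=
  ⟨fun x => (h.1 x).trans ((Nat.le_add_right _ _).trans (L.M_add_c_le_bits 0)),
    by simpa using h.2, hi⟩

lemma Ok.mono {k k' : ℕ} {σ : St} (h : L.Ok k σ) (hk : k ≤ k') : L.Ok k' σ :=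
  ⟨fun x => (h.size_le x).trans (L.bits_mono hk),
    h.space_le.trans (by gcongr), h.input_le⟩

lemma Ok.le_space {k : ℕ} {σ : St} (h : L.Ok k σ) (hk : k ≤ L.N) : regSpace σ.reg ≤ L.space :=
  h.space_le.trans (by unfold space; gcongr)

lemma Ok.update {k : ℕ} {σ : St} (h : L.Ok k σ) (hk : k + 1 ≤ L.N) (i v : ℕ)
    (hv : v.size ≤ L.bits (k + 1)) (inp : List ℕ) (hi : ∀ v ∈ inp, v.size ≤ L.M)
    (o : List (List ℕ)) : L.Ok (k + 1) ⟨σ.reg.update i v, inp, o⟩ := by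
  refine ⟨fun x => ?_, ?_, hi⟩
  · by_cases hx : x = i
    · simpa [hx] using hv
    · simpa [hx, Function.update_apply] using (h.size_le x).trans (L.bits_mono (Nat.le_succ k))
  · have h1 := regSpace_update_le σ.reg i v
    have h2 := L.bits_mono hk
    have h3 := h.space_le
    simp only
    rw [Nat.add_mul, one_mul]
    omega

/-- One instruction at most doubles the bound on bit lengths. Multiplication adds two lengths;
addition costs one extra bit, which doubling absorbs because the bound is at least `c ≥ 1`;
constants and input symbols fit below `M + c`. -/
lemma Ok.run {k : ℕ} {σ : St} (h : L.Ok k σ) (hk : k + 1 ≤ L.N) {I : Instr}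
    (hI : I.Straight L.c) : L.Ok (k + 1) (I.run σ) := by
  have hc := L.c_pos
  have h1 := L.M_add_c_le_bits k
  have h2 := L.bits_succ k
  have hs := h.size_le
  cases I with
  | const i a => exact h.update hk _ _ (by simp only [Instr.Straight] at hI; omega) _ h.input_le _
  | copy i j => exact h.update hk _ _ (by have := hs j; omega) _ h.input_le _
  | load i j => exact h.update hk _ _ (by have := hs (σ.reg j); omega) _ h.input_le _
  | store i j => exact h.update hk _ _ (by have := hs j; omega) _ h.input_le _
  | add i j k' =>
    exact h.update hk _ _ (by have := size_add_le (hs j) (hs k'); omega) _ h.input_le _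
  | sub i j k' =>
    exact h.update hk _ _
      (by have := Nat.size_le_size (Nat.sub_le (σ.reg j) (σ.reg k')); have := hs j; omega)
      _ h.input_le _
  | mul i j k' =>
    exact h.update hk _ _ (by have := size_mul_le (hs j) (hs k'); omega) _ h.input_le _
  | read i =>
    refine h.update hk _ _ ?_ _ (fun v hv => h.input_le v (List.mem_of_mem_tail hv)) _
    rcases hin : σ.input with _ | ⟨v, l⟩
    · simp
    · have := h.input_le v (by simp [hin])
      simp; omega
  | jump l => exact hI.elim
  | jumpZero i l => exact hI.elim
  | halt => exact hI.elim
  | output i j =>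
    have h' := h.mono (Nat.le_succ k)
    exact ⟨h'.size_le, h'.space_le, h'.input_le⟩

/-- A bound for the time of one instruction. -/
def instrTime (L : Limits) : ℕ := 1 + 2 * L.bits L.N

lemma Ok.cost_le {k : ℕ} {σ : St} (h : L.Ok k σ) (hk : k ≤ L.N) (I : Instr) :
    I.cost σ.reg ≤ L.instrTime := by
  have hs x := (h.size_le x).trans (L.bits_mono hk)
  unfold instrTime
  cases I <;> simp only [Instr.cost] <;> try omega
  all_goals
    rename_i j k
    have := hs j
    have := hs k
    omega

end Limits

/-! ### Correctness of the compilation, with time and space -/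

/-- `P` leads from `c` to `c'`, with space at most `B` after every step. -/
def Path (P : Program) (B : ℕ) : Config → Config → Prop :=
  Relation.ReflTransGen fun a b => step P a = some b ∧ b.space ≤ B

lemma step_straight {P : Program} {c pc time : ℕ} {I : Instr} {σ : St} (hP : P[pc]? = some I)
    (hI : I.Straight c) :
    step P (σ.toConfig pc time) = some ((I.run σ).toConfig (pc + 1) (time + I.cost σ.reg)) := by
  simp only [step, St.toConfig, hP, Option.bind_some]
  cases I <;> first | rfl | exact hI.elim

lemma step_jump {P : Program} {pc time l : ℕ} {σ : St} (hP : P[pc]? = some (.jump l)) :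
    step P (σ.toConfig pc time) = some (σ.toConfig l (time + 1)) := by
  simp [step, St.toConfig, hP, Instr.exec, Instr.cost]

lemma step_jumpZero {P : Program} {pc time i l : ℕ} {σ : St} (hP : P[pc]? = some (.jumpZero i l)) :
    step P (σ.toConfig pc time) =
      some (σ.toConfig (if σ.reg i = 0 then l else pc + 1) (time + 1)) := by
  by_cases h : σ.reg i = 0 <;> simp [step, St.toConfig, hP, Instr.exec, Instr.cost, h]

open Limits

lemma path_block {L : Limits} {P : Program} (is : List Instr) :
    ∀ (σ : St) (l k time : ℕ), CodeAt P l is → (∀ I ∈ is, I.Straight L.c) →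
      k + is.length ≤ L.N → L.Ok k σ →
      L.Ok (k + is.length) (is.foldl Instr.run σ) ∧
      ∃ time' ≤ time + is.length * L.instrTime,
        Path P L.space (σ.toConfig l time)
          ((is.foldl Instr.run σ).toConfig (l + is.length) time') := by
  induction is with
  | nil => intro σ l k time _ _ _ hok; exact ⟨hok, time, by simp, Relation.ReflTransGen.refl⟩
  | cons I is ih =>
    intro σ l k time hP hI hk hok
    simp only [List.length_cons] at hk
    have hI0 := hI I (by simp)
    have hok1 := hok.run (by omega) hI0
    have hc := hok.cost_le (by omega) I
    obtain ⟨h1, time', ht, hp⟩ := ih (I.run σ) (l + 1) (k + 1) (time + I.cost σ.reg) hP.tail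
      (fun J hJ => hI J (by simp [hJ])) (by omega) hok1
    refine ⟨by simpa [add_assoc, add_comm 1] using h1, time', ?_, ?_⟩
    · simp only [List.length_cons, Nat.add_mul, one_mul] at *; omega
    · simp only [List.length_cons, List.foldl_cons]
      rw [show l + (is.length + 1) = l + 1 + is.length by omega]
      exact Relation.ReflTransGen.head
        ⟨step_straight hP.head hI0, hok1.le_space (by omega)⟩ hp

/-- The compiled program does what the structured program does. -/
theorem Stmt.BigStep.path {L : Limits} {P : Program} {s : Stmt} {σ σ' : St} {t : ℕ}
    (h : s.BigStep L.Check σ t σ') :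
    ∀ l k time : ℕ, CodeAt P l (s.compile l) → s.Straight L.c → k + s.len ≤ L.N → L.Ok k σ →
      L.Ok (k + s.len) σ' ∧
      ∃ time' ≤ time + (s.len + t * L.N) * L.instrTime,
        Path P L.space (σ.toConfig l time) (σ'.toConfig (l + s.len) time') := by
  induction h with
  | blk is σ =>
    intro l k time hP hs hk hok
    simpa [Stmt.len] using path_block is σ l k time hP hs hk hok
  | @seq s t σ₁ σ₂ σ₃ a b _ _ ih₁ ih₂ =>
    intro l k time hP hs hk hok
    simp only [Stmt.len] at hk ⊢
    obtain ⟨hok₁, t₁, ht₁, hp₁⟩ := ih₁ l k time hP.append_left hs.1 (by omega) hok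
    have hP₂ := hP.append_right
    rw [Stmt.length_compile] at hP₂
    obtain ⟨hok₂, t₂, ht₂, hp₂⟩ := ih₂ (l + s.len) (k + s.len) t₁ hP₂ hs.2 (by omega) hok₁
    refine ⟨by simpa [add_assoc] using hok₂, t₂, ?_, ?_⟩
    · refine ht₂.trans ((Nat.add_le_add_right ht₁ _).trans (le_of_eq ?_))
      ring
    · rw [← add_assoc]
      exact hp₁.trans hp₂
  | @ifz_zero r s t σ σ' a hr _ ih =>
    intro l k time hP hs hk hok
    simp only [Stmt.len] at hk ⊢
    have hP₂ := hP.tail.append_right.tail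
    rw [Stmt.length_compile] at hP₂
    obtain ⟨hok₁, t₁, ht₁, hp₁⟩ := ih (l + 1 + t.len + 1) k (time + 1) hP₂ hs.1 (by omega) hok
    refine ⟨hok₁.mono (by omega), t₁, ht₁.trans ?_, ?_⟩
    · have : 1 ≤ L.instrTime := by unfold instrTime; omega
      nlinarith
    · rw [show l + (s.len + t.len + 2) = l + 1 + t.len + 1 + s.len by omega]
      refine Relation.ReflTransGen.head ⟨step_jumpZero hP.head, hok.le_space (by omega)⟩ ?_
      rw [if_pos hr]
      exact hp₁
  | @ifz_pos r s t σ σ' a hr _ ih =>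
    intro l k time hP hs hk hok
    simp only [Stmt.len] at hk ⊢
    have hPt := hP.tail
    obtain ⟨hok₁, t₁, ht₁, hp₁⟩ := ih (l + 1) k (time + 1) hPt.append_left hs.2 (by omega) hok
    have hj := hPt.append_right.head
    rw [Stmt.length_compile] at hj
    refine ⟨hok₁.mono (by omega), t₁ + 1, ?_, ?_⟩
    · have : 1 ≤ L.instrTime := by unfold instrTime; omega
      nlinarith
    · rw [show l + (s.len + t.len + 2) = l + 1 + t.len + 1 + s.len by omega]
      refine Relation.ReflTransGen.head ⟨step_jumpZero hP.head, hok.le_space (by omega)⟩ ?_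
      rw [if_neg hr]
      exact hp₁.tail ⟨step_jump hj, hok₁.le_space (by omega)⟩
  | @loop_done r s σ hQ hr =>
    intro l k time hP hs hk hok
    simp only [Stmt.len] at hk ⊢
    refine ⟨hok.mono (by omega), time + 1, ?_, ?_⟩
    · have : 1 ≤ L.instrTime := by unfold instrTime; omega
      nlinarith
    · refine Relation.ReflTransGen.single ⟨?_, hok.le_space (by omega)⟩
      rw [step_jumpZero hP.head, if_pos hr]
      simp only [add_assoc, add_left_comm 1, Nat.reduceAdd]
  | @loop_step r s σ₁ σ₂ σ₃ a b hQ hr _ h₂ ih₁ ih₂ =>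
    intro l k time hP hs hk hok
    simp only [Stmt.len] at hk ih₂ ⊢
    -- The condition at the test resets the instruction counter to `0`. Without this the bound `2 ^
    -- k` on the growth would accumulate over the iterations.
    have hok0 : L.Ok 0 σ₁ := hQ.ok hok.input_le
    have hPt := hP.tail
    have hj := hPt.append_right.head
    rw [Stmt.length_compile] at hj
    obtain ⟨hok₁, t₁, ht₁, hp₁⟩ := ih₁ (l + 1) 0 (time + 1) hPt.append_left hs (by omega) hok0
    -- Either way of running the remaining loop begins with a test.
    have hQ₂ : L.Check σ₂ := by cases h₂ <;> assumption
    obtain ⟨hok₂, t₂, ht₂, hp₂⟩ :=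
      ih₂ l 0 (t₁ + 1) hP hs (by omega) (hQ₂.ok hok₁.input_le)
    refine ⟨hok₂.mono (by omega), t₂, ?_, ?_⟩
    -- The test, the body and the jump back are charged to this one test, whose budget is `N`
    -- instructions.
    · have : (s.len + 2) * L.instrTime ≤ L.N * L.instrTime :=
        Nat.mul_le_mul_right _ (by omega)
      have : 1 ≤ L.instrTime := by unfold instrTime; omega
      nlinarith
    · refine Relation.ReflTransGen.head ⟨step_jumpZero hP.head, hok.le_space (by omega)⟩ ?_
      rw [if_neg hr]
      exact (hp₁.tail ⟨step_jump hj, hok₁.le_space (by omega)⟩).trans hp₂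

lemma Path.reaches {P : Program} {B : ℕ} {c c' : Config} (h : Path P B c c') :
    StateTransition.Reaches (step P) c c' :=
  Relation.ReflTransGen.mono (r := fun a b => step P a = some b ∧ b.space ≤ B)
    (fun _ _ hab => hab.1) _ _ h

/-- The machine is deterministic, so every reachable configuration lies on the path to the halting
one. -/
lemma Path.space_le {P : Program} {B : ℕ} {c c' : Config} (h : Path P B c c')
    (hc' : step P c' = none) :
    c.space ≤ B → ∀ x, StateTransition.Reaches (step P) c x → x.space ≤ B := by
  induction h using Relation.ReflTransGen.head_induction_on with
  | refl =>
    intro hB x hx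
    rcases Relation.ReflTransGen.cases_head hx with rfl | ⟨y, hy, _⟩
    · exact hB
    · simp [hc'] at hy
  | head hab _ ih =>
    intro hB x hx
    rcases Relation.ReflTransGen.cases_head hx with rfl | ⟨y, hy, hyx⟩
    · exact hB
    · rw [Option.mem_def, hab.1, Option.some_inj] at hy
      subst hy
      exact ih hab.2 x hyx

/-- A terminating run of a structured program, for the compiled program. -/
theorem Stmt.BigStep.haltsIn {L : Limits} {s : Stmt} {w : List ℕ} {σ' : St} {t : ℕ}
    (h : s.BigStep L.Check ⟨0, w, []⟩ t σ') (hs : s.Straight L.c) (hN : s.len = L.N)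
    (hw : ∀ v ∈ w, v.size ≤ L.M) :
    (∃ c : Config, HaltsIn (s.compile 0) w c ∧ c.out = σ'.out ∧
      c.time ≤ (L.N + t * L.N) * L.instrTime) ∧
    ∀ c : Config, StateTransition.Reaches (step (s.compile 0)) (start w) c →
      c.space ≤ L.space := by
  have hok : L.Ok 0 ⟨0, w, []⟩ := ⟨by simp, by simp [regSpace], hw⟩
  obtain ⟨_, time, ht, hp⟩ := h.path (P := s.compile 0) 0 0 0 ⟨[], [], by simp, rfl⟩ hs (by omega) hok
  -- The program stops by running past its last line.
  have hnone : step (s.compile 0) (σ'.toConfig (0 + s.len) time) = none := by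
    simp [step, St.toConfig, Stmt.length_compile]
  refine ⟨⟨_, ⟨hp.reaches, hnone⟩, rfl, ?_⟩, hp.space_le hnone (hok.le_space (by omega))⟩
  simpa [St.toConfig, hN] using ht

end RAM

/-! ### Codes of terms -/

/-- For a set `S` of codes of terms on `i + 1` variables, the set of codes on `i` variables of the
terms in which the last variable does not occur (digit `0`), or only as the literal with digit `d`,
with this literal removed. -/
def restrict (i d : ℕ) (S : Finset ℕ) : Finset ℕ :=
  (S.filter fun c => c / 3 ^ i = 0 ∨ c / 3 ^ i = d).image (· % 3 ^ i)

lemma mem_restrict {i d q : ℕ} {S : Finset ℕ} :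
    q ∈ restrict i d S ↔ ∃ c ∈ S, (c / 3 ^ i = 0 ∨ c / 3 ^ i = d) ∧ c % 3 ^ i = q := by
  simp [restrict, and_assoc]

@[simp] lemma restrict_empty (i d : ℕ) : restrict i d ∅ = ∅ := by simp [restrict]

lemma restrict_lt {i d q : ℕ} {S : Finset ℕ} (h : q ∈ restrict i d S) : q < 3 ^ i := by
  obtain ⟨c, _, _, rfl⟩ := mem_restrict.1 h
  exact Nat.mod_lt _ (by positivity)

lemma card_restrict_le (i d : ℕ) (S : Finset ℕ) : (restrict i d S).card ≤ S.card :=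
  Finset.card_image_le.trans (Finset.card_filter_le _ _)

/-- The words output for the terms with codes in `S` on `i` variables, where `u` gives the values
of the other variables. -/
def modelWords (n : ℕ) : ℕ → Finset ℕ → (ℕ → ℕ) → List (List ℕ)
  | 0, S, u => if S = ∅ then [] else [(List.range n).map u]
  | i + 1, S, u => modelWords n i (restrict i 1 S) (Function.update u i 0) ++
      modelWords n i (restrict i 2 S) (Function.update u i 1)

/-- The number of models on `i` variables. -/
def modelCount : ℕ → Finset ℕ → ℕ
  | 0, S => if S = ∅ then 0 else 1
  | i + 1, S => modelCount i (restrict i 1 S) + modelCount i (restrict i 2 S)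

/-- The values `v` satisfy the term with code `c` on `i` variables. -/
def CodeSat : ℕ → ℕ → (ℕ → ℕ) → Prop
  | 0, _, _ => True
  | i + 1, c, v => (c / 3 ^ i = 0 ∨ c / 3 ^ i = v i + 1) ∧ CodeSat i (c % 3 ^ i) v

/-- A bound for the number of loop iterations spent on a set of codes on `i` variables. -/
def workBound : ℕ → Finset ℕ → ℕ
  | 0, S => if S = ∅ then 0 else 1
  | i + 1, S => if S = ∅ then 0 else
      S.card + 3 + workBound i (restrict i 1 S) + workBound i (restrict i 2 S)

@[simp] lemma modelWords_empty (n i : ℕ) (u : ℕ → ℕ) : modelWords n i ∅ u = [] := by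
  induction i generalizing u with
  | zero => simp [modelWords]
  | succ i ih => simp [modelWords, ih]

@[simp] lemma workBound_empty (i : ℕ) : workBound i ∅ = 0 := by
  cases i <;> simp [workBound]

lemma length_modelWords (n i : ℕ) (S : Finset ℕ) (u : ℕ → ℕ) :
    (modelWords n i S u).length = modelCount i S := by
  induction i generalizing S u with
  | zero => simp only [modelWords, modelCount]; split_ifs <;> rfl
  | succ i ih => simp [modelWords, modelCount, ih]

/-- Positions below `i` are overwritten along the recursion before a word is formed. This makes
stale values in the memory harmless. -/
lemma modelWords_congr {n i : ℕ} (S : Finset ℕ) {u u' : ℕ → ℕ}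
    (h : ∀ j, i ≤ j → j < n → u j = u' j) : modelWords n i S u = modelWords n i S u' := by
  induction i generalizing S u u' with
  | zero =>
    simp only [modelWords]
    rw [List.map_congr_left fun j hj => h j (Nat.zero_le _) (by simpa using hj)]
  | succ i ih =>
    simp only [modelWords]
    congr 1 <;>
    · refine ih _ fun j hj hn => ?_
      rcases eq_or_ne j i with rfl | hji
      · simp
      · simpa [hji] using h j (by omega) hn

lemma mem_modelWords {n i : ℕ} {S : Finset ℕ} {u : ℕ → ℕ} {y : List ℕ} :
    y ∈ modelWords n i S u ↔ ∃ v : ℕ → ℕ, (∀ j < i, v j ≤ 1) ∧ (∀ j, i ≤ j → v j = u j) ∧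
      (∃ c ∈ S, CodeSat i c v) ∧ y = (List.range n).map v := by
  induction i generalizing S u with
  | zero =>
    simp only [modelWords]
    constructor
    · intro h
      split_ifs at h with hS
      · simp at h
      · obtain ⟨c, hc⟩ := Finset.nonempty_iff_ne_empty.2 hS
        exact ⟨u, by simp, by simp, ⟨c, hc, trivial⟩, by simpa using h⟩
    · rintro ⟨v, _, hv, ⟨c, hc, _⟩, rfl⟩
      have hvu : v = u := funext fun j => hv j (Nat.zero_le _)
      rw [if_neg (Finset.ne_empty_of_mem hc)]
      simp [hvu]
  | succ i ih =>
    -- Digit `b + 1` is the literal that value `b` makes true, so this branch collects the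
    -- assignments with value `b` at position `i`.
    have key : ∀ b : ℕ, b ≤ 1 → (y ∈ modelWords n i (restrict i (b + 1) S) (Function.update u i b) ↔
        ∃ v : ℕ → ℕ, v i = b ∧ (∀ j < i + 1, v j ≤ 1) ∧ (∀ j, i + 1 ≤ j → v j = u j) ∧
          (∃ c ∈ S, CodeSat (i + 1) c v) ∧ y = (List.range n).map v) := by
      intro b hb
      rw [ih]
      refine exists_congr fun v => ?_
      constructor
      · rintro ⟨h1, h2, ⟨q, hq, hs⟩, rfl⟩
        have hvi : v i = b := by simpa using h2 i le_rfl
        obtain ⟨c, hc, hd, rfl⟩ := mem_restrict.1 hq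
        refine ⟨hvi, fun j hj => ?_, fun j hj => ?_, ⟨c, hc, ?_, hs⟩, rfl⟩
        · rcases Nat.lt_succ_iff_lt_or_eq.1 hj with hj | rfl
          · exact h1 j hj
          · omega
        · have := h2 j (by omega)
          rwa [Function.update_of_ne (by omega)] at this
        · rwa [hvi]
      · rintro ⟨hvi, h1, h2, ⟨c, hc, hd, hs⟩, rfl⟩
        refine ⟨fun j hj => h1 j (by omega), fun j hj => ?_,
          ⟨_, mem_restrict.2 ⟨c, hc, ?_, rfl⟩, hs⟩, rfl⟩
        · rcases eq_or_ne j i with rfl | hji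
          · simpa using hvi
          · rw [Function.update_of_ne hji]; exact h2 j (by omega)
        · rwa [hvi] at hd
    simp only [modelWords, List.mem_append]
    rw [key 0 (by omega), key 1 le_rfl, ← exists_or]
    refine exists_congr fun v => ?_
    constructor
    · rintro (⟨_, h⟩ | ⟨_, h⟩) <;> exact h
    · intro h
      have := h.1 i (by omega)
      rcases (by omega : v i = 0 ∨ v i = 1) with h0 | h0
      · exact Or.inl ⟨h0, h⟩
      · exact Or.inr ⟨h0, h⟩

/-- Words from the two branches differ at the position branched on; `i ≤ n` guarantees that this
position belongs to the word. -/
lemma nodup_modelWords {n i : ℕ} (hi : i ≤ n) (S : Finset ℕ) (u : ℕ → ℕ) :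
    (modelWords n i S u).Nodup := by
  induction i generalizing S u with
  | zero => simp only [modelWords]; split_ifs <;> simp
  | succ i ih =>
    refine List.Nodup.append (ih (by omega) _ _) (ih (by omega) _ _) ?_
    intro y h1 h2
    obtain ⟨v, _, hv, _, rfl⟩ := mem_modelWords.1 h1
    obtain ⟨v', _, hv', _, h⟩ := mem_modelWords.1 h2
    have h3 := List.map_inj_left.1 h i (by simpa using hi)
    rw [hv i le_rfl, hv' i le_rfl] at h3
    simp at h3

/-! ### The number of models of a formula with `m` terms is at least `m ^ (log 2 / log 3)` -/

lemma logb_three_two_pos : 0 < Real.logb 3 2 := Real.logb_pos (by norm_num) (by norm_num)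

lemma logb_three_two_lt_one : Real.logb 3 2 < 1 := by
  rw [Real.logb_lt_iff_lt_rpow (by norm_num) (by norm_num)]; norm_num

/-- The defining property `3 ^ γ = 2` of the exponent. -/
lemma three_mul_rpow {b : ℝ} (hb : 0 ≤ b) :
    (3 * b) ^ Real.logb 3 2 = 2 * b ^ Real.logb 3 2 := by
  rw [Real.mul_rpow (by norm_num) hb, Real.rpow_logb (by norm_num) (by norm_num) (by norm_num)]

/-- The points `a` and `3b` lie between `b` and `a + 2b` and have the same sum as these, so a
concave `f` satisfies `f b + f (a + 2b) ≤ f a + f (3b)`. For `f = (·) ^ γ` the last term is `2 f b`.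
Equality holds at `a = b` and at `b = 0`. -/
lemma add_two_mul_rpow_le {a b : ℝ} (hb : 0 ≤ b) (hab : b ≤ a) :
    (a + 2 * b) ^ Real.logb 3 2 ≤ a ^ Real.logb 3 2 + b ^ Real.logb 3 2 := by
  rcases hb.eq_or_lt with rfl | hb0
  · simp [Real.zero_rpow logb_three_two_pos.ne']
  have hc := (Real.concaveOn_rpow logb_three_two_pos.le logb_three_two_lt_one.le).2
  set γ := Real.logb 3 2 with hγ
  have hd : 0 < a + b := by linarith
  -- The weight for which `a = (1 - s) b + s (a + 2b)`; with the weights exchanged one gets `3b`.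
  set s := (a - b) / (a + b) with hs
  have hs0 : 0 ≤ s := div_nonneg (by linarith) hd.le
  have hs1 : s ≤ 1 := by rw [hs, div_le_one hd]; linarith
  have hsd : s * (a + b) = a - b := by rw [hs]; field_simp
  have h1 := hc (x := b) (y := a + 2 * b) (Set.mem_Ici.2 hb) (Set.mem_Ici.2 (by linarith))
    (a := 1 - s) (b := s) (by linarith) hs0 (by ring)
  have h2 := hc (x := b) (y := a + 2 * b) (Set.mem_Ici.2 hb) (Set.mem_Ici.2 (by linarith))
    (a := s) (b := 1 - s) hs0 (by linarith) (by ring)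
  simp only [smul_eq_mul] at h1 h2
  rw [show (1 - s) * b + s * (a + 2 * b) = a by linear_combination hsd] at h1
  rw [show s * b + (1 - s) * (a + 2 * b) = 3 * b by linear_combination -hsd,
    three_mul_rpow hb] at h2
  linarith

/-- Removing the top digit is injective on codes that share it; duplicates arise only between codes
with top digits `0` and `d`. -/
lemma card_filter_le_card_restrict (i d e : ℕ) (S : Finset ℕ) (he : e = 0 ∨ e = d) :
    (S.filter fun c => c / 3 ^ i = e).card ≤ (restrict i d S).card := by
  refine Finset.card_le_card_of_injOn (· % 3 ^ i) (fun c hc => ?_) fun x hx y hy hxy => ?_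
  · obtain ⟨hcS, hce⟩ := Finset.mem_filter.1 hc
    exact mem_restrict.2 ⟨c, hcS, by omega, rfl⟩
  · rw [← Nat.div_add_mod x (3 ^ i), ← Nat.div_add_mod y (3 ^ i),
      show x % 3 ^ i = y % 3 ^ i from hxy, (Finset.mem_filter.1 hx).2, (Finset.mem_filter.1 hy).2]

lemma rpow_card_le_modelCount {i : ℕ} {S : Finset ℕ} (hS : ∀ c ∈ S, c < 3 ^ i) :
    (S.card : ℝ) ^ Real.logb 3 2 ≤ modelCount i S := by
  induction i generalizing S with
  | zero =>
    simp only [modelCount]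
    split_ifs with h
    · simp [h, Real.zero_rpow logb_three_two_pos.ne']
    · have hS1 : S.card ≤ 1 := Finset.card_le_one.2 fun a ha b hb => by
        have := hS a ha; have := hS b hb; omega
      have : (S.card : ℝ) ≤ 1 := by exact_mod_cast hS1
      simpa using Real.rpow_le_one (by positivity) this logb_three_two_pos.le
  | succ i ih =>
    have h1 := ih (S := restrict i 1 S) fun c hc => restrict_lt hc
    have h2 := ih (S := restrict i 2 S) fun c hc => restrict_lt hc
    have h01 := card_filter_le_card_restrict i 1 0 S (by simp)
    have h11 := card_filter_le_card_restrict i 1 1 S (by simp)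
    have h02 := card_filter_le_card_restrict i 2 0 S (by simp)
    have h22 := card_filter_le_card_restrict i 2 2 S (by simp)
    -- With `A` and `B` the sizes of the restrictions, the class of digit `0` is bounded by both,
    -- that of digit `1` by `A` and that of digit `2` by `B`. So the total is at most `A + 2B` and
    -- also at most `B + 2A`.
    have hcard : S.card = (S.filter fun c => c / 3 ^ i = 0).card +
        (S.filter fun c => c / 3 ^ i = 1).card + (S.filter fun c => c / 3 ^ i = 2).card := by
      rw [Finset.card_eq_sum_card_fiberwise (f := fun c => c / 3 ^ i) (t := Finset.range 3)]
      · simp [Finset.sum_range_succ]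
      · intro c hc
        have := hS c hc
        simp only [Finset.coe_range, Set.mem_Iio]
        rw [Nat.div_lt_iff_lt_mul (by positivity)]
        rw [pow_succ] at this; omega
    simp only [modelCount, Nat.cast_add]
    refine le_trans ?_ (add_le_add h1 h2)
    generalize (restrict i 1 S).card = A at *
    generalize (restrict i 2 S).card = B at *
    rcases le_total B A with hBA | hAB
    · refine le_trans (Real.rpow_le_rpow (by positivity) ?_ logb_three_two_pos.le)
        (add_two_mul_rpow_le (Nat.cast_nonneg B) (Nat.cast_le.2 hBA))
      norm_cast
      omega
    · rw [add_comm ((A : ℝ) ^ _)]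
      refine le_trans (Real.rpow_le_rpow (by positivity) ?_ logb_three_two_pos.le)
        (add_two_mul_rpow_le (Nat.cast_nonneg A) (Nat.cast_le.2 hAB))
      norm_cast
      omega

/-- Split `|S| = |S|^(1-γ) * |S|^γ` and bound the factors by `m` and by the number of models. This
charges the cost of a node to the models below it. -/
lemma card_le_rpow_mul_modelCount {i m : ℕ} {S : Finset ℕ} (hS : ∀ c ∈ S, c < 3 ^ i)
    (hm : S.card ≤ m) :
    (S.card : ℝ) ≤ (m : ℝ) ^ (1 - Real.logb 3 2) * modelCount i S := by
  rcases S.eq_empty_or_nonempty with rfl | hne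
  · simp; positivity
  have hc : (0 : ℝ) < S.card := by exact_mod_cast hne.card_pos
  calc (S.card : ℝ) = (S.card : ℝ) ^ (1 - Real.logb 3 2) * (S.card : ℝ) ^ Real.logb 3 2 := by
        rw [← Real.rpow_add hc]; simp
    _ ≤ _ := by
        refine mul_le_mul (Real.rpow_le_rpow hc.le (by exact_mod_cast hm) ?_)
          (rpow_card_le_modelCount hS) (by positivity) (by positivity)
        linarith [logb_three_two_lt_one]

/-- Each level contributes one share `4 m^(1-γ) * modelCount`, since the model counts of the two
branches add up to that of the node. -/
lemma workBound_le {i m : ℕ} {S : Finset ℕ} (hS : ∀ c ∈ S, c < 3 ^ i) (hm : S.card ≤ m) :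
    (workBound i S : ℝ) ≤ 4 * (i + 1) * ((m : ℝ) ^ (1 - Real.logb 3 2) * modelCount i S) := by
  induction i generalizing S with
  | zero =>
    have h := card_le_rpow_mul_modelCount hS hm
    have : workBound 0 S ≤ S.card := by
      simp only [workBound]
      split_ifs with h0
      · omega
      · exact (Finset.nonempty_iff_ne_empty.2 h0).card_pos
    have : (workBound 0 S : ℝ) ≤ S.card := by exact_mod_cast this
    have : (0 : ℝ) ≤ S.card := by positivity
    simp only [Nat.cast_zero]
    linarith
  | succ i ih =>
    have h := card_le_rpow_mul_modelCount hS hm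
    have h1 := ih (S := restrict i 1 S) (fun c hc => restrict_lt hc)
      ((card_restrict_le i 1 S).trans hm)
    have h2 := ih (S := restrict i 2 S) (fun c hc => restrict_lt hc)
      ((card_restrict_le i 2 S).trans hm)
    by_cases h0 : S = ∅
    · subst h0; simp only [workBound_empty, Nat.cast_zero]; positivity
    -- Since `S` is nonempty, `|S| + 3 ≤ 4 |S|`; this is where the factor `4` comes from.
    have hpos : (1 : ℝ) ≤ S.card := by
      exact_mod_cast (Finset.nonempty_iff_ne_empty.2 h0).card_pos
    simp only [workBound, if_neg h0, modelCount] at h ⊢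
    push_cast at h ⊢
    nlinarith

/-! ### The code of a term -/

/-- The number with ternary digits `d 0, …, d (i - 1)`. -/
def digitCode (i : ℕ) (d : ℕ → ℕ) : ℕ := ∑ j ∈ Finset.range i, d j * 3 ^ j

section

variable {d : ℕ → ℕ} (hd : ∀ j, d j ≤ 2)

include hd

lemma digitCode_lt (i : ℕ) : digitCode i d < 3 ^ i := by
  induction i with
  | zero => simp [digitCode]
  | succ i ih =>
    rw [digitCode, Finset.sum_range_succ, ← digitCode, pow_succ]
    nlinarith [hd i]

lemma digitCode_succ_div (i : ℕ) : digitCode (i + 1) d / 3 ^ i = d i := by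
  rw [digitCode, Finset.sum_range_succ, ← digitCode, Nat.add_mul_div_right _ _ (by positivity),
    Nat.div_eq_of_lt (digitCode_lt hd i), zero_add]

lemma digitCode_succ_mod (i : ℕ) : digitCode (i + 1) d % 3 ^ i = digitCode i d := by
  rw [digitCode, Finset.sum_range_succ, ← digitCode, Nat.add_mul_mod_self_right,
    Nat.mod_eq_of_lt (digitCode_lt hd i)]

lemma codeSat_digitCode (i : ℕ) (v : ℕ → ℕ) :
    CodeSat i (digitCode i d) v ↔ ∀ j < i, d j = 0 ∨ d j = v j + 1 := by
  induction i with
  | zero => simp [CodeSat]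
  | succ i ih =>
    rw [CodeSat, digitCode_succ_div hd, digitCode_succ_mod hd, ih, Nat.forall_lt_succ_right,
      and_comm]

lemma digitCode_inj {d' : ℕ → ℕ} (hd' : ∀ j, d' j ≤ 2) {i : ℕ}
    (h : digitCode i d = digitCode i d') : ∀ j < i, d j = d' j := by
  induction i with
  | zero => simp
  | succ i ih =>
    rw [Nat.forall_lt_succ_right]
    refine ⟨ih ?_, ?_⟩
    · rw [← digitCode_succ_mod hd, h, digitCode_succ_mod hd']
    · rw [← digitCode_succ_div hd, h, digitCode_succ_div hd']

end

/-- The contribution of a literal to the code of a term. -/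
def Literal.code {n : ℕ} (l : Literal n) : ℕ := 3 ^ (l.1 : ℕ) * (1 + l.2.toNat)

/-- The code of a set of literals. -/
def literalsCode {n : ℕ} (T : Finset (Literal n)) : ℕ := ∑ l ∈ T, l.code

/-- The digit of the code of a set of literals at the variable `x_j`. -/
def literalsDigit {n : ℕ} (T : Finset (Literal n)) (j : ℕ) : ℕ :=
  ∑ l ∈ T with (l.1 : ℕ) = j, (1 + l.2.toNat)

lemma literalsCode_eq {n : ℕ} (T : Finset (Literal n)) :
    literalsCode T = digitCode n (literalsDigit T) := by
  unfold literalsCode digitCode literalsDigit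
  rw [← Finset.sum_fiberwise_of_maps_to (s := T) (t := Finset.range n) (g := fun l => (l.1 : ℕ))
    (fun l _ => by simp)]
  refine Finset.sum_congr rfl fun j _ => ?_
  rw [Finset.sum_mul]
  refine Finset.sum_congr rfl fun l hl => ?_
  rw [Literal.code, (Finset.mem_filter.1 hl).2, mul_comm]

section

variable {n : ℕ} {T : Finset (Literal n)} (hT : Set.InjOn Prod.fst (T : Set (Literal n)))

include hT

lemma filter_literal_eq {l : Literal n} (hl : l ∈ T) :
    (T.filter fun l' => (l'.1 : ℕ) = l.1) = {l} := by
  ext l'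
  simp only [Finset.mem_filter, Finset.mem_singleton]
  refine ⟨fun h => hT h.1 hl (Fin.ext h.2), ?_⟩
  rintro rfl
  exact ⟨hl, rfl⟩

lemma literalsDigit_of_mem {l : Literal n} (hl : l ∈ T) :
    literalsDigit T l.1 = 1 + l.2.toNat := by
  rw [literalsDigit, filter_literal_eq hT hl, Finset.sum_singleton]

omit hT in
lemma exists_mem_of_literalsDigit_ne_zero {j : ℕ} (h : literalsDigit T j ≠ 0) :
    ∃ l ∈ T, (l.1 : ℕ) = j := by
  obtain ⟨l, hl, _⟩ := Finset.exists_ne_zero_of_sum_ne_zero h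
  exact ⟨l, Finset.mem_filter.1 hl⟩

lemma literalsDigit_le (j : ℕ) : literalsDigit T j ≤ 2 := by
  by_cases h : literalsDigit T j = 0
  · omega
  obtain ⟨l, hl, rfl⟩ := exists_mem_of_literalsDigit_ne_zero h
  rw [literalsDigit_of_mem hT hl]
  have := Bool.toNat_le l.2
  omega

/-- As a variable carries at most one literal, its digit shows whether it occurs and with which
sign. Hence the code determines the term. -/
lemma mem_iff_literalsDigit (l : Literal n) :
    l ∈ T ↔ literalsDigit T l.1 = 1 + l.2.toNat := by
  refine ⟨literalsDigit_of_mem hT, fun h => ?_⟩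
  obtain ⟨l', hl', hj⟩ := exists_mem_of_literalsDigit_ne_zero (T := T) (j := l.1) (by omega)
  rw [← hj, literalsDigit_of_mem hT hl'] at h
  have h2 : l'.2 = l.2 := by
    revert h; cases l'.2 <;> cases l.2 <;> simp
  rwa [← Prod.ext (Fin.ext hj) h2]

lemma literalsCode_lt : literalsCode T < 3 ^ n := by
  rw [literalsCode_eq]; exact digitCode_lt (literalsDigit_le hT) n

lemma literalsCode_inj {T' : Finset (Literal n)}
    (hT' : Set.InjOn Prod.fst (T' : Set (Literal n))) (h : literalsCode T = literalsCode T') :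
    T = T' := by
  rw [literalsCode_eq, literalsCode_eq] at h
  have h' := digitCode_inj (literalsDigit_le hT) (literalsDigit_le hT') h
  ext l
  rw [mem_iff_literalsDigit hT, mem_iff_literalsDigit hT', h' l.1 l.1.2]

lemma codeSat_literalsCode {v : ℕ → ℕ} {α : Fin n → Bool} (hv : ∀ j : Fin n, v j = (α j).toNat) :
    CodeSat n (literalsCode T) v ↔ ∀ l ∈ T, Literal.value α l = true := by
  rw [literalsCode_eq, codeSat_digitCode (literalsDigit_le hT)]
  constructor
  · intro h l hl
    have h1 := h l.1 l.1.2
    rw [literalsDigit_of_mem hT hl, hv] at h1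
    unfold Literal.value
    revert h1
    cases l.2 <;> cases α l.1 <;> simp
  · intro h j hj
    by_cases h0 : literalsDigit T j = 0
    · exact Or.inl h0
    obtain ⟨l, hl, rfl⟩ := exists_mem_of_literalsDigit_ne_zero h0
    have h1 := h l hl
    right
    rw [literalsDigit_of_mem hT hl, hv]
    unfold Literal.value at h1
    revert h1
    cases l.2 <;> cases α l.1 <;> simp

end

/-! ### Families of linked lists in the memory -/

/-- The address of the cell for the code `q` in the list `p`. -/
def cellAddr (K : ℕ) (p : ℕ × Bool) (q : ℕ) : ℕ := (K + p.2.toNat) * 3 ^ p.1 + q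

lemma le_cellAddr (K : ℕ) (p : ℕ × Bool) (q : ℕ) : K ≤ cellAddr K p q := by
  have : 1 ≤ 3 ^ p.1 := Nat.one_le_pow _ _ (by norm_num)
  unfold cellAddr
  nlinarith

lemma cellAddr_lt {K n : ℕ} {p : ℕ × Bool} {q : ℕ} (hq : q < 3 ^ p.1) (hp : p.1 ≤ n) :
    cellAddr K p q < (K + 2) * 3 ^ n := by
  have h1 : 3 ^ p.1 ≤ 3 ^ n := Nat.pow_le_pow_right (by norm_num) hp
  have h2 := Bool.toNat_le p.2
  unfold cellAddr
  nlinarith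

/-- Level `i` occupies the addresses from `K * 3^i` to below `(K + 2) * 3^i ≤ K * 3^(i+1)`, so
different levels are disjoint. Within a level, division by `3^i` recovers the flag and the remainder
is the code. -/
lemma cellAddr_inj {K : ℕ} (hK : 2 ≤ K) {p p' : ℕ × Bool} {q q' : ℕ} (hq : q < 3 ^ p.1)
    (hq' : q' < 3 ^ p'.1) (h : cellAddr K p q = cellAddr K p' q') : p = p' ∧ q = q' := by
  have key : ∀ {p p' : ℕ × Bool} {q q' : ℕ}, q < 3 ^ p.1 → p.1 < p'.1 →
      cellAddr K p q ≠ cellAddr K p' q' := by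
    intro p p' q q' hq hp
    have h1 := cellAddr_lt (K := K) hq le_rfl
    have h2 : 3 ^ (p.1 + 1) ≤ 3 ^ p'.1 := Nat.pow_le_pow_right (by norm_num) hp
    rw [pow_succ] at h2
    have h3 : K * 3 ^ p'.1 ≤ cellAddr K p' q' := by unfold cellAddr; nlinarith
    have h4 : (K + 2) * 3 ^ p.1 ≤ K * 3 ^ p'.1 := by nlinarith
    omega
  rcases lt_trichotomy p.1 p'.1 with hlt | heq | hlt
  · exact (key hq hlt h).elim
  · rw [← heq] at hq'
    unfold cellAddr at h
    rw [← heq] at h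
    have h1 := congrArg (· / 3 ^ p.1) h
    have h2 := congrArg (· % 3 ^ p.1) h
    simp only [Nat.mul_add_mod_self_right, Nat.mod_eq_of_lt hq, Nat.mod_eq_of_lt hq'] at h2
    have hpos : 0 < 3 ^ p.1 := by positivity
    simp only [add_comm _ q, add_comm _ q', Nat.add_mul_div_right _ _ hpos,
      Nat.div_eq_of_lt hq, Nat.div_eq_of_lt hq'] at h1
    refine ⟨Prod.ext heq ?_, h2⟩
    have h3 : p.2.toNat = p'.2.toNat := by omega
    revert h3
    cases p.2 <;> cases p'.2 <;> simp
  · exact (key hq' hlt h.symm).elim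

/-- The pointer `h` leads to the cells with addresses `l`, one after the other; a cell contains the
pointer to the next one plus `1`, and the last one the pointer `0`. -/
def Chain (r : ℕ → ℕ) : ℕ → List ℕ → Prop
  | h, [] => h = 0
  | h, a :: l => h = a ∧ r a ≠ 0 ∧ Chain r (r a - 1) l

lemma Chain.congr {r r' : ℕ → ℕ} {l : List ℕ} (h : ∀ a ∈ l, r' a = r a) :
    ∀ {p : ℕ}, Chain r p l → Chain r' p l := by
  induction l with
  | nil => exact id
  | cons a l ih =>
    rintro p ⟨rfl, h1, h2⟩
    have ha := h p (by simp)
    exact ⟨rfl, by rwa [ha], by rw [ha]; exact ih (fun b hb => h b (by simp [hb])) h2⟩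

lemma Chain.ne_zero {r : ℕ → ℕ} {l : List ℕ} : ∀ {p : ℕ}, Chain r p l → ∀ a ∈ l, r a ≠ 0 := by
  induction l with
  | nil => simp
  | cons a l ih =>
    rintro p ⟨_, h1, h2⟩ b hb
    rcases List.mem_cons.1 hb with rfl | hb
    · exact h1
    · exact ih h2 b hb

/-- In the memory `r`, for each `p` with `p.1 ≤ n` the pointer `hd p` leads to a linked list of
the cells for the codes in `F p`, and all other registers from number `K` on contain `0`. -/
structure Heap (n K : ℕ) (r : ℕ → ℕ) (hd : ℕ × Bool → ℕ) (F : ℕ × Bool → Finset ℕ) : Prop where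
  chain : ∀ p : ℕ × Bool, p.1 ≤ n →
    ∃ l : List ℕ, l.Nodup ∧ l.toFinset = F p ∧ Chain r (hd p) (l.map (cellAddr K p))
  lt : ∀ p, ∀ q ∈ F p, q < 3 ^ p.1 ∧ p.1 ≤ n
  supp : ∀ x, K ≤ x → r x ≠ 0 → ∃ p, ∃ q ∈ F p, x = cellAddr K p q

namespace Heap

variable {n K : ℕ} {r r' : ℕ → ℕ} {hd hd' : ℕ × Bool → ℕ} {F : ℕ × Bool → Finset ℕ}

lemma congr (h : Heap n K r hd F) (hr : ∀ x, K ≤ x → r' x = r x)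
    (hhd : ∀ p : ℕ × Bool, p.1 ≤ n → hd' p = hd p) : Heap n K r' hd' F := by
  refine ⟨fun p hp => ?_, h.lt, fun x hx h0 => h.supp x hx (by rwa [hr x hx] at h0)⟩
  obtain ⟨l, h1, h2, h3⟩ := h.chain p hp
  rw [hhd p hp]
  refine ⟨l, h1, h2, h3.congr fun a ha => ?_⟩
  obtain ⟨q, _, rfl⟩ := List.mem_map.1 ha
  exact hr _ (le_cellAddr K p q)

lemma head_eq_zero_iff (h : Heap n K r hd F) (hK : 2 ≤ K) {p : ℕ × Bool} (hp : p.1 ≤ n) :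
    hd p = 0 ↔ F p = ∅ := by
  obtain ⟨l, _, h2, h3⟩ := h.chain p hp
  rcases l with _ | ⟨c, l⟩
  · exact ⟨fun _ => by simpa using h2.symm, fun _ => h3⟩
  · constructor
    · intro h0
      have := h3.1
      have := le_cellAddr K p c
      omega
    · intro h0
      simp [h0] at h2

/-- Together with `cell_ne_zero` this makes one lookup a membership test. The shift by `1` of the
stored pointers keeps even the last cell of a list nonzero. -/
lemma cell_eq_zero (h : Heap n K r hd F) (hK : 2 ≤ K) {p : ℕ × Bool} {q : ℕ}
    (hq : q < 3 ^ p.1) (hqF : q ∉ F p) : r (cellAddr K p q) = 0 := by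
  by_contra h0
  obtain ⟨p', q', hq', he⟩ := h.supp _ (le_cellAddr K p q) h0
  obtain ⟨rfl, rfl⟩ := cellAddr_inj hK hq (h.lt p' q' hq').1 he
  exact hqF hq'

lemma cell_ne_zero (h : Heap n K r hd F) {p : ℕ × Bool} {q : ℕ} (hq : q ∈ F p) :
    r (cellAddr K p q) ≠ 0 := by
  obtain ⟨l, _, h2, h3⟩ := h.chain p (h.lt p q hq).2
  exact h3.ne_zero _ (List.mem_map.2 ⟨q, by rwa [← List.mem_toFinset, h2], rfl⟩)

lemma push (h : Heap n K r hd F) (hK : 2 ≤ K) {p : ℕ × Bool} {q : ℕ} (hp : p.1 ≤ n)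
    (hq : q < 3 ^ p.1) (hqF : q ∉ F p) :
    Heap n K (Function.update r (cellAddr K p q) (hd p + 1))
      (Function.update hd p (cellAddr K p q)) (Function.update F p (insert q (F p))) := by
  have hne : ∀ p' : ℕ × Bool, ∀ q' ∈ F p', cellAddr K p' q' ≠ cellAddr K p q := by
    intro p' q' hq' he
    obtain ⟨rfl, rfl⟩ := cellAddr_inj hK (h.lt p' q' hq').1 hq he
    exact hqF hq'
  have hch : ∀ p' : ℕ × Bool, p'.1 ≤ n → ∃ l : List ℕ, l.Nodup ∧ l.toFinset = F p' ∧
      Chain (Function.update r (cellAddr K p q) (hd p + 1)) (hd p')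
        (l.map (cellAddr K p')) := by
    intro p' hp'
    obtain ⟨l, h1, h2, h3⟩ := h.chain p' hp'
    refine ⟨l, h1, h2, h3.congr fun a ha => ?_⟩
    obtain ⟨q', hq', rfl⟩ := List.mem_map.1 ha
    exact Function.update_of_ne (hne p' q' (by rwa [← h2, List.mem_toFinset])) _ _
  refine ⟨fun p' hp' => ?_, fun p' q' hq' => ?_, fun x hx h0 => ?_⟩
  · rcases eq_or_ne p' p with rfl | hpp
    · obtain ⟨l, h1, h2, h3⟩ := hch p' hp'
      refine ⟨q :: l, List.nodup_cons.2 ⟨?_, h1⟩, by simp [h2], ?_⟩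
      · rwa [← List.mem_toFinset, h2]
      · simpa [Chain] using h3
    · simpa [hpp] using hch p' hp'
  · rcases eq_or_ne p' p with rfl | hpp
    · simp only [Function.update_self, Finset.mem_insert] at hq'
      rcases hq' with rfl | hq'
      · exact ⟨hq, hp⟩
      · exact h.lt p' q' hq'
    · exact h.lt p' q' (by simpa [hpp] using hq')
  · by_cases hxa : x = cellAddr K p q
    · exact ⟨p, q, by simp, hxa⟩
    · rw [Function.update_of_ne hxa] at h0
      obtain ⟨p', q', hq', he⟩ := h.supp x hx h0
      refine ⟨p', q', ?_, he⟩
      rcases eq_or_ne p' p with rfl | hpp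
      · simp [hq']
      · simpa [hpp] using hq'

/-- Clearing the cell restores the zero background, so the address range can be reused by later
lists of the same level. -/
lemma pop (h : Heap n K r hd F) (hK : 2 ≤ K) {p : ℕ × Bool} (hp : p.1 ≤ n) (h0 : hd p ≠ 0) :
    ∃ c ∈ F p, hd p = cellAddr K p c ∧
      Heap n K (Function.update r (hd p) 0) (Function.update hd p (r (hd p) - 1))
        (Function.update F p ((F p).erase c)) := by
  obtain ⟨l, h1, h2, h3⟩ := h.chain p hp
  rcases l with _ | ⟨c, l⟩
  · exact (h0 h3).elim
  obtain ⟨hc, h4, h5⟩ := h3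
  have hcF : c ∈ F p := by rw [← h2]; simp
  obtain ⟨hcl, hl⟩ := List.nodup_cons.1 h1
  have herase : l.toFinset = (F p).erase c := by
    rw [← h2, List.toFinset_cons, Finset.erase_insert (by simpa using hcl)]
  have hne : ∀ p' : ℕ × Bool, ∀ q' ∈ F p', ¬ (p' = p ∧ q' = c) →
      cellAddr K p' q' ≠ cellAddr K p c := fun p' q' hq' hn he =>
    hn (cellAddr_inj hK (h.lt p' q' hq').1 (h.lt p c hcF).1 he)
  rw [hc]
  refine ⟨c, hcF, rfl, fun p' hp' => ?_, fun p' q' hq' => ?_, fun x hx hx0 => ?_⟩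
  · rcases eq_or_ne p' p with rfl | hpp
    · refine ⟨l, hl, by simpa using herase, ?_⟩
      simp only [Function.update_self]
      refine h5.congr fun a ha => ?_
      obtain ⟨q', hq', rfl⟩ := List.mem_map.1 ha
      refine Function.update_of_ne (hne p' q' ?_ ?_) _ _
      · rw [← h2]; simp [hq']
      · rintro ⟨_, rfl⟩; exact hcl hq'
    · obtain ⟨l', h1', h2', h3'⟩ := h.chain p' hp'
      simp only [Function.update_of_ne hpp]
      refine ⟨l', h1', h2', h3'.congr fun a ha => ?_⟩
      obtain ⟨q', hq', rfl⟩ := List.mem_map.1 ha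
      exact Function.update_of_ne (hne p' q' (by rwa [← h2', List.mem_toFinset])
        fun h => hpp h.1) _ _
  · rcases eq_or_ne p' p with rfl | hpp
    · exact h.lt p' q' (Finset.mem_of_mem_erase (by simpa using hq'))
    · exact h.lt p' q' (by simpa [hpp] using hq')
  · by_cases hxa : x = cellAddr K p c
    · simp [hxa] at hx0
    · rw [Function.update_of_ne hxa] at hx0
      obtain ⟨p', q', hq', he⟩ := h.supp x hx hx0
      refine ⟨p', q', ?_, he⟩
      rcases eq_or_ne p' p with rfl | hpp
      · simp only [Function.update_self, Finset.mem_erase]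
        refine ⟨?_, hq'⟩
        rintro rfl
        exact hxa he
      · simpa [hpp] using hq'

end Heap

/-! ### The memory invariant and its space bound -/

namespace RAM

/-- A bound for the contents of all registers. -/
def maxValue (n : ℕ) : ℕ := (4 * n + 38) * 3 ^ (n + 1)

/-- The first register of the lists. -/
abbrev heapStart (n : ℕ) : ℕ := 4 * n + 36

/-- The linked lists, with bounds for the contents of the registers and the lengths of the
lists. -/
structure Mem (n m : ℕ) (r : ℕ → ℕ) (hd : ℕ × Bool → ℕ) (F : ℕ × Bool → Finset ℕ) : Prop where
  heap : Heap n (heapStart n) r hd F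
  le_maxValue : ∀ x, r x ≤ maxValue n
  card_le : ∀ p, (F p).card ≤ m

/-- The bounds for the runs of the program, where `N` is its length. -/
def limits (N n m : ℕ) : Limits where
  M := 3 * n + 8
  S := (heapStart n + 2 * (n + 1) * m) * (3 * n + 8)
  c := 6
  N := N
  c_pos := by norm_num

lemma maxValue_size_le (n : ℕ) : (maxValue n).size ≤ 3 * n + 8 := by
  rw [Nat.size_le, maxValue]
  have h1 : n < 2 ^ n := Nat.lt_two_pow_self
  have h2 : 3 ^ (n + 1) < 4 ^ (n + 1) := Nat.pow_lt_pow_left (by norm_num) (by omega)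
  have h3 : 4 ^ (n + 1) = 4 * (2 ^ n * 2 ^ n) := by
    rw [pow_succ, show 4 = 2 * 2 by rfl, mul_pow]; ring
  have h4 : 2 ^ (3 * n + 8) = (64 * 2 ^ n) * (4 * (2 ^ n * 2 ^ n)) := by
    rw [pow_add, mul_comm 3 n, pow_mul]; ring
  rw [h4, ← h3]
  exact Nat.mul_lt_mul'' (by omega) h2

/-- Nonzero registers are either below `heapStart n` or cells of one of the `2 (n + 1)` lists, each
of length at most `m`. -/
lemma Mem.check {N n m : ℕ} {σ : St} {hd : ℕ × Bool → ℕ} {F : ℕ × Bool → Finset ℕ}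
    (h : Mem n m σ.reg hd F) : (limits N n m).Check σ := by
  have hsize : ∀ x, (σ.reg x).size ≤ 3 * n + 8 := fun x =>
    (Nat.size_le_size (h.le_maxValue x)).trans (maxValue_size_le n)
  refine ⟨hsize, ?_⟩
  set ps : Finset (ℕ × Bool) := Finset.range (n + 1) ×ˢ Finset.univ
  refine (regSpace_le_card_mul σ.reg (Finset.range (heapStart n) ∪
    ps.biUnion fun p => (F p).image (cellAddr (heapStart n) p)) _ (fun x hx => ?_) hsize).trans
    (Nat.mul_le_mul_right _ ?_)
  · rw [Finset.mem_union]
    by_cases hxK : x < heapStart n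
    · exact Or.inl (Finset.mem_range.2 hxK)
    · obtain ⟨p, q, hq, rfl⟩ := h.heap.supp x (not_lt.1 hxK) hx
      refine Or.inr (Finset.mem_biUnion.2 ⟨p, ?_, Finset.mem_image_of_mem _ hq⟩)
      have := (h.heap.lt p q hq).2
      simp only [ps, Finset.mem_product, Finset.mem_range, Finset.mem_univ, and_true]
      omega
  · refine (Finset.card_union_le _ _).trans (add_le_add (by simp) ?_)
    refine (Finset.card_biUnion_le_card_mul _ _ m fun p _ =>
      Finset.card_image_le.trans (h.card_le p)).trans ?_
    simp [ps, mul_comm 2]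

end RAM

lemma restrict_insert (i d c : ℕ) (S : Finset ℕ) :
    restrict i d (insert c S) = restrict i d {c} ∪ restrict i d S := by
  rw [Finset.insert_eq, restrict, Finset.filter_union, Finset.image_union, restrict, restrict]

lemma restrict_singleton (i d c : ℕ) :
    restrict i d {c} = if c / 3 ^ i = 0 ∨ c / 3 ^ i = d then {c % 3 ^ i} else ∅ := by
  unfold restrict
  rw [Finset.filter_singleton]
  split_ifs <;> simp

lemma Heap.head_lt {n K : ℕ} {r : ℕ → ℕ} {hd : ℕ × Bool → ℕ} {F : ℕ × Bool → Finset ℕ}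
    (h : Heap n K r hd F) {p : ℕ × Bool} (hp : p.1 ≤ n) : hd p < (K + 2) * 3 ^ n := by
  obtain ⟨l, _, h2, h3⟩ := h.chain p hp
  rcases l with _ | ⟨c, l⟩
  · rw [show hd p = 0 from h3]; positivity
  · rw [show hd p = _ from h3.1]
    exact cellAddr_lt (h.lt p c (by rw [← h2]; simp)).1 hp

lemma update_le {f : ℕ → ℕ} {V a v : ℕ} (hf : ∀ x, f x ≤ V) (hv : v ≤ V) :
    ∀ x, Function.update f a v x ≤ V := by
  intro x
  rw [Function.update_apply]
  split_ifs
  exacts [hv, hf x]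

lemma ite_le_of_le {c : Prop} [Decidable c] {a b V : ℕ} (ha : a ≤ V) (hb : b ≤ V) :
    (if c then a else b) ≤ V := by
  split_ifs <;> assumption

/-! ### Inserting a code without duplicates -/

namespace RAM

open Stmt

lemma maxValue_ge (n : ℕ) : (heapStart n + 2) * 3 ^ n ≤ maxValue n ∧ heapStart n + 2 ≤ maxValue n ∧
    3 ^ (n + 1) ≤ maxValue n := by
  have : 1 ≤ 3 ^ n := Nat.one_le_pow _ _ (by norm_num)
  unfold maxValue heapStart
  rw [pow_succ]
  refine ⟨?_, ?_, ?_⟩ <;> nlinarith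

/-- Insert the code in `R_16` into the list with head `R_h` and base address `R_b`. -/
def insertCode (b h : ℕ) : Stmt :=
  .seq (.blk [.add 23 b 16, .load 17 23])
    (.ifz 17 (.blk [.add 17 h 0, .store 23 17, .copy h 23]) (.blk []))

/-- If the cell is nonzero the code is already present and nothing changes; otherwise it is pushed.
The register `h` plays the role of the head of the list. No loop is involved, so the count is `0`.
-/
lemma insertCode_run (Q : St → Prop) {n m b h q : ℕ} {σ : St} {hd : ℕ × Bool → ℕ}
    {F : ℕ × Bool → Finset ℕ} {p : ℕ × Bool} (hmem : Mem n m σ.reg hd F) (hp : p.1 ≤ n)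
    (hq : q < 3 ^ p.1) (hcard : (insert q (F p)).card ≤ m)
    (h17 : h ≠ 17) (h23 : h ≠ 23) (hh : h < 32)
    (h1 : σ.reg 0 = 1) (hrq : σ.reg 16 = q) (hrb : σ.reg b = cellAddr (heapStart n) p 0)
    (hrh : σ.reg h = hd p) :
    ∃ σ' : St, BigStep Q (insertCode b h) σ 0 σ' ∧ σ'.input = σ.input ∧ σ'.out = σ.out ∧
      Mem n m σ'.reg (Function.update hd p (σ'.reg h))
        (Function.update F p (insert q (F p))) ∧
      ∀ x < heapStart n, x ≠ 17 → x ≠ 23 → x ≠ h → σ'.reg x = σ.reg x := by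
  set a := cellAddr (heapStart n) p q with ha
  have hab : σ.reg b + σ.reg 16 = a := by rw [hrb, hrq, ha]; simp [cellAddr]
  have haK := le_cellAddr (heapStart n) p q
  rw [← ha] at haK
  have hKn : 36 ≤ heapStart n := by unfold heapStart; omega
  have haV := cellAddr_lt (K := heapStart n) hq hp
  rw [← ha] at haV
  have hV := maxValue_ge n
  have hhd := hmem.heap.head_lt hp
  set σ₁ : St := [Instr.add 23 b 16, .load 17 23].foldl Instr.run σ with hσ₁
  have hr₁ : ⇑σ₁.reg = Function.update (Function.update σ.reg 23 a) 17 (σ.reg a) := by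
    simp only [hσ₁, List.foldl, Instr.run, Finsupp.coe_update, hab, Function.update_self]
    rw [Function.update_of_ne (show a ≠ 23 by omega)]
  by_cases hqF : q ∈ F p
  · have hne : σ.reg a ≠ 0 := hmem.heap.cell_ne_zero hqF
    refine ⟨σ₁, BigStep.seq (.blk _ _) (.ifz_pos ?_ (.blk [] _)), rfl, rfl, ?_, ?_⟩
    · rw [← hσ₁, hr₁]; simpa using hne
    · have hfr : ∀ x, heapStart n ≤ x → σ₁.reg x = σ.reg x := by
        intro x hx
        rw [hr₁, Function.update_of_ne (by omega), Function.update_of_ne (by omega)]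
      have e1 : σ₁.reg h = hd p := by
        rw [hr₁, Function.update_of_ne h17, Function.update_of_ne h23, hrh]
      rw [e1, Function.update_eq_self, Finset.insert_eq_of_mem hqF, Function.update_eq_self]
      refine ⟨hmem.heap.congr hfr fun _ _ => rfl, ?_, hmem.card_le⟩
      rw [hr₁]
      exact update_le (update_le hmem.le_maxValue (by omega)) (hmem.le_maxValue a)
    · intro x _ hx17 hx23 _
      rw [hr₁, Function.update_of_ne hx17, Function.update_of_ne hx23]
  · have hz : σ.reg a = 0 := hmem.heap.cell_eq_zero (by omega) hq hqF
    set σ₂ : St := [Instr.add 17 h 0, .store 23 17, .copy h 23].foldl Instr.run σ₁ with hσ₂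
    have hr₂ : ⇑σ₂.reg = Function.update (Function.update (Function.update σ₁.reg 17 (hd p + 1))
        a (hd p + 1)) h a := by
      have e1 : σ₁.reg h = hd p := by
        rw [hr₁, Function.update_of_ne h17, Function.update_of_ne h23, hrh]
      have e2 : σ₁.reg 0 = 1 := by simp [hr₁, h1]
      have e3 : σ₁.reg 23 = a := by simp [hr₁]
      simp only [hσ₂, List.foldl, Instr.run, Finsupp.coe_update, e1, e2, Function.update_self]
      rw [Function.update_of_ne (show (23 : ℕ) ≠ 17 by norm_num), e3,
        Function.update_of_ne (show (23 : ℕ) ≠ a by omega),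
        Function.update_of_ne (show (23 : ℕ) ≠ 17 by norm_num), e3]
    refine ⟨σ₂, BigStep.seq (.blk _ _) (.ifz_zero ?_ (.blk _ _)), rfl, rfl, ?_, ?_⟩
    · rw [← hσ₁, hr₁]; simpa using hz
    · have e1 : σ₂.reg h = a := by rw [hr₂, Function.update_self]
      rw [e1]
      refine ⟨(hmem.heap.push (by omega) hp hq hqF).congr (fun x hx => ?_) fun _ _ => rfl, ?_,
        fun p' => ?_⟩
      · rw [hr₂, hr₁, Function.update_of_ne (by omega)]
        by_cases hxa : x = a
        · rw [hxa, Function.update_self, Function.update_self]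
        · rw [Function.update_of_ne hxa, Function.update_of_ne (by omega),
            Function.update_of_ne (by omega), Function.update_of_ne (by omega),
            Function.update_of_ne hxa]
      · rw [hr₂, hr₁]
        exact update_le (update_le (update_le (update_le (update_le hmem.le_maxValue (by omega))
          (hmem.le_maxValue a)) (by omega)) (by omega)) (by omega)
      · rcases eq_or_ne p' p with rfl | hpp
        · simpa using hcard
        · simpa [hpp] using hmem.card_le p'
    · intro x hx hx17 hx23 hxh
      rw [hr₂, hr₁, Function.update_of_ne hxh, Function.update_of_ne (by omega),
        Function.update_of_ne hx17, Function.update_of_ne hx17, Function.update_of_ne hx23]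

end RAM

/-! ### Splitting a list into its two restrictions -/

namespace RAM

open Stmt

/-- Remove the first code from the list at `R_8` and insert its restrictions into the lists at
`R_14` and `R_15`. -/
def splitBody : Stmt :=
  .seq (.blk [.sub 16 8 10, .load 18 8, .sub 18 18 0, .const 17 0, .store 8 17, .copy 8 18,
      .add 17 16 0, .sub 17 17 11])
    (.ifz 17 (.seq (insertCode 12 14) (insertCode 13 15))
      (.seq (.blk [.sub 16 16 11, .add 17 16 0, .sub 17 17 11])
        (.ifz 17 (insertCode 12 14) (.seq (.blk [.sub 16 16 11]) (insertCode 13 15)))))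

/-- The state of the machine while the list `(i + 1, b)` is split. -/
structure SplitState (n m i : ℕ) (b : Bool) (r : ℕ → ℕ) (hd : ℕ × Bool → ℕ)
    (F : ℕ × Bool → Finset ℕ) : Prop where
  mem : Mem n m r hd F
  lt : i < n
  one : r 0 = 1
  head : r 8 = hd (i + 1, b)
  base : r 10 = cellAddr (heapStart n) (i + 1, b) 0
  pow : r 11 = 3 ^ i
  base0 : r 12 = cellAddr (heapStart n) (i, false) 0
  base1 : r 13 = cellAddr (heapStart n) (i, true) 0
  head0 : r 14 = hd (i, false)
  head1 : r 15 = hd (i, true)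

/-- Away from the lists `p` and `(i, b')` the heads and the lists are the same. -/
def SameElsewhere (p : ℕ × Bool) (i : ℕ) (hd hd' : ℕ × Bool → ℕ)
    (F F' : ℕ × Bool → Finset ℕ) : Prop :=
  ∀ p' : ℕ × Bool, p' ≠ p → p'.1 ≠ i → hd' p' = hd p' ∧ F' p' = F p'

lemma SplitState.scratch {n m i : ℕ} {b : Bool} {r r' : ℕ → ℕ} {hd : ℕ × Bool → ℕ}
    {F : ℕ × Bool → Finset ℕ} (h : SplitState n m i b r hd F)
    (hr : ∀ x, x ≠ 16 → x ≠ 17 → r' x = r x) (h16 : r' 16 ≤ maxValue n)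
    (h17 : r' 17 ≤ maxValue n) : SplitState n m i b r' hd F := by
  refine ⟨⟨h.mem.heap.congr (fun x hx => hr x ?_ ?_) fun _ _ => rfl, fun x => ?_,
    h.mem.card_le⟩, h.lt, ?_, ?_, ?_, ?_, ?_, ?_, ?_, ?_⟩
  · unfold heapStart at hx; omega
  · unfold heapStart at hx; omega
  · by_cases h1 : x = 16
    · rwa [h1]
    by_cases h2 : x = 17
    · rwa [h2]
    rw [hr x h1 h2]
    exact h.mem.le_maxValue x
  · rw [hr _ (by simp) (by simp), h.one]
  · rw [hr _ (by simp) (by simp), h.head]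
  · rw [hr _ (by simp) (by simp), h.base]
  · rw [hr _ (by simp) (by simp), h.pow]
  · rw [hr _ (by simp) (by simp), h.base0]
  · rw [hr _ (by simp) (by simp), h.base1]
  · rw [hr _ (by simp) (by simp), h.head0]
  · rw [hr _ (by simp) (by simp), h.head1]

lemma SplitState.insert (Q : St → Prop) {n m i q : ℕ} {b : Bool} {σ : St} {hd : ℕ × Bool → ℕ}
    {F : ℕ × Bool → Finset ℕ} (h : SplitState n m i b σ.reg hd F) (b' : Bool)
    (hq : q < 3 ^ i) (hrq : σ.reg 16 = q) (hcard : (insert q (F (i, b'))).card ≤ m) :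
    ∃ (σ' : St) (hd' : ℕ × Bool → ℕ),
      BigStep Q (insertCode (12 + b'.toNat) (14 + b'.toNat)) σ 0 σ' ∧ σ'.input = σ.input ∧
      σ'.out = σ.out ∧
      SplitState n m i b σ'.reg hd' (Function.update F (i, b') (insert q (F (i, b')))) ∧
      (∀ p, p ≠ (i, b') → hd' p = hd p) ∧
      ∀ x < heapStart n, x ∉ ({14, 15, 17, 23} : Finset ℕ) → σ'.reg x = σ.reg x := by
  obtain ⟨σ', hrun, hinp, hout, hmem, hfr⟩ := insertCode_run Q (p := (i, b')) (b := 12 + b'.toNat)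
    (h := 14 + b'.toNat) h.mem h.lt.le hq hcard (by cases b' <;> simp) (by cases b' <;> simp)
    (by cases b' <;> simp) h.one hrq (by cases b' <;> simp [h.base0, h.base1])
    (by cases b' <;> simp [h.head0, h.head1])
  have hlow : ∀ x < 32, x ∉ ({14, 15, 17, 23} : Finset ℕ) → σ'.reg x = σ.reg x := by
    intro x hx hxs
    simp only [Finset.mem_insert, Finset.mem_singleton, not_or] at hxs
    refine hfr x (by unfold heapStart; omega) hxs.2.2.1 hxs.2.2.2 ?_
    cases b' <;> simp <;> omega
  refine ⟨σ', _, hrun, hinp, hout, ⟨hmem, h.lt, ?_, ?_, ?_, ?_, ?_, ?_, ?_, ?_⟩,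
    fun p hp => Function.update_of_ne hp _ _, fun x hx hxs => ?_⟩
  · rw [hlow 0 (by simp) (by simp), h.one]
  · rw [hlow 8 (by simp) (by simp), h.head, Function.update_of_ne (by simp)]
  · rw [hlow 10 (by simp) (by simp), h.base]
  · rw [hlow 11 (by simp) (by simp), h.pow]
  · rw [hlow 12 (by simp) (by simp), h.base0]
  · rw [hlow 13 (by simp) (by simp), h.base1]
  · cases b'
    · simp
    · rw [hfr 14 (by unfold heapStart; omega) (by simp) (by simp) (by simp), h.head0]; simp
  · cases b'
    · rw [hfr 15 (by unfold heapStart; omega) (by simp) (by simp) (by simp), h.head1]; simp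
    · simp
  · simp only [Finset.mem_insert, Finset.mem_singleton, not_or] at hxs
    refine hfr x hx hxs.2.2.1 hxs.2.2.2 ?_
    cases b' <;> simp <;> omega

/-- The top digit is found by at most two comparisons with `3^i`: digit `0` sends the remainder to
both lists, digit `1` to the list for value `0`, digit `2` to the list for value `1`. The size
hypothesis concerns the target lists after the whole split, so that it can be carried through the
loop. -/
lemma splitBody_run (Q : St → Prop) {n m i : ℕ} {b : Bool} {σ : St} {hd : ℕ × Bool → ℕ}
    {F : ℕ × Bool → Finset ℕ} (h : SplitState n m i b σ.reg hd F)
    (hcard : ∀ b' : Bool, (F (i, b') ∪ restrict i (b'.toNat + 1) (F (i + 1, b))).card ≤ m)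
    (h8 : σ.reg 8 ≠ 0) :
    ∃ (σ' : St) (hd' : ℕ × Bool → ℕ) (F' : ℕ × Bool → Finset ℕ) (c : ℕ),
      BigStep Q splitBody σ 0 σ' ∧ σ'.input = σ.input ∧ σ'.out = σ.out ∧
      c ∈ F (i + 1, b) ∧ SplitState n m i b σ'.reg hd' F' ∧
      F' (i + 1, b) = (F (i + 1, b)).erase c ∧
      (∀ b' : Bool, F' (i, b') = F (i, b') ∪ restrict i (b'.toNat + 1) {c}) ∧
      SameElsewhere (i + 1, b) i hd hd' F F' ∧
      ∀ x < heapStart n, x ∉ ({8, 14, 15, 16, 17, 18, 23} : Finset ℕ) →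
        σ'.reg x = σ.reg x := by
  obtain ⟨hmem, hin, hone, hhead, hbase, hpow, hbase0, hbase1, hhead0, hhead1⟩ := h
  have hKn : 36 ≤ heapStart n := by unfold heapStart; omega
  obtain ⟨c, hcF, hc, hpop⟩ := hmem.heap.pop (p := (i + 1, b)) (by omega) hin (by rwa [← hhead])
  have hV := maxValue_ge n
  set a := cellAddr (heapStart n) (i + 1, b) c with ha
  have haK := le_cellAddr (heapStart n) (i + 1, b) c
  rw [← ha] at haK
  have hclt : c < 3 ^ (i + 1) := (hmem.heap.lt _ _ hcF).1
  have haV := cellAddr_lt (K := heapStart n) (p := (i + 1, b)) (n := n) hclt hin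
  rw [← ha] at haV
  have hac : a - σ.reg 10 = c := by rw [hbase, ha]; simp [cellAddr]
  rw [hc] at hhead hpop
  set nx := σ.reg a - 1 with hnx
  have hkey : ∀ k < 32, (k = a) = False := fun k hk => by simp; omega
  have hkey' : ∀ k < 32, (a = k) = False := fun k hk => by simp; omega
  set σ₁ : St := [Instr.sub 16 8 10, .load 18 8, .sub 18 18 0, .const 17 0, .store 8 17,
    .copy 8 18, .add 17 16 0, .sub 17 17 11].foldl Instr.run σ with hσ₁
  have hr₁ : ⇑σ₁.reg = fun x => if x = 8 then nx else if x = 17 then c + 1 - 3 ^ i else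
      if x = 16 then c else if x = 18 then nx else Function.update σ.reg a 0 x := by
    funext x
    simp [hσ₁, Instr.run, Function.update_apply, hkey, hkey', hhead, hac, hone, hpow, hnx]
    split_ifs <;> simp_all
  have hlow₁ : ∀ x < heapStart n, x ∉ ({8, 16, 17, 18} : Finset ℕ) →
      σ₁.reg x = σ.reg x := by
    intro x hx hxs
    simp only [Finset.mem_insert, Finset.mem_singleton, not_or] at hxs
    simp [hr₁, hxs, Function.update_of_ne (show x ≠ a by omega)]
  have hpowle : 3 ^ (i + 1) ≤ 3 ^ n := Nat.pow_le_pow_right (by norm_num) hin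
  have hpown : 3 ^ n ≤ 3 ^ (n + 1) := Nat.pow_le_pow_right (by norm_num) (by omega)
  have hpowi : 3 ^ (i + 1) = 3 * 3 ^ i := by rw [pow_succ, mul_comm]
  have hmem₁ : Mem n m σ₁.reg (Function.update hd (i + 1, b) nx)
      (Function.update F (i + 1, b) ((F (i + 1, b)).erase c)) := by
    refine ⟨hpop.congr (fun x hx => ?_) fun _ _ => rfl, fun x => ?_, fun p => ?_⟩
    · simp [hr₁, show x ≠ 8 by omega, show x ≠ 17 by omega, show x ≠ 16 by omega,
        show x ≠ 18 by omega]
    · have := hmem.le_maxValue a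
      have := update_le (a := a) hmem.le_maxValue (Nat.zero_le _) x
      rw [hr₁]
      repeat' apply ite_le_of_le
      all_goals omega
    · rcases eq_or_ne p (i + 1, b) with rfl | hp
      · simpa using (Finset.card_erase_le).trans (hmem.card_le _)
      · simpa [hp] using hmem.card_le p
  have hS₁ : SplitState n m i b σ₁.reg (Function.update hd (i + 1, b) nx)
      (Function.update F (i + 1, b) ((F (i + 1, b)).erase c)) := by
    refine ⟨hmem₁, hin, ?_, ?_, ?_, ?_, ?_, ?_, ?_, ?_⟩
    · rw [hlow₁ 0 (by omega) (by simp), hone]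
    · simp [hr₁]
    · rw [hlow₁ 10 (by omega) (by simp), hbase]
    · rw [hlow₁ 11 (by omega) (by simp), hpow]
    · rw [hlow₁ 12 (by omega) (by simp), hbase0]
    · rw [hlow₁ 13 (by omega) (by simp), hbase1]
    · rw [hlow₁ 14 (by omega) (by simp), hhead0]; simp
    · rw [hlow₁ 15 (by omega) (by simp), hhead1]; simp
  have hcard₁ : ∀ (b' : Bool) (q : ℕ), q ∈ restrict i (b'.toNat + 1) {c} →
      (insert q (F (i, b'))).card ≤ m := by
    intro b' q hq
    refine (Finset.card_le_card ?_).trans (hcard b')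
    refine Finset.insert_subset (Finset.mem_union_right _ ?_) Finset.subset_union_left
    rw [← Finset.insert_eq_of_mem hcF, restrict_insert]
    exact Finset.mem_union_left _ hq
  have hdiv : ∀ d, d * 3 ^ i ≤ c → c < (d + 1) * 3 ^ i → c / 3 ^ i = d := fun d h1 h2 =>
    Nat.div_eq_of_lt_le h1 h2
  have hmod : c % 3 ^ i = c - 3 ^ i * (c / 3 ^ i) := Nat.mod_def _ _
  -- With truncated subtraction, `c + 1 - 3^i = 0` exactly when `c < 3^i`.
  by_cases hc0 : c < 3 ^ i
  · have hd0 := hdiv 0 (by omega) (by omega)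
    have hres : ∀ d, restrict i d {c} = {c} := fun d => by
      rw [restrict_singleton, if_pos (Or.inl hd0), Nat.mod_eq_of_lt hc0]
    obtain ⟨σ₂, hd₂, hrun₂, hinp₂, hout₂, hS₂, hhd₂, hfr₂⟩ := hS₁.insert Q false hc0
      (by simp [hr₁]) (by simpa using hcard₁ false c (by simp [hres]))
    obtain ⟨σ₃, hd₃, hrun₃, hinp₃, hout₃, hS₃, hhd₃, hfr₃⟩ := hS₂.insert Q true hc0
      (by rw [hfr₂ 16 (by omega) (by simp), hr₁]; simp)
      (by simpa using hcard₁ true c (by simp [hres]))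
    refine ⟨σ₃, hd₃, _, c, .seq (.blk _ _) (.ifz_zero ?_ (.seq hrun₂ hrun₃)),
      hinp₃.trans hinp₂, hout₃.trans hout₂, hcF, hS₃, by simp, fun b' => ?_, fun p h1 h2 => ?_,
      fun x hx hxs => ?_⟩
    · rw [← hσ₁, hr₁]; simp; omega
    · rw [hres]; cases b' <;> simp
    · have h3 : p ≠ (i, true) := by rintro rfl; exact h2 rfl
      have h4 : p ≠ (i, false) := by rintro rfl; exact h2 rfl
      rw [hhd₃ p h3, hhd₂ p h4]
      simp [h1, h3, h4]
    · simp only [Finset.mem_insert, Finset.mem_singleton, not_or] at hxs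
      rw [hfr₃ x hx (by simp; omega), hfr₂ x hx (by simp; omega), hlow₁ x hx (by simp; omega)]
  · set σ₂ : St := [Instr.sub 16 16 11, .add 17 16 0, .sub 17 17 11].foldl Instr.run σ₁ with hσ₂
    have h₁16 : σ₁.reg 16 = c := by simp [hr₁]
    have hr₂ : ⇑σ₂.reg = fun x => if x = 17 then c - 3 ^ i + 1 - 3 ^ i else
        if x = 16 then c - 3 ^ i else σ₁.reg x := by
      funext x
      simp [hσ₂, Instr.run, Function.update_apply, h₁16, hS₁.pow, hS₁.one]
    have hS₂ := hS₁.scratch (r' := σ₂.reg) (fun x h1 h2 => by simp [hr₂, h1, h2])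
      (by simp [hr₂]; omega) (by simp [hr₂]; omega)
    by_cases hc1 : c < 2 * 3 ^ i
    · have hd1 := hdiv 1 (by omega) (by omega)
      have hcm : c % 3 ^ i = c - 3 ^ i := by rw [hmod, hd1, mul_one]
      have hres : restrict i 1 {c} = {c - 3 ^ i} := by
        rw [restrict_singleton, if_pos (Or.inr hd1), hcm]
      have hres2 : restrict i 2 {c} = ∅ := by
        rw [restrict_singleton, if_neg (by omega)]
      obtain ⟨σ₃, hd₃, hrun₃, hinp₃, hout₃, hS₃, hhd₃, hfr₃⟩ := hS₂.insert Q false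
        (q := c - 3 ^ i) (by omega) (by simp [hr₂])
        (by simpa using hcard₁ false (c - 3 ^ i) (by simp [hres]))
      refine ⟨σ₃, hd₃, _, c, .seq (.blk _ _) (.ifz_pos ?_ (.seq (.blk _ _) (.ifz_zero ?_ hrun₃))),
        hinp₃, hout₃, hcF, hS₃, by simp, fun b' => ?_, fun p h1 h2 => ?_, fun x hx hxs => ?_⟩
      · rw [← hσ₁, hr₁]; simp; omega
      · rw [← hσ₁, ← hσ₂, hr₂]; simp; omega
      · cases b' <;> simp [hres, hres2]
      · have h4 : p ≠ (i, false) := by rintro rfl; exact h2 rfl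
        rw [hhd₃ p h4]
        simp [h1, h4]
      · simp only [Finset.mem_insert, Finset.mem_singleton, not_or] at hxs
        rw [hfr₃ x hx (by simp; omega), hr₂, ← hlow₁ x hx (by simp; omega)]
        simp [hxs]
    · set σ₃ : St := [Instr.sub 16 16 11].foldl Instr.run σ₂ with hσ₃
      have hr₃ : ⇑σ₃.reg = fun x => if x = 16 then c - 3 ^ i - 3 ^ i else σ₂.reg x := by
        have h₂16 : σ₂.reg 16 = c - 3 ^ i := by simp [hr₂]
        funext x
        simp [hσ₃, Instr.run, Function.update_apply, h₂16, hS₂.pow]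
      have hS₃ := hS₂.scratch (r' := σ₃.reg) (fun x h1 h2 => by simp [hr₃, h1])
        (by simp [hr₃]; omega) (by simp [hr₃, hr₂]; omega)
      have hd2 := hdiv 2 (by omega) (by omega)
      have hcm : c % 3 ^ i = c - 3 ^ i - 3 ^ i := by rw [hmod, hd2]; omega
      have hres : restrict i 2 {c} = {c - 3 ^ i - 3 ^ i} := by
        rw [restrict_singleton, if_pos (Or.inr hd2), hcm]
      have hres1 : restrict i 1 {c} = ∅ := by
        rw [restrict_singleton, if_neg (by omega)]
      obtain ⟨σ₄, hd₄, hrun₄, hinp₄, hout₄, hS₄, hhd₄, hfr₄⟩ := hS₃.insert Q true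
        (q := c - 3 ^ i - 3 ^ i) (by omega) (by simp [hr₃])
        (by simpa using hcard₁ true (c - 3 ^ i - 3 ^ i) (by simp [hres]))
      refine ⟨σ₄, hd₄, _, c, .seq (.blk _ _) (.ifz_pos ?_ (.seq (.blk _ _)
        (.ifz_pos ?_ (.seq (.blk _ _) hrun₄)))),
        hinp₄, hout₄, hcF, hS₄, by simp, fun b' => ?_, fun p h1 h2 => ?_, fun x hx hxs => ?_⟩
      · rw [← hσ₁, hr₁]; simp; omega
      · rw [← hσ₁, ← hσ₂, hr₂]; simp; omega
      · cases b' <;> simp [hres, hres1]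
      · have h4 : p ≠ (i, true) := by rintro rfl; exact h2 rfl
        rw [hhd₄ p h4]
        simp [h1, h4]
      · simp only [Finset.mem_insert, Finset.mem_singleton, not_or] at hxs
        rw [hfr₄ x hx (by simp; omega), hr₃, hr₂, ← hlow₁ x hx (by simp; omega)]
        simp [hxs]

lemma splitLoop_run (N : ℕ) {n m i : ℕ} {b : Bool} : ∀ (k : ℕ) {σ : St} {hd : ℕ × Bool → ℕ}
    {F : ℕ × Bool → Finset ℕ}, SplitState n m i b σ.reg hd F → (F (i + 1, b)).card = k →
    (∀ b' : Bool, (F (i, b') ∪ restrict i (b'.toNat + 1) (F (i + 1, b))).card ≤ m) →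
    ∃ (σ' : St) (hd' : ℕ × Bool → ℕ) (F' : ℕ × Bool → Finset ℕ),
      BigStep (limits N n m).Check (.loop 8 splitBody) σ (k + 1) σ' ∧ σ'.input = σ.input ∧
      σ'.out = σ.out ∧ SplitState n m i b σ'.reg hd' F' ∧ F' (i + 1, b) = ∅ ∧
      (∀ b' : Bool, F' (i, b') = F (i, b') ∪ restrict i (b'.toNat + 1) (F (i + 1, b))) ∧
      SameElsewhere (i + 1, b) i hd hd' F F' ∧
      ∀ x < heapStart n, x ∉ ({8, 14, 15, 16, 17, 18, 23} : Finset ℕ) →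
        σ'.reg x = σ.reg x := by
  intro k
  induction k with
  | zero =>
    intro σ hd F h hk _
    have hF := Finset.card_eq_zero.1 hk
    refine ⟨σ, hd, F, .loop_done h.mem.check ?_, rfl, rfl, h, hF, fun b' => by simp [hF],
      fun _ _ _ => ⟨rfl, rfl⟩, fun _ _ _ => rfl⟩
    rw [h.head]
    exact (h.mem.heap.head_eq_zero_iff (p := (i + 1, b)) (by unfold heapStart; omega) h.lt).2 hF
  | succ k ih =>
    intro σ hd F h hk hcard
    have h8 : σ.reg 8 ≠ 0 := by
      rw [h.head, Ne, h.mem.heap.head_eq_zero_iff (p := (i + 1, b)) (by unfold heapStart; omega) h.lt]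
      rintro h0
      simp [h0] at hk
    obtain ⟨σ₁, hd₁, F₁, c, hrun₁, hinp₁, hout₁, hc, hS₁, hF₁, hF₁', hsame₁, hfr₁⟩ :=
      splitBody_run (limits N n m).Check h hcard h8
    -- The loop invariant: what a target list holds, joined with what the remaining codes will still
    -- send there, does not change when a code is moved.
    have hunion : ∀ b' : Bool, F₁ (i, b') ∪ restrict i (b'.toNat + 1) (F₁ (i + 1, b)) =
        F (i, b') ∪ restrict i (b'.toNat + 1) (F (i + 1, b)) := by
      intro b'
      rw [hF₁', hF₁, Finset.union_assoc, ← restrict_insert, Finset.insert_erase hc]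
    obtain ⟨σ₂, hd₂, F₂, hrun₂, hinp₂, hout₂, hS₂, hF₂, hF₂', hsame₂, hfr₂⟩ :=
      ih hS₁ (by rw [hF₁, Finset.card_erase_of_mem hc, hk]; rfl)
        (fun b' => by rw [hunion]; exact hcard b')
    refine ⟨σ₂, hd₂, F₂, ?_, hinp₂.trans hinp₁, hout₂.trans hout₁, hS₂, hF₂,
      fun b' => (hF₂' b').trans (hunion b'), fun p h1 h2 => ?_,
      fun x hx hxs => (hfr₂ x hx hxs).trans (hfr₁ x hx hxs)⟩
    · have := BigStep.loop_step h.mem.check h8 hrun₁ hrun₂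
      rwa [show k + 1 + 1 = 1 + 0 + (k + 1) by omega]
    · exact ⟨(hsame₂ p h1 h2).1.trans (hsame₁ p h1 h2).1,
        (hsame₂ p h1 h2).2.trans (hsame₁ p h1 h2).2⟩

end RAM

/-! ### The main loop: selecting a list and climbing -/

namespace RAM

open Stmt

/-- The number of the register that contains the head of the list `p`. -/
def headAddr (n : ℕ) (p : ℕ × Bool) : ℕ := (if p.2 then 3 * n + 35 else 2 * n + 34) + p.1

/-- The registers that are constant during the enumeration. -/
structure Ctx (n : ℕ) (r : ℕ → ℕ) : Prop where
  one : r 0 = 1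
  vars : r 1 = n
  start : r 2 = heapStart n
  word : r 3 = n + 33
  heads0 : r 4 = 2 * n + 34
  heads1 : r 5 = 3 * n + 35
  succ : r 22 = n + 1
  table : r 25 = 32
  pow : ∀ j ≤ n, r (32 + j) = 3 ^ j

lemma Ctx.congr {n : ℕ} {r r' : ℕ → ℕ} (h : Ctx n r)
    (hr : ∀ x, x ≤ 5 ∨ x = 22 ∨ x = 25 ∨ (32 ≤ x ∧ x ≤ n + 32) → r' x = r x) : Ctx n r' where
  one := by rw [hr _ (by simp), h.one]
  vars := by rw [hr _ (by simp), h.vars]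
  start := by rw [hr _ (by simp), h.start]
  word := by rw [hr _ (by simp), h.word]
  heads0 := by rw [hr _ (by simp), h.heads0]
  heads1 := by rw [hr _ (by simp), h.heads1]
  succ := by rw [hr _ (by simp), h.succ]
  table := by rw [hr _ (by simp), h.table]
  pow j hj := by rw [hr _ (by omega), h.pow j hj]

/-- Split the list `(i, b)`, where `i > 0`, and go to level `i - 1`. -/
def splitStmt : Stmt :=
  .seq (.blk [.add 17 2 7, .add 23 25 6, .load 23 23, .mul 10 17 23, .sub 6 6 0, .add 23 25 6,
      .load 11 23, .mul 12 2 11, .add 13 12 11, .const 14 0, .const 15 0])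
    (.seq (.loop 8 splitBody) (.blk [.add 23 4 6, .store 23 14, .add 23 5 6, .store 23 15]))

/-- Output the word and remove the list `(0, b)`. -/
def outputStmt : Stmt := .blk [.add 23 3 1, .sub 23 23 0, .output 3 23, .store 8 17]

/-- Treat the list `(i, b)`. -/
def processStmt : Stmt :=
  .seq (.blk [.add 23 3 6, .store 23 7, .const 17 0, .store 9 17]) (.ifz 6 outputStmt splitStmt)

/-- Look for a list at level `i` that is not empty. -/
def selectStmt : Stmt :=
  .seq (.blk [.const 7 0, .add 9 4 6, .load 8 9])
    (.ifz 8 (.blk [.const 7 1, .add 9 5 6, .load 8 9]) (.blk []))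

def mainBody : Stmt :=
  .seq (.seq selectStmt (.ifz 8 (.blk [.add 6 6 0]) processStmt)) (.blk [.sub 19 22 6])

/-- The state of the machine in the main loop, at level `i`. -/
structure MainState (n m i : ℕ) (r : ℕ → ℕ) (F : ℕ × Bool → Finset ℕ) : Prop where
  ctx : Ctx n r
  mem : Mem n m r (fun p => r (headAddr n p)) F
  level : r 6 = i
  flag : r 19 = n + 1 - i
  below : ∀ p : ℕ × Bool, p.1 < i → F p = ∅

lemma headAddr_bounds {n : ℕ} {p : ℕ × Bool} (hp : p.1 ≤ n) :
    2 * n + 34 ≤ headAddr n p ∧ headAddr n p < heapStart n := by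
  unfold headAddr heapStart
  split_ifs <;> omega

lemma headAddr_inj {n : ℕ} {p p' : ℕ × Bool} (hp : p.1 ≤ n) (hp' : p'.1 ≤ n)
    (h : headAddr n p = headAddr n p') : p = p' := by
  obtain ⟨i, b⟩ := p
  obtain ⟨i', b'⟩ := p'
  simp only [headAddr] at hp hp' h
  cases b <;> cases b' <;> simp at * <;> omega

section

variable {n m i : ℕ} {σ : St} {F : ℕ × Bool → Finset ℕ} (Q : St → Prop)

/-- The list for value `0` has priority; the one for value `1` is taken only when the former is
exhausted, even if it is empty as well. -/
lemma selectStmt_run (h : MainState n m i σ.reg F) (hi : i ≤ n) (b : Bool)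
    (hb : b = true ↔ F (i, false) = ∅) :
    ∃ σ' : St, BigStep Q selectStmt σ 0 σ' ∧ σ'.input = σ.input ∧ σ'.out = σ.out ∧
      ⇑σ'.reg = fun x => if x = 7 then b.toNat else if x = 8 then σ.reg (headAddr n (i, b)) else
        if x = 9 then headAddr n (i, b) else σ.reg x := by
  have hz := h.mem.heap.head_eq_zero_iff (p := (i, false)) (by unfold heapStart; omega) hi
  have h0 : σ.reg 4 + σ.reg 6 = headAddr n (i, false) := by
    rw [h.ctx.heads0, h.level]; simp [headAddr]
  have h1 : σ.reg 5 + σ.reg 6 = headAddr n (i, true) := by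
    rw [h.ctx.heads1, h.level]; simp [headAddr]
  have hk : ∀ k < 32, ∀ b, (headAddr n (i, b) = k) = False := fun k hk b => by
    have := headAddr_bounds (n := n) (p := (i, b)) hi
    simp; omega
  set σ₁ : St := [Instr.const 7 0, .add 9 4 6, .load 8 9].foldl Instr.run σ with hσ₁
  have hr₁ : ⇑σ₁.reg = fun x => if x = 7 then 0 else if x = 8 then σ.reg (headAddr n (i, false))
      else if x = 9 then headAddr n (i, false) else σ.reg x := by
    funext x
    simp [hσ₁, Instr.run, Function.update_apply, h0, hk]
    split_ifs <;> simp_all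
  cases b with
  | false =>
    refine ⟨σ₁, .seq (.blk _ _) (.ifz_pos ?_ (.blk [] _)), rfl, rfl, by simpa using hr₁⟩
    rw [← hσ₁, hr₁]
    simp at hb
    simpa using hz.not.2 hb
  | true =>
    refine ⟨_, .seq (.blk _ _) (.ifz_zero ?_ (.blk _ _)), rfl, rfl, ?_⟩
    · rw [← hσ₁, hr₁]
      simpa using hz.2 (hb.1 rfl)
    · rw [← hσ₁]
      funext x
      simp [Instr.run, Function.update_apply, hr₁, h1, hk]
      split_ifs <;> simp_all

/-- This is the return from a recursive call: both branches at level `i` are done, so the level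
counter moves up. -/
lemma mainBody_skip (h : MainState n m i σ.reg F) (hi : i ≤ n) (hF : ∀ b, F (i, b) = ∅) :
    ∃ σ' : St, BigStep Q mainBody σ 0 σ' ∧ σ'.input = σ.input ∧ σ'.out = σ.out ∧
      MainState n m (i + 1) σ'.reg F ∧ ∀ x ≥ 32, σ'.reg x = σ.reg x := by
  obtain ⟨σ₁, hrun₁, hinp₁, hout₁, hr₁⟩ := selectStmt_run Q h hi true (by simp [hF])
  have hz := (h.mem.heap.head_eq_zero_iff (p := (i, true)) (by unfold heapStart; omega) hi).2 (hF _)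
  rw [hz] at hr₁
  set σ₂ : St := [Instr.sub 19 22 6].foldl Instr.run ([Instr.add 6 6 0].foldl Instr.run σ₁)
    with hσ₂
  have hr₂ : ⇑σ₂.reg =
      fun x => if x = 19 then n + 1 - (i + 1) else if x = 6 then i + 1 else σ₁.reg x := by
    funext x
    simp [hσ₂, Instr.run, Function.update_apply, hr₁, h.ctx.succ, h.ctx.one, h.level]
  have hfr : ∀ x, x ∉ ({6, 7, 8, 9, 19} : Finset ℕ) → σ₂.reg x = σ.reg x := by
    intro x hx
    simp only [Finset.mem_insert, Finset.mem_singleton, not_or] at hx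
    simp [hr₂, hr₁, hx]
  refine ⟨σ₂, .seq (.seq hrun₁ (.ifz_zero (by simp [hr₁]) (.blk _ _))) (.blk _ _), hinp₁, hout₁,
    ⟨h.ctx.congr fun x hx => hfr x (by simp; omega), ⟨h.mem.heap.congr (fun x hx => ?_)
    (fun p hp => ?_), fun x => ?_, h.mem.card_le⟩, by simp [hr₂], by simp [hr₂], fun p hp => ?_⟩,
    fun x hx => hfr x (by simp; omega)⟩
  · unfold heapStart at hx
    exact hfr x (by simp; omega)
  · have := headAddr_bounds hp
    exact hfr _ (by simp; omega)
  · have h1 := h.mem.le_maxValue x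
    have h2 := (headAddr_bounds (n := n) (p := (i, true)) hi).2
    have h3 := (maxValue_ge n).2.1
    have h4 : 36 ≤ heapStart n := by unfold heapStart; omega
    have h5 : n + 1 ≤ heapStart n := by unfold heapStart; omega
    rw [hr₂, hr₁]
    simp only [Bool.toNat_true]
    split_ifs <;> omega
  · rcases Nat.lt_succ_iff_lt_or_eq.1 hp with hp | hp
    · exact h.below p hp
    · obtain ⟨j, b⟩ := p
      simp only at hp
      rw [hp]
      exact hF b

/-- The contents of the registers when the list `(i, b)` is treated, after the selection. -/
def processReg (n i : ℕ) (b : Bool) (r : ℕ → ℕ) : ℕ → ℕ := fun x =>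
  if x = headAddr n (i, b) then 0 else if x = n + 33 + i then b.toNat else
  if x = 7 then b.toNat else if x = 8 then r (headAddr n (i, b)) else
  if x = 9 then headAddr n (i, b) else if x = 17 then 0 else if x = 23 then n + 33 + i else r x

lemma process_prefix_run (h : MainState n m i σ.reg F) (hi : i ≤ n) {b : Bool} {σ₁ : St}
    (hr₁ : ⇑σ₁.reg = fun x => if x = 7 then b.toNat else
      if x = 8 then σ.reg (headAddr n (i, b)) else
      if x = 9 then headAddr n (i, b) else σ.reg x) :
    ⇑([Instr.add 23 3 6, .store 23 7, .const 17 0, .store 9 17].foldl Instr.run σ₁).reg =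
      processReg n i b σ.reg := by
  have hb := headAddr_bounds (n := n) (p := (i, b)) hi
  obtain ⟨a, ha⟩ : ∃ a, a = headAddr n (i, b) := ⟨_, rfl⟩
  obtain ⟨w, hw⟩ : ∃ w, w = n + 33 + i := ⟨_, rfl⟩
  rw [← ha] at hr₁ hb
  have hsum : σ.reg 3 + σ.reg 6 = w := by rw [h.ctx.word, h.level, hw]
  have hk1 : ∀ k < 32, (k = a) = False := fun k hk => by simp; omega
  have hk2 : ∀ k < 32, (k = w) = False := fun k hk => by simp; omega
  have hk3 : ∀ k < 32, (a = k) = False := fun k hk => by simp; omega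
  have hk4 : ∀ k < 32, (w = k) = False := fun k hk => by simp; omega
  funext x
  simp [processReg, Instr.run, Function.update_apply, hr₁, ← ha, ← hw, hk2, hsum]
  split_ifs <;> simp_all

end

end RAM

/-! ### The main loop: output at level zero -/

namespace RAM

open Stmt

lemma Stmt.BigStep.of_eq {Q : St → Prop} {s : Stmt} {σ σ' : St} {t t' : ℕ}
    (h : BigStep Q s σ t σ') (ht : t = t') : BigStep Q s σ t' σ' := ht ▸ h

/-- The values of the variables that are stored in the memory. -/
def storedValues (n : ℕ) (r : ℕ → ℕ) (j : ℕ) : ℕ := r (n + 33 + j)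

lemma processReg_of_ge {n i : ℕ} (hi : i ≤ n) (b : Bool) (r : ℕ → ℕ) {x : ℕ}
    (hx : heapStart n ≤ x) : processReg n i b r x = r x := by
  have := headAddr_bounds (n := n) (p := (i, b)) hi
  unfold heapStart at *
  unfold processReg
  rw [if_neg (by omega), if_neg (by omega), if_neg (by omega), if_neg (by omega),
    if_neg (by omega), if_neg (by omega), if_neg (by omega)]

lemma processReg_of_lt {n i : ℕ} (hi : i ≤ n) (b : Bool) (r : ℕ → ℕ) {x : ℕ} (hx : x < n + 33)
    (hxs : x ∉ ({7, 8, 9, 17, 23} : Finset ℕ)) : processReg n i b r x = r x := by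
  have := headAddr_bounds (n := n) (p := (i, b)) hi
  simp only [Finset.mem_insert, Finset.mem_singleton, not_or] at hxs
  unfold processReg
  rw [if_neg (by omega), if_neg (by omega), if_neg hxs.1, if_neg hxs.2.1, if_neg hxs.2.2.1,
    if_neg hxs.2.2.2.1, if_neg hxs.2.2.2.2]

lemma processReg_headAddr {n i : ℕ} (hi : i ≤ n) (b : Bool) (r : ℕ → ℕ) {p : ℕ × Bool}
    (hp : p.1 ≤ n) : processReg n i b r (headAddr n p) = if p = (i, b) then 0 else
      r (headAddr n p) := by
  by_cases h : p = (i, b)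
  · simp [processReg, h]
  · have := headAddr_bounds hp
    unfold processReg
    rw [if_neg h, if_neg fun h' => h (headAddr_inj hp hi h'), if_neg (by omega), if_neg (by omega),
      if_neg (by omega), if_neg (by omega), if_neg (by omega), if_neg (by omega)]

lemma processReg_word {n i : ℕ} (hi : i ≤ n) (b : Bool) (r : ℕ → ℕ) {j : ℕ} (hj : j ≤ n) :
    processReg n i b r (n + 33 + j) = Function.update (storedValues n r) i b.toNat j := by
  have := headAddr_bounds (n := n) (p := (i, b)) hi
  unfold processReg
  rw [if_neg (by omega)]
  rcases eq_or_ne j i with rfl | hji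
  · simp
  · rw [if_neg (by omega), if_neg (by omega), if_neg (by omega), if_neg (by omega),
      if_neg (by omega), if_neg (by omega), Function.update_of_ne hji, storedValues]

lemma processReg_le {n i : ℕ} (hi : i ≤ n) (b : Bool) {r : ℕ → ℕ} (hr : ∀ x, r x ≤ maxValue n)
    (x : ℕ) : processReg n i b r x ≤ maxValue n := by
  have h1 := headAddr_bounds (n := n) (p := (i, b)) hi
  have h2 := maxValue_ge n
  have h3 := Bool.toNat_le b
  have h4 := hr x
  have h5 := hr (headAddr n (i, b))
  unfold processReg
  unfold heapStart at *
  split_ifs <;> omega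

lemma mainBody_output {n m : ℕ} {σ : St} {F : ℕ × Bool → Finset ℕ} (Q : St → Prop)
    (h : MainState n m 0 σ.reg F) (b : Bool) (hb : b = true ↔ F (0, false) = ∅)
    (hF : F (0, b) ≠ ∅) :
    ∃ σ' : St, BigStep Q mainBody σ 0 σ' ∧ σ'.input = σ.input ∧
      σ'.out = σ.out ++ [(List.range n).map (Function.update (storedValues n σ.reg) 0 b.toNat)] ∧
      MainState n m 0 σ'.reg (Function.update F (0, b) ∅) ∧
      ∀ j ≤ n, j ≠ 0 → storedValues n σ'.reg j = storedValues n σ.reg j := by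
  have hK : 2 ≤ heapStart n := by unfold heapStart; omega
  obtain ⟨σ₁, hrun₁, hinp₁, hout₁, hr₁⟩ := selectStmt_run Q h n.zero_le b hb
  have hne := (h.mem.heap.head_eq_zero_iff (p := (0, b)) hK n.zero_le).not.2 hF
  obtain ⟨c, hcF, hc, hpop⟩ := h.mem.heap.pop (p := (0, b)) hK n.zero_le hne
  -- At level `0` the only possible code is `0`, so removing one cell empties the list.
  have herase : (F (0, b)).erase c = ∅ := by
    have hlt : ∀ q ∈ F (0, b), q = 0 := fun q hq => by
      have := (h.mem.heap.lt _ q hq).1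
      simpa using this
    ext q
    simp only [Finset.mem_erase, Finset.notMem_empty, iff_false, not_and]
    intro hqc hq
    exact hqc ((hlt q hq).trans (hlt c hcF).symm)
  rw [herase] at hpop
  have hnext := (hpop.head_eq_zero_iff (p := (0, b)) hK n.zero_le).2 (by simp)
  simp only [Function.update_self] at hnext
  rw [hnext] at hpop
  have haK := le_cellAddr (heapStart n) (0, b) c
  rw [← hc] at haK
  set a := σ.reg (headAddr n (0, b)) with ha
  set σ₂ := [Instr.add 23 3 6, .store 23 7, .const 17 0, .store 9 17].foldl Instr.run σ₁ with hσ₂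
  have hr₂ : ⇑σ₂.reg = processReg n 0 b σ.reg := process_prefix_run h n.zero_le hr₁
  have hlow : ∀ x, x < n + 33 → x ∉ ({7, 8, 9, 17, 23} : Finset ℕ) → σ₂.reg x = σ.reg x :=
    fun x hx hxs => by rw [hr₂, processReg_of_lt n.zero_le b _ hx hxs]
  have e0 : σ₂.reg 0 = 1 := by rw [hlow 0 (by omega) (by simp), h.ctx.one]
  have e1 : σ₂.reg 1 = n := by rw [hlow 1 (by omega) (by simp), h.ctx.vars]
  have e3 : σ₂.reg 3 = n + 33 := by rw [hlow 3 (by omega) (by simp), h.ctx.word]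
  have e6 : σ₂.reg 6 = 0 := by rw [hlow 6 (by omega) (by simp), h.level]
  have e22 : σ₂.reg 22 = n + 1 := by rw [hlow 22 (by omega) (by simp), h.ctx.succ]
  have hh := headAddr_bounds (n := n) (p := (0, b)) n.zero_le
  have e8 : σ₂.reg 8 = a := by
    rw [hr₂, processReg, if_neg (by omega), if_neg (by omega)]; simp [ha]
  have e17 : σ₂.reg 17 = 0 := by
    rw [hr₂, processReg, if_neg (by omega), if_neg (by omega)]; simp
  have hKn : 36 ≤ heapStart n := by unfold heapStart; omega
  have hk : ∀ k < 32, (k = a) = False := fun k hk => by simp; omega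
  set σ₃ := [Instr.add 23 3 1, .sub 23 23 0, .output 3 23, .store 8 17].foldl Instr.run σ₂
    with hσ₃
  set σ₄ := [Instr.sub 19 22 6].foldl Instr.run σ₃ with hσ₄
  have hr₄ : ⇑σ₄.reg = fun x => if x = 19 then n + 1 else if x = a then 0 else
      if x = 23 then n + 33 + n - 1 else processReg n 0 b σ.reg x := by
    funext x
    simp [hσ₄, hσ₃, Instr.run, Function.update_apply, hr₂]
    split_ifs <;> first | rfl | omega | simp_all
  have hout₄ : σ₄.out =
      σ.out ++ [(List.range n).map (Function.update (storedValues n σ.reg) 0 b.toNat)] := by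
    -- The slot `n + 33 + n`, which serves only the root list at level `n`, is left out of the word.
    have hlen : n + 33 + n - 1 + 1 - (n + 33) = n := by omega
    have hout₂ : σ₂.out = σ.out := hout₁
    simp only [hσ₄, hσ₃, List.foldl, Instr.run, Finsupp.coe_update, hout₂, Function.update_self,
      Function.update_of_ne (show (3 : ℕ) ≠ 23 by norm_num),
      Function.update_of_ne (show (0 : ℕ) ≠ 23 by norm_num), e0, e1, e3, hlen]
    rw [List.range'_eq_map_range, List.map_map]
    refine congrArg (fun l => σ.out ++ [l]) (List.map_congr_left fun j hj => ?_)
    rw [Function.comp_apply, Function.update_of_ne (by omega), Function.update_of_ne (by omega),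
      hr₂, processReg_word n.zero_le b _ (List.mem_range.1 hj).le]
  have hfr : ∀ x, x < heapStart n → x ∉ ({19, 23} : Finset ℕ) → σ₄.reg x =
      processReg n 0 b σ.reg x := by
    intro x hx hxs
    simp only [Finset.mem_insert, Finset.mem_singleton, not_or] at hxs
    simp [hr₄, hxs, show x ≠ a by omega]
  refine ⟨σ₄, .seq (.seq hrun₁ (.ifz_pos ?_ (.seq (.blk _ _) (.ifz_zero e6 (.blk _ _)))))
    (.blk _ _), hinp₁, hout₄, ⟨?_, ⟨hpop.congr (fun x hx => ?_) (fun p hp => ?_), fun x => ?_,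
    fun p => ?_⟩, ?_, ?_, by simp⟩, fun j hj hj0 => ?_⟩
  · simpa [hr₁] using hne
  · refine h.ctx.congr fun x hx => ?_
    rw [hfr x (by unfold heapStart; omega) (by simp; omega),
      processReg_of_lt n.zero_le b _ (by omega) (by simp; omega)]
  · rw [hr₄]
    simp only [Function.update_apply]
    rw [if_neg (by omega)]
    split_ifs
    · rfl
    · omega
    · exact processReg_of_ge n.zero_le b _ hx
  · have := headAddr_bounds hp
    rw [hfr _ this.2 (by simp; omega), processReg_headAddr n.zero_le b _ hp, Function.update_apply]
  · have h1 := processReg_le n.zero_le b h.mem.le_maxValue x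
    have h2 := maxValue_ge n
    rw [hr₄]
    simp only
    unfold heapStart at h2
    split_ifs <;> omega
  · rcases eq_or_ne p (0, b) with rfl | hp
    · simp
    · simpa [hp] using h.mem.card_le p
  · rw [hfr 6 (by omega) (by simp), processReg_of_lt n.zero_le b _ (by omega) (by simp), h.level]
  · simp [hr₄]
  · rw [storedValues, hfr _ (by unfold heapStart; omega) (by simp; omega),
      processReg_word n.zero_le b _ hj, Function.update_of_ne hj0]

end RAM

/-! ### The main loop: descending one level -/

namespace RAM

open Stmt

lemma split_prefix_run {σ : St} {K i c T T' : ℕ} (h0 : σ.reg 0 = 1) (h2 : σ.reg 2 = K)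
    (h6 : σ.reg 6 = i + 1) (h7 : σ.reg 7 = c) (h25 : σ.reg 25 = 32)
    (hT : σ.reg (32 + (i + 1)) = T) (hT' : σ.reg (32 + i) = T') :
    ⇑([Instr.add 17 2 7, .add 23 25 6, .load 23 23, .mul 10 17 23, .sub 6 6 0, .add 23 25 6,
      .load 11 23, .mul 12 2 11, .add 13 12 11, .const 14 0, .const 15 0].foldl
        Instr.run σ).reg = fun x => if x = 15 then 0 else if x = 14 then 0 else
      if x = 13 then K * T' + T' else if x = 12 then K * T' else
      if x = 11 then T' else if x = 23 then 32 + i else if x = 6 then i else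
      if x = 10 then (K + c) * T else if x = 17 then K + c else σ.reg x := by
  have hk : ∀ k < 32, ∀ j, (32 + j = k) = False := fun k hk j => by simp; omega
  set σ₁ := [Instr.add 17 2 7, .add 23 25 6, .load 23 23, .mul 10 17 23, .sub 6 6 0].foldl
    Instr.run σ with hσ₁
  have hr₁ : ⇑σ₁.reg = fun x => if x = 6 then i else if x = 10 then (K + c) * T else
      if x = 23 then T else if x = 17 then K + c else σ.reg x := by
    funext x
    simp [hσ₁, Instr.run, Function.update_apply, h0, h2, h6, h7, h25, hT, hk]
  change ⇑([Instr.add 23 25 6, .load 11 23, .mul 12 2 11, .add 13 12 11, .const 14 0,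
    .const 15 0].foldl Instr.run σ₁).reg = _
  clear_value σ₁
  funext x
  simp [Instr.run, Function.update_apply, hr₁, h2, h25, hT', hk]
  split_ifs <;> rfl

lemma split_suffix_run {σ : St} {a₀ a₁ g h₀ h₁ : ℕ} (ha₀ : σ.reg 4 + σ.reg 6 = a₀)
    (ha₁ : σ.reg 5 + σ.reg 6 = a₁) (hg : σ.reg 22 - σ.reg 6 = g) (hh₀ : σ.reg 14 = h₀)
    (hh₁ : σ.reg 15 = h₁) (hk₀ : 32 ≤ a₀) (hk₁ : 32 ≤ a₁) :
    ⇑([Instr.sub 19 22 6].foldl Instr.run ([Instr.add 23 4 6, .store 23 14, .add 23 5 6,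
      .store 23 15].foldl Instr.run σ)).reg = fun x => if x = 19 then g else if x = a₁ then h₁ else
      if x = a₀ then h₀ else if x = 23 then a₁ else σ.reg x := by
  have hk : ∀ k < 32, (k = a₀) = False := fun k hk => by simp; omega
  have hk' : ∀ k < 32, (k = a₁) = False := fun k hk => by simp; omega
  funext x
  simp [Instr.run, Function.update_apply, ha₀, ha₁, hg, hk, hk', hh₀, hh₁]
  split_ifs <;> first | rfl | omega

-- This is the recursive call: the list `(i + 1, b)` is consumed, its value `b` is recorded, and its
-- restrictions become the lists of level `i`. The count is that of the inner loop, one test per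
-- code and a final one.
set_option maxHeartbeats 400000 in
lemma mainBody_split (N : ℕ) {n m i : ℕ} {σ : St} {F : ℕ × Bool → Finset ℕ}
    (h : MainState n m (i + 1) σ.reg F) (hi : i < n) (b : Bool)
    (hb : b = true ↔ F (i + 1, false) = ∅) (hF : F (i + 1, b) ≠ ∅) :
    ∃ (σ' : St) (F' : ℕ × Bool → Finset ℕ),
      BigStep (limits N n m).Check mainBody σ ((F (i + 1, b)).card + 1) σ' ∧
      σ'.input = σ.input ∧ σ'.out = σ.out ∧ MainState n m i σ'.reg F' ∧ F' (i + 1, b) = ∅ ∧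
      (∀ b' : Bool, F' (i, b') = restrict i (b'.toNat + 1) (F (i + 1, b))) ∧
      (∀ p : ℕ × Bool, p ≠ (i + 1, b) → p.1 ≠ i → F' p = F p) ∧
      ∀ j ≤ n, storedValues n σ'.reg j =
        Function.update (storedValues n σ.reg) (i + 1) b.toNat j := by
  have hi' : i + 1 ≤ n := hi
  have hK : 2 ≤ heapStart n := by unfold heapStart; omega
  obtain ⟨σ₁, hrun₁, hinp₁, hout₁, hr₁⟩ := selectStmt_run (limits N n m).Check h hi' b hb
  have hne := (h.mem.heap.head_eq_zero_iff (p := (i + 1, b)) hK hi').not.2 hF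
  have hh := headAddr_bounds (n := n) (p := (i + 1, b)) hi'
  have hKn : 36 ≤ heapStart n := by unfold heapStart; omega
  have hKn' : n + 33 ≤ heapStart n := by unfold heapStart; omega
  obtain ⟨σ₂, hrun₂, hinp₂, hout₂, hr₂⟩ : ∃ σ₂ : St, BigStep (limits N n m).Check
      (.blk [.add 23 3 6, .store 23 7, .const 17 0, .store 9 17]) σ₁ 0 σ₂ ∧
      σ₂.input = σ.input ∧ σ₂.out = σ.out ∧ ⇑σ₂.reg = processReg n (i + 1) b σ.reg :=
    ⟨_, .blk _ _, hinp₁, hout₁, process_prefix_run h hi' hr₁⟩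
  have hlow : ∀ x, x < n + 33 → x ∉ ({7, 8, 9, 17, 23} : Finset ℕ) → σ₂.reg x = σ.reg x :=
    fun x hx hxs => by rw [hr₂, processReg_of_lt hi' b _ hx hxs]
  have e0 : σ₂.reg 0 = 1 := by rw [hlow 0 (by omega) (by simp), h.ctx.one]
  have e2 : σ₂.reg 2 = heapStart n := by rw [hlow 2 (by omega) (by simp), h.ctx.start]
  have e6 : σ₂.reg 6 = i + 1 := by rw [hlow 6 (by omega) (by simp), h.level]
  have e25 : σ₂.reg 25 = 32 := by rw [hlow 25 (by omega) (by simp), h.ctx.table]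
  have eT : ∀ j ≤ n, σ₂.reg (32 + j) = 3 ^ j := fun j hj => by
    rw [hlow _ (by omega) (by simp; omega), h.ctx.pow j hj]
  have e7 : σ₂.reg 7 = b.toNat := by
    rw [hr₂, processReg, if_neg (by omega), if_neg (by omega)]; simp
  have e8 : σ₂.reg 8 = σ.reg (headAddr n (i + 1, b)) := by
    rw [hr₂, processReg, if_neg (by omega), if_neg (by omega)]; simp
  obtain ⟨σ₃, hrun₃, hinp₃, hout₃, hr₃⟩ : ∃ σ₃ : St, BigStep (limits N n m).Check
      (.blk [.add 17 2 7, .add 23 25 6, .load 23 23, .mul 10 17 23, .sub 6 6 0, .add 23 25 6,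
        .load 11 23, .mul 12 2 11, .add 13 12 11, .const 14 0, .const 15 0]) σ₂ 0 σ₃ ∧
      σ₃.input = σ.input ∧ σ₃.out = σ.out ∧
      ⇑σ₃.reg = fun x => if x = 15 then 0 else if x = 14 then 0 else
      if x = 13 then heapStart n * 3 ^ i + 3 ^ i else if x = 12 then heapStart n * 3 ^ i else
      if x = 11 then 3 ^ i else if x = 23 then 32 + i else if x = 6 then i else
      if x = 10 then (heapStart n + b.toNat) * 3 ^ (i + 1) else
      if x = 17 then heapStart n + b.toNat else σ₂.reg x :=
    ⟨_, .blk _ _, hinp₂, hout₂, split_prefix_run e0 e2 e6 e7 e25 (eT (i + 1) hi') (eT i hi.le)⟩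
  have hpos : ∀ b' : Bool, ∀ j : ℕ, cellAddr (heapStart n) (j, b') 0 =
      (heapStart n + b'.toNat) * 3 ^ j := fun b' j => by simp [cellAddr]
  have hhigh₃ : ∀ x, 32 ≤ x → σ₃.reg x = σ₂.reg x := by
    intro x hx
    rw [hr₃]
    simp only
    split_ifs <;> first | rfl | omega
  -- The heads are those before the treatment: the register of `(i + 1, b)` has been cleared, but
  -- its pointer lives on in `R_8`. The heads at level `i` start as `0` because nothing is stored
  -- below the current level.
  have hS₃ : SplitState n m i b σ₃.reg (fun p => σ.reg (headAddr n p)) F := by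
    refine ⟨⟨h.mem.heap.congr (fun x hx => ?_) fun _ _ => rfl, fun x => ?_, h.mem.card_le⟩, hi,
      ?_, ?_, ?_, ?_, ?_, ?_, ?_, ?_⟩
    · rw [← processReg_of_ge hi' b σ.reg hx, ← hr₂, hhigh₃ x (by omega)]
    · have h1 := processReg_le hi' b h.mem.le_maxValue x
      have h2 := maxValue_ge n
      have h3 := cellAddr_lt (K := heapStart n) (n := n) (p := (i, true)) (q := 0) (by simp) hi.le
      have h4 := cellAddr_lt (K := heapStart n) (n := n) (p := (i + 1, b)) (q := 0) (by simp) hi'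
      have h5 := Bool.toNat_le b
      have h7 : 0 < 3 ^ i := by positivity
      have h6 : 3 ^ i ≤ 3 ^ (n + 1) := Nat.pow_le_pow_right (by norm_num) (by omega)
      rw [hpos] at h3 h4
      rw [Bool.toNat_true, Nat.add_mul, one_mul] at h3
      rw [hr₃, hr₂]
      beta_reduce
      generalize processReg n (i + 1) b σ.reg x = y at h1 ⊢
      repeat' apply ite_le_of_le
      all_goals omega
    · simp [hr₃, e0]
    · simp [hr₃, e8]
    · simp [hr₃, hpos]
    · simp [hr₃]
    · simp [hr₃, hpos]
    · simp [hr₃, hpos, Nat.add_mul]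
    · have := (h.mem.heap.head_eq_zero_iff (p := (i, false)) hK hi.le).2
        (h.below _ (Nat.lt_succ_self i))
      simp [hr₃, this]
    · have := (h.mem.heap.head_eq_zero_iff (p := (i, true)) hK hi.le).2
        (h.below _ (Nat.lt_succ_self i))
      simp [hr₃, this]
  obtain ⟨σ₄, hd₄, F₄, hrun₄, hinp₄, hout₄, hS₄, hF₄, hF₄', hsame, hfr₄⟩ :=
    splitLoop_run N _ hS₃ rfl fun b' => by
      rw [h.below _ (Nat.lt_succ_self i), Finset.empty_union]
      exact (card_restrict_le _ _ _).trans (h.mem.card_le _)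
  have hF₄i : ∀ b' : Bool, F₄ (i, b') = restrict i (b'.toNat + 1) (F (i + 1, b)) := fun b' => by
    rw [hF₄', h.below _ (Nat.lt_succ_self i), Finset.empty_union]
  have hlow₄ : ∀ x < n + 33,
      x ∉ ({6, 7, 8, 9, 10, 11, 12, 13, 14, 15, 16, 17, 18, 23} : Finset ℕ) →
      σ₄.reg x = σ.reg x := by
    intro x hx hxs
    simp only [Finset.mem_insert, Finset.mem_singleton, not_or] at hxs
    rw [hfr₄ x (by omega) (by simp; omega), hr₃]
    simp only [hxs, if_false]
    exact hlow x hx (by simp; omega)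
  have hhigh₄ : ∀ x < heapStart n, 32 ≤ x → σ₄.reg x = processReg n (i + 1) b σ.reg x := by
    intro x hx hx32
    rw [hfr₄ x hx (by simp; omega), hhigh₃ x hx32, hr₂]
  have f0 : headAddr n (i, false) = 2 * n + 34 + i := by simp [headAddr]
  have f1 : headAddr n (i, true) = 3 * n + 35 + i := by simp [headAddr]
  obtain ⟨σ₆, σ₅, hrun₆, hrun₇, hinp₅, hout₅, hr₅⟩ : ∃ σ₆ σ₅ : St, BigStep (limits N n m).Check
      (.blk [.add 23 4 6, .store 23 14, .add 23 5 6, .store 23 15]) σ₄ 0 σ₆ ∧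
      BigStep (limits N n m).Check (.blk [.sub 19 22 6]) σ₆ 0 σ₅ ∧ σ₅.input = σ.input ∧ σ₅.out = σ.out ∧ ⇑σ₅.reg = fun x =>
      if x = 19 then n + 1 - i else
      if x = headAddr n (i, true) then hd₄ (i, true) else
      if x = headAddr n (i, false) then hd₄ (i, false) else
      if x = 23 then headAddr n (i, true) else σ₄.reg x := by
    have g4 : σ₄.reg 4 = 2 * n + 34 := by rw [hlow₄ _ (by omega) (by simp), h.ctx.heads0]
    have g5 : σ₄.reg 5 = 3 * n + 35 := by rw [hlow₄ _ (by omega) (by simp), h.ctx.heads1]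
    have g22 : σ₄.reg 22 = n + 1 := by rw [hlow₄ _ (by omega) (by simp), h.ctx.succ]
    have g6 : σ₄.reg 6 = i := by rw [hfr₄ _ (by omega) (by simp), hr₃]; simp
    rw [f0, f1]
    refine ⟨_, _, .blk _ _, .blk _ _, hinp₄.trans hinp₃, hout₄.trans hout₃, ?_⟩
    exact split_suffix_run (by rw [g4, g6]) (by rw [g5, g6]) (by rw [g22, g6]) hS₄.head0 hS₄.head1
      (by omega) (by omega)
  have hlow₅ : ∀ x < n + 33,
      x ∉ ({6, 7, 8, 9, 10, 11, 12, 13, 14, 15, 16, 17, 18, 19, 23} : Finset ℕ) →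
      σ₅.reg x = σ.reg x := by
    intro x hx hxs
    simp only [Finset.mem_insert, Finset.mem_singleton, not_or] at hxs
    rw [← hlow₄ x hx (by simp; omega), hr₅, f0, f1]
    simp only
    rw [if_neg (by omega), if_neg (by omega), if_neg (by omega), if_neg (by omega)]
  refine ⟨σ₅, F₄, BigStep.of_eq (.seq (.seq hrun₁ (.ifz_pos ?_ (.seq hrun₂ (.ifz_pos ?_
    (.seq hrun₃ (.seq hrun₄ hrun₆)))))) hrun₇) (by omega), hinp₅, hout₅, ⟨?_,
    ⟨hS₄.mem.heap.congr (fun x hx => ?_) (fun p hp => ?_), fun x => ?_, hS₄.mem.card_le⟩,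
    ?_, ?_, fun p hp => ?_⟩, hF₄, hF₄i, fun p h1 h2 => (hsame p h1 h2).2, fun j hj => ?_⟩
  · simpa [hr₁] using hne
  · rw [e6]; omega
  · exact h.ctx.congr fun x hx => hlow₅ x (by omega) (by simp; omega)
  · have := (headAddr_bounds (n := n) (p := (i, false)) hi.le).2
    have := (headAddr_bounds (n := n) (p := (i, true)) hi.le).2
    rw [hr₅]
    simp only
    rw [if_neg (by omega), if_neg (by omega), if_neg (by omega), if_neg (by omega)]
  · have hb1 := headAddr_bounds hp
    rw [hr₅]
    simp only
    rw [if_neg (by omega)]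
    by_cases h1 : p = (i, true)
    · rw [if_pos (by rw [h1]), h1]
    rw [if_neg fun h' => h1 (headAddr_inj hp hi.le h')]
    by_cases h2 : p = (i, false)
    · rw [if_pos (by rw [h2]), h2]
    rw [if_neg fun h' => h2 (headAddr_inj hp hi.le h'), if_neg (by omega),
      hhigh₄ _ hb1.2 (by omega), processReg_headAddr hi' b _ hp]
    -- The head register of `(i + 1, b)` was cleared in advance, which agrees with the list being
    -- empty after the split.
    split_ifs with h3
    · rw [h3]
      exact ((hS₄.mem.heap.head_eq_zero_iff hK hi').2 hF₄).symm
    · refine ((hsame p h3 fun hpi => ?_).1).symm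
      obtain ⟨j, b'⟩ := p
      simp only at hpi
      subst hpi
      cases b'
      · exact h2 rfl
      · exact h1 rfl
  · have h1 := hS₄.mem.le_maxValue x
    have h2 := hS₄.mem.heap.head_lt (p := (i, false)) hi.le
    have h3 := hS₄.mem.heap.head_lt (p := (i, true)) hi.le
    have h4 := maxValue_ge n
    have h5 := (headAddr_bounds (n := n) (p := (i, true)) hi.le).2
    rw [hr₅]
    repeat' apply ite_le_of_le
    all_goals omega
  · rw [hr₅, f0, f1]
    simp only
    rw [if_neg (by omega), if_neg (by omega), if_neg (by omega), if_neg (by omega),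
      hfr₄ _ (by omega) (by simp), hr₃]
    simp
  · simp [hr₅]
  · rw [(hsame p (fun h' => ?_) (by omega)).2]
    · exact h.below p (by omega)
    · rw [h'] at hp
      simp at hp
  · rw [storedValues, hr₅, f0, f1]
    simp only
    rw [if_neg (by omega), if_neg (by omega), if_neg (by omega), if_neg (by omega),
      hhigh₄ _ (by unfold heapStart; omega) (by omega), processReg_word hi' b _ hj]

end RAM

/-! ### The main loop performs the recursion -/

namespace RAM

open Stmt

/-- Every run of the main loop from `σ'` gives one from `σ`, with `t` more tests. -/
def LoopTo (Q : St → Prop) (σ : St) (t : ℕ) (σ' : St) : Prop :=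
  ∀ t' σ'', BigStep Q (.loop 19 mainBody) σ' t' σ'' → BigStep Q (.loop 19 mainBody) σ (t + t') σ''

lemma LoopTo.refl (Q : St → Prop) (σ : St) : LoopTo Q σ 0 σ :=
  fun _ _ h => h.of_eq (zero_add _).symm

lemma LoopTo.trans {Q : St → Prop} {σ₁ σ₂ σ₃ : St} {t t' : ℕ} (h : LoopTo Q σ₁ t σ₂)
    (h' : LoopTo Q σ₂ t' σ₃) : LoopTo Q σ₁ (t + t') σ₃ :=
  fun _ _ hr => (h _ _ (h' _ _ hr)).of_eq (add_assoc _ _ _).symm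

variable {n m : ℕ}

lemma MainState.loopTo {N i t : ℕ} {σ σ' : St} {F : ℕ × Bool → Finset ℕ}
    (h : MainState n m i σ.reg F) (hi : i ≤ n)
    (hrun : BigStep (limits N n m).Check mainBody σ t σ') :
    LoopTo (limits N n m).Check σ (1 + t) σ' :=
  fun _ _ hr => .loop_step h.mem.check (by rw [h.flag]; omega) hrun hr

lemma storedValues_update_congr {n i : ℕ} {S : Finset ℕ} {b : ℕ} {u u' : ℕ → ℕ}
    (h : ∀ j, i < j → j < n → u j = u' j) :
    modelWords n i S (Function.update u i b) = modelWords n i S (Function.update u' i b) := by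
  refine modelWords_congr S fun j hj hn => ?_
  rcases eq_or_ne j i with rfl | hji
  · simp
  · rw [Function.update_of_ne hji, Function.update_of_ne hji, h j (by omega) hn]

/-- The effect of the main loop from level `i` until it reaches level `i + 1`. -/
def Sweeps (N n m i : ℕ) : Prop :=
  ∀ (σ : St) (F : ℕ × Bool → Finset ℕ), MainState n m i σ.reg F →
    ∃ (σ' : St) (F' : ℕ × Bool → Finset ℕ) (t : ℕ),
      LoopTo (limits N n m).Check σ t σ' ∧ σ'.input = σ.input ∧
      σ'.out = σ.out ++
        (modelWords n i (F (i, false)) (Function.update (storedValues n σ.reg) i 0) ++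
        modelWords n i (F (i, true)) (Function.update (storedValues n σ.reg) i 1)) ∧
      MainState n m (i + 1) σ'.reg F' ∧ (∀ p : ℕ × Bool, i < p.1 → F' p = F p) ∧
      (∀ j ≤ n, i < j → storedValues n σ'.reg j = storedValues n σ.reg j) ∧
      t ≤ workBound i (F (i, false)) + workBound i (F (i, true)) + 1

/-- A nonempty list is output at level `0`; otherwise it is split and the level below is swept. The
summand `|S| + 3` of `workBound` consists of the main test, the `|S| + 1` tests of the split, and
the test for climbing back. Stored values at positions up to `i` may change, those above may not. -/
lemma treat_list {N i : ℕ} (hi : i ≤ n) (hsweep : ∀ k, i = k + 1 → Sweeps N n m k) {σ : St}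
    {F : ℕ × Bool → Finset ℕ} (h : MainState n m i σ.reg F) (b : Bool)
    (hb : b = true → F (i, false) = ∅) :
    ∃ (σ' : St) (F' : ℕ × Bool → Finset ℕ) (t : ℕ),
      LoopTo (limits N n m).Check σ t σ' ∧ σ'.input = σ.input ∧
      σ'.out = σ.out ++
        modelWords n i (F (i, b)) (Function.update (storedValues n σ.reg) i b.toNat) ∧
      MainState n m i σ'.reg F' ∧ F' (i, b) = ∅ ∧
      (∀ p : ℕ × Bool, p ≠ (i, b) → i ≤ p.1 → F' p = F p) ∧
      (∀ j ≤ n, i < j → storedValues n σ'.reg j = storedValues n σ.reg j) ∧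
      t ≤ workBound i (F (i, b)) := by
  by_cases hF : F (i, b) = ∅
  · exact ⟨σ, F, 0, LoopTo.refl _ _, rfl, by simp [hF], h, hF, fun _ _ _ => rfl,
      fun _ _ _ => rfl, Nat.zero_le _⟩
  have hb' : b = true ↔ F (i, false) = ∅ := by
    refine ⟨hb, fun h0 => ?_⟩
    cases b
    · exact (hF h0).elim
    · rfl
  rcases i with _ | k
  · obtain ⟨σ', hrun, hinp, hout, hmain, hst⟩ := mainBody_output (limits N n m).Check h b hb' hF
    refine ⟨σ', _, 1, h.loopTo hi hrun, hinp, ?_, hmain, by simp, fun p hp _ => by simp [hp],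
      fun j hj hj0 => hst j hj hj0.ne', by simp [workBound, hF]⟩
    rw [hout, modelWords, if_neg hF]
  · obtain ⟨σ₁, F₁, hrun₁, hinp₁, hout₁, hmain₁, hF₁, hF₁', hsame₁, hst₁⟩ :=
      mainBody_split N h hi b hb' hF
    obtain ⟨σ₂, F₂, t, hloop₂, hinp₂, hout₂, hmain₂, hsame₂, hst₂, ht⟩ := hsweep k rfl σ₁ F₁ hmain₁
    refine ⟨σ₂, F₂, _, (h.loopTo hi hrun₁).trans hloop₂, hinp₂.trans hinp₁, ?_, hmain₂,
      (hsame₂ _ (Nat.lt_succ_self k)).trans hF₁, fun p hp hk => ?_, fun j hj hkj => ?_, ?_⟩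
    · have hcongr : ∀ (S : Finset ℕ) (c : ℕ),
          modelWords n k S (Function.update (storedValues n σ₁.reg) k c) = modelWords n k S
            (Function.update (Function.update (storedValues n σ.reg) (k + 1) b.toNat) k c) :=
        fun S c => storedValues_update_congr fun j _ hj => hst₁ j hj.le
      rw [hout₂, hout₁, hF₁', hF₁', hcongr, hcongr, modelWords]
      rfl
    · rw [hsame₂ p hk, hsame₁ p hp (by omega)]
    · rw [hst₂ j hj (by omega), hst₁ j hj, Function.update_of_ne (by omega)]
    · rw [hF₁', hF₁'] at ht
      rw [workBound, if_neg hF]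
      simp only [Bool.toNat_false, Bool.toNat_true, zero_add, Nat.reduceAdd] at ht
      omega

/-- Treat the list for value `0`, then that for value `1`, then climb. Treating the first leaves the
second untouched, as only lower levels are used meanwhile. -/
lemma sweeps_of_pred {N i : ℕ} (hi : i ≤ n) (hsweep : ∀ k, i = k + 1 → Sweeps N n m k) :
    Sweeps N n m i := by
  intro σ F h
  obtain ⟨σ₁, F₁, t₁, hloop₁, hinp₁, hout₁, hmain₁, hF₁, hsame₁, hst₁, ht₁⟩ :=
    treat_list hi hsweep h false (by simp)
  obtain ⟨σ₂, F₂, t₂, hloop₂, hinp₂, hout₂, hmain₂, hF₂, hsame₂, hst₂, ht₂⟩ :=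
    treat_list hi hsweep hmain₁ true (fun _ => hF₁)
  have hF₂' : ∀ b, F₂ (i, b) = ∅ := by
    intro b
    cases b
    · rw [hsame₂ _ (by simp) le_rfl, hF₁]
    · exact hF₂
  obtain ⟨σ₃, hrun₃, hinp₃, hout₃, hmain₃, hst₃⟩ :=
    mainBody_skip (limits N n m).Check hmain₂ hi hF₂'
  have hF₁t : F₁ (i, true) = F (i, true) := hsame₁ _ (by simp) le_rfl
  refine ⟨σ₃, F₂, _, (hloop₁.trans hloop₂).trans (hmain₂.loopTo hi hrun₃),
    hinp₃.trans (hinp₂.trans hinp₁), ?_, hmain₃, fun p hp => ?_, fun j hj hij => ?_, ?_⟩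
  · rw [hout₃, hout₂, hout₁, List.append_assoc, hF₁t,
      storedValues_update_congr fun j hij hj => hst₁ j hj.le hij]
    rfl
  · have hne : ∀ b, p ≠ (i, b) := by
      rintro b rfl
      exact lt_irrefl _ hp
    rw [hsame₂ p (hne _) hp.le, hsame₁ p (hne _) hp.le]
  · rw [storedValues, hst₃ _ (by omega)]
    exact (hst₂ j hj hij).trans (hst₁ j hj hij)
  · rw [hF₁t] at ht₂
    omega

lemma sweeps (N : ℕ) {i : ℕ} (hi : i ≤ n) : Sweeps N n m i := by
  induction i with
  | zero => exact sweeps_of_pred hi fun k hk => by omega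
  | succ i ih =>
    refine sweeps_of_pred hi fun k hk => ?_
    obtain rfl : i = k := by omega
    exact ih (by omega)

end RAM

lemma Heap.empty {n K : ℕ} {r : ℕ → ℕ} (hr : ∀ x, K ≤ x → r x = 0) :
    Heap n K r (fun _ => 0) (fun _ => ∅) :=
  ⟨fun _ _ => ⟨[], by simp, by simp, rfl⟩, by simp, fun x hx h0 => (h0 (hr x hx)).elim⟩

/-! ### Reading the input -/

namespace RAM

open Stmt

/-- Memory layout: registers below `32` for constants and work, then blocks of `n + 1` registers for
the powers of `3`, the word, the heads for value `0` and the heads for value `1`, and finally the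
cells from `heapStart n` on. -/
def headerStmt : Stmt :=
  .blk [.read 1, .const 0 1, .add 22 1 0, .const 25 32, .add 3 25 22, .add 4 3 22, .add 5 4 22,
    .add 2 5 22, .const 6 0, .const 11 1, .const 24 3, .copy 19 22]

/-- Store a power of `3`. -/
def tableBody : Stmt :=
  .blk [.add 23 25 6, .store 23 11, .mul 11 11 24, .add 6 6 0, .sub 19 19 0]

def termsHeaderStmt : Stmt :=
  .blk [.read 20, .add 23 25 1, .load 11 23, .mul 10 2 11, .const 14 0]

/-- Read a literal. -/
def literalBody : Stmt :=
  .blk [.read 23, .add 23 25 23, .load 23 23, .read 17, .add 17 17 0, .mul 23 23 17,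
    .add 16 16 23, .sub 21 21 0]

/-- Read a term. -/
def termBody : Stmt :=
  .seq (.seq (.blk [.read 21, .const 16 0]) (.loop 21 literalBody))
    (.seq (insertCode 10 14) (.blk [.sub 20 20 0]))

/-- The flag `1` is `n + 1 - i` at the starting level `i = n`. -/
def mainHeaderStmt : Stmt := .blk [.add 23 4 1, .store 23 14, .copy 6 1, .const 19 1]

/-- The program that enumerates the models of a DNF formula. -/
def enumStmt : Stmt :=
  .seq (.seq (.seq headerStmt (.loop 19 tableBody)) (.seq termsHeaderStmt (.loop 20 termBody)))
    (.seq mainHeaderStmt (.loop 19 mainBody))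

/-- The state of the machine when the first `j` powers of `3` have been stored. -/
structure TableState (n j : ℕ) (r : ℕ → ℕ) : Prop where
  one : r 0 = 1
  vars : r 1 = n
  start : r 2 = heapStart n
  word : r 3 = n + 33
  heads0 : r 4 = 2 * n + 34
  heads1 : r 5 = 3 * n + 35
  succ : r 22 = n + 1
  table : r 25 = 32
  index : r 6 = j
  power : r 11 = 3 ^ j
  three : r 24 = 3
  flag : r 19 = n + 1 - j
  le : j ≤ n + 1
  pow : ∀ k < j, r (32 + k) = 3 ^ k
  zero : ∀ x, n + 33 ≤ x → r x = 0
  le_maxValue : ∀ x, r x ≤ maxValue n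

lemma TableState.mem {n m j : ℕ} {r : ℕ → ℕ} (h : TableState n j r) :
    Mem n m r (fun _ => 0) (fun _ => ∅) :=
  ⟨Heap.empty fun x hx => h.zero x (by unfold heapStart at hx; omega), h.le_maxValue, by simp⟩

lemma header_run {n : ℕ} {w : List ℕ} {o : List (List ℕ)} (Q : St → Prop) :
    ∃ σ' : St, BigStep Q headerStmt ⟨0, n :: w, o⟩ 0 σ' ∧ σ'.input = w ∧ σ'.out = o ∧
      TableState n 0 σ'.reg := by
  refine ⟨_, .blk _ _, rfl, rfl, ?_⟩
  have hr : ⇑(List.foldl Instr.run ⟨0, n :: w, o⟩ [.read 1, .const 0 1, .add 22 1 0, .const 25 32,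
      .add 3 25 22, .add 4 3 22, .add 5 4 22, .add 2 5 22, .const 6 0, .const 11 1, .const 24 3,
      .copy 19 22]).reg = fun x => if x = 19 then n + 1 else if x = 24 then 3 else
      if x = 11 then 1 else if x = 6 then 0 else if x = 2 then 32 + (n + 1) + (n + 1) + (n + 1)
        + (n + 1) else
      if x = 5 then 32 + (n + 1) + (n + 1) + (n + 1) else if x = 4 then 32 + (n + 1) + (n + 1) else
      if x = 3 then 32 + (n + 1) else if x = 25 then 32 else if x = 22 then n + 1 else
      if x = 0 then 1 else if x = 1 then n else 0 := by
    funext x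
    simp [Instr.run, Function.update_apply, -Finsupp.zero_update]
  have hV := (maxValue_ge n).2.1
  have hK : heapStart n = 4 * n + 36 := rfl
  generalize List.foldl Instr.run _ _ = σ' at hr
  refine ⟨?_, ?_, ?_, ?_, ?_, ?_, ?_, ?_, ?_, ?_, ?_, ?_, by omega, by simp, fun x hx => ?_,
    fun x => ?_⟩
  · simp [hr]
  · simp [hr]
  · simp [hr]; omega
  · simp [hr]; omega
  · simp [hr]; omega
  · simp [hr]; omega
  · simp [hr]
  · simp [hr]
  · simp [hr]
  · simp [hr]
  · simp [hr]
  · simp [hr]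
  · rw [hr]
    beta_reduce
    rw [if_neg, if_neg, if_neg, if_neg, if_neg, if_neg, if_neg, if_neg, if_neg, if_neg, if_neg,
      if_neg] <;> omega
  · rw [hr]
    repeat' apply ite_le_of_le
    all_goals omega

lemma tableLoop_run (N : ℕ) {n m : ℕ} : ∀ (k : ℕ) {j : ℕ} {σ : St}, TableState n j σ.reg →
    n + 1 - j = k →
    ∃ σ' : St, BigStep (limits N n m).Check (.loop 19 tableBody) σ (k + 1) σ' ∧
      σ'.input = σ.input ∧ σ'.out = σ.out ∧ TableState n (n + 1) σ'.reg := by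
  intro k
  induction k with
  | zero =>
    intro j σ h hk
    obtain rfl : j = n + 1 := by have := h.le; omega
    exact ⟨σ, .loop_done h.mem.check (by rw [h.flag]; omega), rfl, rfl, h⟩
  | succ k ih =>
    intro j σ h hk
    obtain ⟨σ₁, hrun₁, hinp₁, hout₁, hr₁⟩ : ∃ σ₁ : St, BigStep (limits N n m).Check tableBody σ 0 σ₁
        ∧ σ₁.input = σ.input ∧ σ₁.out = σ.out ∧ ⇑σ₁.reg = fun x => if x = 19 then n + 1 - (j + 1)
        else if x = 6 then j + 1 else if x = 11 then 3 ^ (j + 1) else if x = 32 + j then 3 ^ j else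
        if x = 23 then 32 + j else σ.reg x := by
      refine ⟨_, .blk _ _, rfl, rfl, ?_⟩
      have hk : ∀ k < 32, ∀ j, (k = 32 + j) = False := fun k hk j => by simp; omega
      funext x
      simp [Instr.run, Function.update_apply, hk, h.table, h.index, h.power, h.three, h.one, h.flag,
        pow_succ, Nat.sub_sub]
    have hk32 : ∀ k < 32, (k = 32 + j) = False := fun k hk => by simp; omega
    have hV := maxValue_ge n
    have hK : heapStart n = 4 * n + 36 := rfl
    have hp1 : 3 ^ (j + 1) ≤ 3 ^ (n + 1) := Nat.pow_le_pow_right (by norm_num) (by omega)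
    have hp2 : 3 ^ j ≤ 3 ^ (n + 1) := Nat.pow_le_pow_right (by norm_num) (by omega)
    have h₁ : TableState n (j + 1) σ₁.reg := by
      refine ⟨?_, ?_, ?_, ?_, ?_, ?_, ?_, ?_, ?_, ?_, ?_, ?_, by omega, fun l hl => ?_,
        fun x hx => ?_, fun x => ?_⟩ <;> rw [hr₁]
      · simp [h.one, hk32]
      · simp [h.vars, hk32]
      · simp [h.start, hk32]
      · simp [h.word, hk32]
      · simp [h.heads0, hk32]
      · simp [h.heads1, hk32]
      · simp [h.succ, hk32]
      · simp [h.table, hk32]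
      · simp
      · simp
      · simp [h.three, hk32]
      · simp
      · simp only
        rw [if_neg (by omega), if_neg (by omega), if_neg (by omega)]
        rcases Nat.lt_succ_iff_lt_or_eq.1 hl with hl | rfl
        · rw [if_neg (by omega), if_neg (by omega), h.pow l hl]
        · simp
      · simp only
        rw [if_neg (by omega), if_neg (by omega), if_neg (by omega), if_neg (by omega),
          if_neg (by omega), h.zero x hx]
      · have := h.le_maxValue x
        repeat' apply ite_le_of_le
        all_goals omega
    obtain ⟨σ₂, hrun₂, hinp₂, hout₂, h₂⟩ := ih h₁ (by omega)
    exact ⟨σ₂, (BigStep.loop_step h.mem.check (by rw [h.flag]; omega) hrun₁ hrun₂).of_eq (by omega),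
      hinp₂.trans hinp₁, hout₂.trans hout₁, h₂⟩

/-- The code is accumulated additively, so the order of the literals does not matter; the bound on
the final sum also bounds all partial sums. -/
lemma literalLoop_run (N : ℕ) {n m : ℕ} {hd : ℕ × Bool → ℕ} {F : ℕ × Bool → Finset ℕ}
    {rest : List ℕ} (ls : List (Literal n)) :
    ∀ {σ : St} {c : ℕ}, Ctx n σ.reg → Mem n m σ.reg hd F → σ.reg 21 = ls.length →
      σ.reg 16 = c → c + (ls.map Literal.code).sum ≤ 3 ^ n →
      σ.input = (ls.flatMap fun l => [(l.1 : ℕ), l.2.toNat]) ++ rest →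
      ∃ σ' : St, BigStep (limits N n m).Check (.loop 21 literalBody) σ (ls.length + 1) σ' ∧
        σ'.input = rest ∧ σ'.out = σ.out ∧ Mem n m σ'.reg hd F ∧
        σ'.reg 16 = c + (ls.map Literal.code).sum ∧
        ∀ x, x ∉ ({16, 17, 21, 23} : Finset ℕ) → σ'.reg x = σ.reg x := by
  induction ls with
  | nil =>
    intro σ c hctx hmem h21 h16 _ hinp
    exact ⟨σ, .loop_done hmem.check h21, by simpa using hinp, rfl, hmem, by simpa using h16,
      fun _ _ => rfl⟩
  | cons l ls ih =>
    intro σ c hctx hmem h21 h16 hsum hinp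
    simp only [List.map_cons, List.sum_cons, List.length_cons] at hsum h21 ⊢
    have hpow := hctx.pow l.1 l.1.2.le
    obtain ⟨σ₁, hrun₁, hinp₁, hout₁, hr₁⟩ : ∃ σ₁ : St,
        BigStep (limits N n m).Check literalBody σ 0 σ₁ ∧
        σ₁.input = (ls.flatMap fun l => [(l.1 : ℕ), l.2.toNat]) ++ rest ∧ σ₁.out = σ.out ∧
        ⇑σ₁.reg = fun x => if x = 21 then ls.length else if x = 16 then c + l.code else
          if x = 23 then l.code else if x = 17 then l.2.toNat + 1 else σ.reg x := by
      refine ⟨_, .blk _ _, by simp [Instr.run, hinp], rfl, ?_⟩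
      have hk : ∀ k < 32, ∀ j, (32 + j = k) = False := fun k hk j => by simp; omega
      funext x
      simp [Instr.run, Function.update_apply, hk, hinp, hctx.table, hctx.one, h21, h16, hpow,
        Literal.code, add_comm l.2.toNat]
      split_ifs <;> rfl
    have hfr : ∀ x, x ∉ ({16, 17, 21, 23} : Finset ℕ) → σ₁.reg x = σ.reg x := by
      intro x hx
      simp only [Finset.mem_insert, Finset.mem_singleton, not_or] at hx
      simp [hr₁, hx]
    have hV := maxValue_ge n
    have hK : heapStart n = 4 * n + 36 := rfl
    have hpn : 3 ^ n ≤ 3 ^ (n + 1) := Nat.pow_le_pow_right (by norm_num) (by omega)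
    obtain ⟨σ₂, hrun₂, hinp₂, hout₂, hmem₂, h16₂, hfr₂⟩ := ih (σ := σ₁) (c := c + l.code)
      (hctx.congr fun x hx => hfr x (by simp; omega))
      ⟨hmem.heap.congr (fun x hx => hfr x (by simp; omega)) fun _ _ => rfl, fun x => by
        have h1 := hmem.le_maxValue x
        have h2 := hmem.le_maxValue 21
        have h3 := Bool.toNat_le l.2
        rw [hr₁]
        repeat' apply ite_le_of_le
        all_goals omega, hmem.card_le⟩
      (by simp [hr₁]) (by simp [hr₁]) (by omega) hinp₁
    refine ⟨σ₂, (BigStep.loop_step hmem.check (by omega) hrun₁ hrun₂).of_eq (by omega), hinp₂,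
      hout₂.trans hout₁, hmem₂, by omega, fun x hx => (hfr₂ x hx).trans (hfr x hx)⟩

end RAM

/-- The codes of the terms of a formula, given as lists of literals. -/
def termCodes {n : ℕ} (Ts : List (List (Literal n))) : Finset ℕ :=
  (Ts.map fun ls => literalsCode ls.toFinset).toFinset

/-- The list has pairwise different literals, with pairwise different variables. -/
def IsTermList {n : ℕ} (ls : List (Literal n)) : Prop :=
  ls.Nodup ∧ Set.InjOn Prod.fst (ls.toFinset : Set (Literal n))

lemma IsTermList.sum_code {n : ℕ} {ls : List (Literal n)} (h : IsTermList ls) :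
    (ls.map Literal.code).sum = literalsCode ls.toFinset :=
  (List.sum_toFinset _ h.1).symm

/-- The variables of the literals are pairwise different elements of `Fin n`. -/
lemma IsTermList.length_le {n : ℕ} {ls : List (Literal n)} (h : IsTermList ls) :
    ls.length ≤ n := by
  rw [← List.toFinset_card_of_nodup h.1, ← Finset.card_image_of_injOn h.2]
  exact (Finset.card_le_univ _).trans (by simp)

namespace RAM

open Stmt

/-- All terms go into the root list `(n, false)`. A term costs one outer test and at most `n + 1`
tests for its literals. -/
lemma termsLoop_run (N : ℕ) {n m : ℕ} (Ts : List (List (Literal n))) :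
    ∀ {σ : St} {S : Finset ℕ}, Ctx n σ.reg →
      Mem n m σ.reg (Function.update (fun _ => 0) (n, false) (σ.reg 14))
        (Function.update (fun _ => ∅) (n, false) S) →
      σ.reg 10 = cellAddr (heapStart n) (n, false) 0 → σ.reg 20 = Ts.length →
      (∀ x, n + 33 ≤ x → x < heapStart n → σ.reg x = 0) →
      σ.input = Ts.flatMap encodeTerm → (∀ ls ∈ Ts, IsTermList ls) →
      (S ∪ termCodes Ts).card ≤ m →
      ∃ (σ' : St) (t : ℕ), BigStep (limits N n m).Check (.loop 20 termBody) σ t σ' ∧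
        σ'.out = σ.out ∧ Ctx n σ'.reg ∧
        Mem n m σ'.reg (Function.update (fun _ => 0) (n, false) (σ'.reg 14))
          (Function.update (fun _ => ∅) (n, false) (S ∪ termCodes Ts)) ∧
        (∀ x, n + 33 ≤ x → x < heapStart n → σ'.reg x = 0) ∧
        t ≤ Ts.length * (n + 2) + 1 := by
  induction Ts with
  | nil =>
    intro σ S hctx hmem _ h20 hzero _ _ _
    exact ⟨σ, 1, .loop_done hmem.check h20, rfl, hctx, by simpa [termCodes] using hmem, hzero,
      by simp⟩
  | cons ls Ts ih =>
    intro σ S hctx hmem h10 h20 hzero hinp hTs hcard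
    have hls := hTs ls (by simp)
    have hlt : literalsCode ls.toFinset < 3 ^ n := literalsCode_lt hls.2
    have hV := maxValue_ge n
    have hK : heapStart n = 4 * n + 36 := rfl
    have hcodes : S ∪ termCodes (ls :: Ts) =
        insert (literalsCode ls.toFinset) S ∪ termCodes Ts := by
      simp [termCodes]
    rw [hcodes] at hcard ⊢
    simp only [List.length_cons] at h20 ⊢
    obtain ⟨σ₁, hrun₁, hinp₁, hout₁, hr₁⟩ : ∃ σ₁ : St,
        BigStep (limits N n m).Check (.blk [.read 21, .const 16 0]) σ 0 σ₁ ∧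
        σ₁.input = (ls.flatMap fun l => [(l.1 : ℕ), l.2.toNat]) ++ Ts.flatMap encodeTerm ∧
        σ₁.out = σ.out ∧
        ⇑σ₁.reg = fun x => if x = 16 then 0 else if x = 21 then ls.length else σ.reg x := by
      refine ⟨_, .blk _ _, by simp [Instr.run, hinp, encodeTerm], rfl, ?_⟩
      funext x
      simp [Instr.run, Function.update_apply, hinp, encodeTerm]
    have hfr₁ : ∀ x, x ∉ ({16, 21} : Finset ℕ) → σ₁.reg x = σ.reg x := by
      intro x hx
      simp only [Finset.mem_insert, Finset.mem_singleton, not_or] at hx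
      simp [hr₁, hx]
    have hmem₁ : Mem n m σ₁.reg (Function.update (fun _ => 0) (n, false) (σ.reg 14))
        (Function.update (fun _ => ∅) (n, false) S) := by
      refine ⟨hmem.heap.congr (fun x hx => hfr₁ x (by simp; omega)) fun _ _ => rfl, fun x => ?_,
        hmem.card_le⟩
      have h1 := hmem.le_maxValue x
      have h2 := hls.length_le
      rw [hr₁]
      repeat' apply ite_le_of_le
      all_goals omega
    obtain ⟨σ₂, hrun₂, hinp₂, hout₂, hmem₂, h16₂, hfr₂⟩ := literalLoop_run N ls
      (hctx.congr fun x hx => hfr₁ x (by simp; omega)) hmem₁ (by simp [hr₁]) rfl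
      (by rw [hls.sum_code, hr₁]; simpa using hlt.le) hinp₁
    rw [hls.sum_code, show σ₁.reg 16 = 0 by simp [hr₁], zero_add] at h16₂
    have hfr₂' : ∀ x, x ∉ ({16, 17, 21, 23} : Finset ℕ) → σ₂.reg x = σ.reg x := fun x hx =>
      (hfr₂ x hx).trans (hfr₁ x (by
        simp only [Finset.mem_insert, Finset.mem_singleton, not_or] at hx ⊢
        exact ⟨hx.1, hx.2.2.1⟩))
    have hcard₂ : (insert (literalsCode ls.toFinset) S).card ≤ m :=
      (Finset.card_le_card Finset.subset_union_left).trans hcard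
    obtain ⟨σ₃, hrun₃, hinp₃, hout₃, hmem₃, hfr₃⟩ := insertCode_run (limits N n m).Check
      (p := (n, false)) (b := 10) (h := 14) hmem₂ le_rfl hlt (by simpa using hcard₂) (by simp)
      (by simp) (by simp) (by rw [hfr₂' 0 (by simp), hctx.one]) h16₂
      (by rw [hfr₂' 10 (by simp), h10]) (by rw [hfr₂' 14 (by simp)]; simp)
    simp only [Function.update_idem, Function.update_self] at hmem₃
    have hfr₃' : ∀ x < heapStart n, x ∉ ({14, 16, 17, 21, 23} : Finset ℕ) →
        σ₃.reg x = σ.reg x := by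
      intro x hx hxs
      simp only [Finset.mem_insert, Finset.mem_singleton, not_or] at hxs
      rw [hfr₃ x hx hxs.2.2.1 hxs.2.2.2.2 hxs.1, hfr₂' x (by simp; omega)]
    obtain ⟨σ₄, hrun₄, hinp₄, hout₄, hr₄⟩ : ∃ σ₄ : St,
        BigStep (limits N n m).Check (.blk [.sub 20 20 0]) σ₃ 0 σ₄ ∧
        σ₄.input = σ₃.input ∧ σ₄.out = σ₃.out ∧
        ⇑σ₄.reg = fun x => if x = 20 then Ts.length else σ₃.reg x := by
      refine ⟨_, .blk _ _, rfl, rfl, ?_⟩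
      have e0 : σ₃.reg 0 = 1 := by rw [hfr₃' 0 (by omega) (by simp), hctx.one]
      have e20 : σ₃.reg 20 = Ts.length + 1 := by rw [hfr₃' 20 (by omega) (by simp), h20]
      funext x
      simp [Instr.run, Function.update_apply, e0, e20]
    have hfr₄ : ∀ x < heapStart n, x ∉ ({14, 16, 17, 20, 21, 23} : Finset ℕ) →
        σ₄.reg x = σ.reg x := by
      intro x hx hxs
      simp only [Finset.mem_insert, Finset.mem_singleton, not_or] at hxs
      rw [← hfr₃' x hx (by simp; omega), hr₄]
      simp [hxs]
    have h14 : σ₄.reg 14 = σ₃.reg 14 := by simp [hr₄]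
    obtain ⟨σ₅, t, hrun₅, hout₅, hctx₅, hmem₅, hzero₅, ht⟩ := ih (σ := σ₄)
      (S := insert (literalsCode ls.toFinset) S)
      (hctx.congr fun x hx => hfr₄ x (by omega) (by simp; omega))
      ⟨by
        rw [h14]
        refine hmem₃.heap.congr (fun x hx => ?_) fun _ _ => rfl
        simp [hr₄, show x ≠ 20 by omega], fun x => by
        have h1 := hmem₃.le_maxValue x
        have h2 := hmem.le_maxValue 20
        rw [hr₄]
        repeat' apply ite_le_of_le
        all_goals omega, hmem₃.card_le⟩
      (by rw [hfr₄ 10 (by omega) (by simp), h10]) (by simp [hr₄])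
      (fun x h1 h2 => by rw [hfr₄ x h2 (by simp; omega), hzero x h1 h2])
      (by rw [hinp₄, hinp₃, hinp₂]) (fun l hl => hTs l (by simp [hl])) hcard
    refine ⟨σ₅, _, BigStep.loop_step hmem.check (by omega)
      (.seq (.seq hrun₁ hrun₂) (.seq hrun₃ hrun₄)) hrun₅, ?_, hctx₅, hmem₅, hzero₅, ?_⟩
    · rw [hout₅, hout₄, hout₃, hout₂, hout₁]
    · have := hls.length_le
      rw [Nat.add_mul, one_mul]
      omega

/-- The tests are `n + 2` for the table of powers, at most `(n + 2) m + 1` for the terms, at most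
`workBound + 1` for the sweep from level `n`, and one that ends the main loop. The bound on the
number of terms keeps the counter of terms below `maxValue n`. -/
lemma enumStmt_run (N : ℕ) {n : ℕ} (Ts : List (List (Literal n)))
    (hTs : ∀ ls ∈ Ts, IsTermList ls) (hlen : Ts.length ≤ 3 ^ n) :
    ∃ (σ' : St) (t : ℕ) (u : ℕ → ℕ),
      BigStep (limits N n Ts.length).Check enumStmt ⟨0, encodeTerms Ts, []⟩ t σ' ∧
      σ'.out = modelWords n n (termCodes Ts) u ∧
      t ≤ (n + 2) * Ts.length + n + 5 + workBound n (termCodes Ts) := by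
  set m := Ts.length with hm
  have hV := maxValue_ge n
  have hK : heapStart n = 4 * n + 36 := rfl
  have hpn : 3 ^ n ≤ 3 ^ (n + 1) := Nat.pow_le_pow_right (by norm_num) (by omega)
  have hcard : (termCodes Ts).card ≤ m :=
    (List.toFinset_card_le _).trans (by simp [hm])
  obtain ⟨σ₁, hrun₁, hinp₁, hout₁, h₁⟩ := header_run (n := n) (w := m :: Ts.flatMap encodeTerm)
    (o := []) (limits N n m).Check
  obtain ⟨σ₂, hrun₂, hinp₂, hout₂, h₂⟩ := tableLoop_run N (m := m) _ h₁ rfl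
  have hctx₂ : Ctx n σ₂.reg := ⟨h₂.one, h₂.vars, h₂.start, h₂.word, h₂.heads0, h₂.heads1, h₂.succ,
    h₂.table, fun j hj => h₂.pow j (by omega)⟩
  obtain ⟨σ₃, hrun₃, hinp₃, hout₃, hr₃⟩ : ∃ σ₃ : St,
      BigStep (limits N n m).Check termsHeaderStmt σ₂ 0 σ₃ ∧
      σ₃.input = Ts.flatMap encodeTerm ∧ σ₃.out = σ₂.out ∧
      ⇑σ₃.reg = fun x => if x = 14 then 0 else if x = 10 then heapStart n * 3 ^ n else
        if x = 11 then 3 ^ n else if x = 23 then 32 + n else if x = 20 then m else σ₂.reg x := by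
    refine ⟨_, .blk _ _, by simp [Instr.run, hinp₂, hinp₁], rfl, ?_⟩
    have hk : ∀ k < 32, ∀ j, (32 + j = k) = False := fun k hk j => by simp; omega
    have hp := hctx₂.pow n le_rfl
    funext x
    simp [Instr.run, Function.update_apply, hinp₂, hinp₁, hk, hp, h₂.vars, h₂.start, h₂.table]
  have hfr₃ : ∀ x, x ∉ ({10, 11, 14, 20, 23} : Finset ℕ) → σ₃.reg x = σ₂.reg x := by
    intro x hx
    simp only [Finset.mem_insert, Finset.mem_singleton, not_or] at hx
    simp [hr₃, hx]
  have hzero₃ : ∀ x, n + 33 ≤ x → σ₃.reg x = 0 := fun x hx => by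
    rw [hfr₃ x (by simp; omega), h₂.zero x hx]
  have hmem₃ : Mem n m σ₃.reg (Function.update (fun _ => 0) (n, false) (σ₃.reg 14))
      (Function.update (fun _ => ∅) (n, false) ∅) := by
    rw [show σ₃.reg 14 = 0 by simp [hr₃], Function.update_eq_self_iff.2 rfl,
      Function.update_eq_self_iff.2 rfl]
    refine ⟨Heap.empty fun x hx => hzero₃ x (by omega), fun x => ?_, by simp⟩
    have h1 := h₂.le_maxValue x
    have h3 := cellAddr_lt (K := heapStart n) (n := n) (p := (n, false)) (q := 0) (by simp) le_rfl
    simp only [cellAddr, Bool.toNat_false, add_zero] at h3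
    rw [hr₃]
    repeat' apply ite_le_of_le
    all_goals omega
  obtain ⟨σ₄, t₄, hrun₄, hout₄, hctx₄, hmem₄, hzero₄, ht₄⟩ := termsLoop_run N Ts (σ := σ₃) (S := ∅)
    (hctx₂.congr fun x hx => hfr₃ x (by simp; omega)) hmem₃ (by simp [hr₃, cellAddr])
    (by simp [hr₃, hm]) (fun x hx _ => hzero₃ x hx) hinp₃ hTs (by simpa using hcard)
  rw [Finset.empty_union] at hmem₄
  have ha : headAddr n (n, false) = 2 * n + 34 + n := by simp [headAddr]
  obtain ⟨σ₅, hrun₅, hout₅, hr₅⟩ : ∃ σ₅ : St,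
      BigStep (limits N n m).Check mainHeaderStmt σ₄ 0 σ₅ ∧ σ₅.out = σ₄.out ∧
      ⇑σ₅.reg = fun x => if x = 19 then 1 else if x = 6 then n else
        if x = 2 * n + 34 + n then σ₄.reg 14 else if x = 23 then 2 * n + 34 + n else
        σ₄.reg x := by
    refine ⟨_, .blk _ _, rfl, ?_⟩
    have hk : ∀ k < 32, (k = 2 * n + 34 + n) = False := fun k hk => by simp; omega
    funext x
    simp [Instr.run, Function.update_apply, hk, hctx₄.vars, hctx₄.heads0]
  have hfr₅ : ∀ x, x ∉ ({6, 19, 23, 2 * n + 34 + n} : Finset ℕ) → σ₅.reg x = σ₄.reg x := by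
    intro x hx
    simp only [Finset.mem_insert, Finset.mem_singleton, not_or] at hx
    simp [hr₅, hx]
  have hmain : MainState n m n σ₅.reg
      (Function.update (fun _ => ∅) (n, false) (termCodes Ts)) := by
    refine ⟨hctx₄.congr fun x hx => hfr₅ x (by simp; omega),
      ⟨hmem₄.heap.congr (fun x hx => hfr₅ x (by simp; omega)) fun p hp => ?_, fun x => ?_,
        hmem₄.card_le⟩, by simp [hr₅], by simp [hr₅], fun p hp => ?_⟩
    · have hb := headAddr_bounds hp
      rcases eq_or_ne p (n, false) with rfl | hpn
      · rw [ha, hr₅, Function.update_self]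
        beta_reduce
        rw [if_neg (by omega), if_neg (by omega), if_pos rfl]
      · have : headAddr n p ≠ 2 * n + 34 + n := by
          rw [← ha]
          exact fun h' => hpn (headAddr_inj hp le_rfl h')
        rw [Function.update_of_ne hpn, hfr₅ _ (by simp; omega), hzero₄ _ (by omega) hb.2]
    · have h1 := hmem₄.le_maxValue x
      have h2 := hmem₄.le_maxValue 14
      rw [hr₅]
      repeat' apply ite_le_of_le
      all_goals omega
    · exact Function.update_of_ne (fun h' => by rw [h'] at hp; exact lt_irrefl _ hp) _ _
  obtain ⟨σ₆, F', t₆, hloop, _, hout₆, hmain₆, _, _, ht₆⟩ := sweeps N le_rfl σ₅ _ hmain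
  -- The list `(n, true)` is empty, so the sweep of level `n` treats only the root list.
  rw [Function.update_self, Function.update_of_ne (by simp)] at hout₆ ht₆
  refine ⟨σ₆, _, Function.update (storedValues n σ₅.reg) n 0, .seq (.seq (.seq hrun₁ hrun₂) (.seq hrun₃ hrun₄))
    (.seq hrun₅ (hloop _ _ (.loop_done hmain₆.mem.check (by rw [hmain₆.flag]; omega)))), ?_, ?_⟩
  · rw [hout₆, hout₅, hout₄, hout₃, hout₂, hout₁, modelWords_empty, List.append_nil, List.nil_append]
  · rw [workBound_empty] at ht₆
    rw [← hm, mul_comm] at ht₄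
    omega

end RAM

/-! ### From codes back to formulas, and the final bounds -/

open RAM Stmt

section

variable {n : ℕ} {Ts : List (List (Literal n))}

lemma mem_termCodes {c : ℕ} : c ∈ termCodes Ts ↔ ∃ ls ∈ Ts, literalsCode ls.toFinset = c := by
  simp [termCodes]

lemma termCodes_lt (hTs : ∀ ls ∈ Ts, IsTermList ls) : ∀ c ∈ termCodes Ts, c < 3 ^ n := by
  intro c hc
  obtain ⟨ls, hls, rfl⟩ := mem_termCodes.1 hc
  exact literalsCode_lt (hTs ls hls).2

/-- The code is injective on terms, so the root list has exactly `m` codes; the lower bound on the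
number of models thereby applies to `m` itself. -/
lemma card_termCodes (hTs : ∀ ls ∈ Ts, IsTermList ls) (hnd : (Ts.map List.toFinset).Nodup) :
    (termCodes Ts).card = Ts.length := by
  have h : (Ts.map fun ls => literalsCode ls.toFinset) =
      (Ts.map List.toFinset).map literalsCode := by simp
  rw [termCodes, h, List.toFinset_card_of_nodup]
  · simp
  · refine List.Nodup.map_on (fun x hx y hy hxy => ?_) hnd
    obtain ⟨a, ha, rfl⟩ := List.mem_map.1 hx
    obtain ⟨b, hb, rfl⟩ := List.mem_map.1 hy
    exact literalsCode_inj (hTs a ha).2 (hTs b hb).2 hxy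

lemma size_le_of_mem_encodeTerms (hTs : ∀ ls ∈ Ts, IsTermList ls) (hlen : Ts.length ≤ 3 ^ n) :
    ∀ v ∈ encodeTerms Ts, v.size ≤ 3 * n + 8 := by
  intro v hv
  refine (Nat.size_le_size ?_).trans (maxValue_size_le n)
  have hV := maxValue_ge n
  have hK : heapStart n = 4 * n + 36 := rfl
  have hpn : 3 ^ n ≤ 3 ^ (n + 1) := Nat.pow_le_pow_right (by norm_num) (by omega)
  simp only [encodeTerms, List.mem_cons, List.mem_flatMap, encodeTerm] at hv
  rcases hv with rfl | rfl | ⟨ls, hls, rfl | ⟨l, _, rfl | rfl | hv⟩⟩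
  · omega
  · omega
  · have := (hTs ls hls).length_le
    omega
  · have := l.1.2
    omega
  · have := Bool.toNat_le l.2
    omega
  · simp at hv

end

lemma assignmentWord_eq {n : ℕ} (α : Fin n → Bool) (v : ℕ → ℕ)
    (h : ∀ j : Fin n, v j = (α j).toNat) : assignmentWord α = (List.range n).map v := by
  refine List.ext_getElem (by simp [assignmentWord]) fun i h1 h2 => ?_
  have hi : i < n := by simpa using h2
  simp [assignmentWord, ← h ⟨i, hi⟩]

/-- The words that the program outputs are the models. -/
lemma mem_modelWords_termCodes {n : ℕ} {D : DNF n} {Ts : List (List (Literal n))}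
    (hTs : ∀ ls ∈ Ts, IsTermList ls)
    (hD : ∀ S : Finset (Literal n), S ∈ Ts.map List.toFinset ↔ ∃ T ∈ D, T.1 = S) (u : ℕ → ℕ)
    (y : List ℕ) :
    y ∈ modelWords n n (termCodes Ts) u ↔ y ∈ assignmentWord '' D.models := by
  have hsat : ∀ (v : ℕ → ℕ) (α : Fin n → Bool), (∀ j : Fin n, v j = (α j).toNat) →
      ((∃ c ∈ termCodes Ts, CodeSat n c v) ↔ α ∈ D.models) := by
    intro v α hv
    constructor
    · rintro ⟨c, hc, hs⟩
      obtain ⟨ls, hls, rfl⟩ := mem_termCodes.1 hc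
      obtain ⟨T, hT, hTl⟩ := (hD ls.toFinset).1 (List.mem_map_of_mem hls)
      rw [codeSat_literalsCode (hTs ls hls).2 hv, ← hTl] at hs
      exact ⟨T, hT, hs⟩
    · rintro ⟨T, hT, hs⟩
      obtain ⟨ls, hls, hTl⟩ := List.mem_map.1 ((hD T.1).2 ⟨T, hT, rfl⟩)
      refine ⟨_, mem_termCodes.2 ⟨ls, hls, rfl⟩, ?_⟩
      rw [codeSat_literalsCode (hTs ls hls).2 hv, hTl]
      exact hs
  rw [mem_modelWords]
  constructor
  · rintro ⟨v, hv, _, hs, rfl⟩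
    have hα : ∀ j : Fin n, v j = (decide (v j = 1)).toNat := fun j => by
      have := hv j j.2
      rcases (by omega : v j = 0 ∨ v j = 1) with h | h <;> simp [h]
    exact ⟨_, (hsat v _ hα).1 hs, assignmentWord_eq _ v hα⟩
  · rintro ⟨α, hα, rfl⟩
    obtain ⟨v, hv, hvu⟩ : ∃ v : ℕ → ℕ, (∀ j : Fin n, v j = (α j).toNat) ∧
        ∀ j, n ≤ j → v j = u j :=
      ⟨fun j => if h : j < n then (α ⟨j, h⟩).toNat else u j, by simp,
        fun j hj => by simp [not_lt.2 hj]⟩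
    refine ⟨v, fun j hj => ?_, hvu, (hsat v α hv).2 hα, assignmentWord_eq α v hv⟩
    rw [hv ⟨j, hj⟩]
    exact Bool.toNat_le _

/-- The largest constant in the program is `32`, which has six bits. -/
lemma enumStmt_straight : enumStmt.Straight 6 := by
  have h32 : Nat.size 32 ≤ 6 := Nat.size_le.2 (by norm_num)
  have h3 : Nat.size 3 ≤ 6 := Nat.size_le.2 (by norm_num)
  simp [enumStmt, headerStmt, tableBody, termsHeaderStmt, termBody, literalBody, insertCode,
    mainHeaderStmt, mainBody, selectStmt, processStmt, outputStmt, splitStmt, splitBody,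
    Stmt.Straight, Instr.Straight, h32, h3]

/-- A polynomial that bounds the space in terms of the number of variables plus the number of
terms. -/
noncomputable def spacePoly (N : ℕ) : Polynomial ℕ :=
  (4 * .X + 36 + 2 * (.X + 1) * .X) * (3 * .X + 8) +
    Polynomial.C (N * 2 ^ N) * (3 * .X + 14)

lemma limits_space_le (N n m : ℕ) : (limits N n m).space ≤ (spacePoly N).eval (n + m) := by
  simp only [Limits.space, Limits.bits, limits, spacePoly, Polynomial.eval_add,
    Polynomial.eval_mul, Polynomial.eval_X, Polynomial.eval_C, Polynomial.eval_ofNat,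
    Polynomial.eval_one]
  have h : 2 * (n + 1) * m ≤ 2 * (n + m + 1) * (n + m) :=
    Nat.mul_le_mul (by omega) (by omega)
  have h1 : N * (2 ^ N * (3 * n + 8 + 6)) ≤ N * 2 ^ N * (3 * (n + m) + 14) := by
    rw [← mul_assoc]
    exact Nat.mul_le_mul_left _ (by omega)
  refine add_le_add (Nat.mul_le_mul ?_ ?_) h1
  · unfold heapStart; omega
  · omega

/-- The bound for the average delay, from bounds for the time and the number of tests of loop
conditions. -/
lemma time_div_le {N n m t time count w : ℕ} {x : ℝ} (hn : 1 ≤ n) (hm : 1 ≤ m)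
    (hcount : (m : ℝ) ≤ x * count) (hx : 0 ≤ x) (hw : (w : ℝ) ≤ 4 * (n + 1) * (x * count))
    (ht : t ≤ (n + 2) * m + n + 5 + w)
    (htime : time ≤ (N + t * N) * (limits N n m).instrTime) :
    (time : ℝ) / count ≤ 18 * N * (1 + 34 * 2 ^ N) * (n : ℝ) ^ 2 * x := by
  have hn' : (1 : ℝ) ≤ n := by exact_mod_cast hn
  have hm' : (1 : ℝ) ≤ m := by exact_mod_cast hm
  have hc : (0 : ℝ) < count := by
    rcases (Nat.cast_nonneg (α := ℝ) count).eq_or_lt with h0 | h0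
    · rw [← h0] at hcount; linarith
    · exact h0
  rw [div_le_iff₀ hc]
  set y := x * count with hy
  have hy0 : 0 ≤ y := by positivity
  have ht' : (t : ℝ) ≤ (n + 2) * m + n + 5 + w := by exact_mod_cast ht
  have htime' : (time : ℝ) ≤ (N + t * N) * (1 + 2 * (2 ^ N * (3 * n + 8 + 6))) := by
    have : (limits N n m).instrTime = 1 + 2 * (2 ^ N * (3 * n + 8 + 6)) := rfl
    rw [this] at htime
    exact_mod_cast htime
  -- Here `1 ≤ m ≤ y` and `1 ≤ n`: reading the terms gives `3ny`, the constant part `n + 6` gives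
  -- `7ny`, and the enumeration gives `8ny`.
  have h1 : (1 : ℝ) + t ≤ 18 * (n * y) := by nlinarith
  -- From `3n + 14 ≤ 17n`. This is the cost of one instruction and the source of the second factor
  -- `n`.
  have h2 : (1 : ℝ) + 2 * (2 ^ N * (3 * n + 8 + 6)) ≤ (1 + 34 * 2 ^ N) * n := by
    have : (1 : ℝ) ≤ 2 ^ N := one_le_pow₀ (by norm_num)
    nlinarith
  calc (time : ℝ) ≤ N * (1 + t) * (1 + 2 * (2 ^ N * (3 * n + 8 + 6))) := by
        refine htime'.trans (le_of_eq ?_); ring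
    _ ≤ N * (18 * (n * y)) * ((1 + 34 * 2 ^ N) * n) := by gcongr
    _ = _ := by rw [hy]; ring

theorem mainTheorem6 :
    ∃ (P : RAM.Program) (C : ℝ) (p : Polynomial ℕ),
      ∀ (n : ℕ) (D : DNF n) (w : List ℕ), IsInputFor D w →
        (∃ c : RAM.Config, RAM.HaltsIn P w c ∧
          c.Enumerates (assignmentWord '' D.models) ∧
          (1 ≤ n → D.Nonempty →
            c.averageDelay ≤ C * (n : ℝ) ^ 2 * (D.card : ℝ) ^ (1 - Real.logb 3 2))) ∧
        (∀ c : RAM.Config, StateTransition.Reaches (RAM.step P) (RAM.start w) c →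
          c.space ≤ p.eval (n + D.card)) := by
  generalize hN : enumStmt.len = N
  refine ⟨enumStmt.compile 0, 18 * N * (1 + 34 * 2 ^ N), spacePoly N, ?_⟩
  rintro n D w ⟨Ts, hls, hnd, hD, rfl⟩
  have hTs : ∀ ls ∈ Ts, IsTermList ls := by
    intro ls h
    obtain ⟨T, _, hT⟩ := (hD ls.toFinset).1 (List.mem_map_of_mem h)
    exact ⟨hls ls h, hT ▸ T.2⟩
  have hcard : Ts.length = D.card := by
    rw [← Finset.card_map (Function.Embedding.subtype _), ← List.length_map (f := List.toFinset),
      ← List.toFinset_card_of_nodup hnd]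
    congr 1
    ext S
    rw [List.mem_toFinset, hD]
    simp
  have hcodes := card_termCodes hTs hnd
  have hlt := termCodes_lt hTs
  -- There are as many terms as distinct codes, and these are below `3^n`.
  have hlen : Ts.length ≤ 3 ^ n := by
    rw [← hcodes]
    simpa using Finset.card_le_card
      (show termCodes Ts ⊆ Finset.range (3 ^ n) from fun c hc => Finset.mem_range.2 (hlt c hc))
  obtain ⟨σ, t, u, hrun, hout, ht⟩ := enumStmt_run N Ts hTs hlen
  obtain ⟨⟨c, hc, hco, hct⟩, hspace⟩ := hrun.haltsIn enumStmt_straight hN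
    (size_le_of_mem_encodeTerms hTs hlen)
  rw [hout] at hco
  rw [hcard] at hspace ht hct
  refine ⟨⟨c, hc, ⟨?_, fun y => ?_⟩, fun hn hne => ?_⟩,
    fun c' hc' => (hspace c' hc').trans (limits_space_le N n _)⟩
  · rw [hco]
    exact nodup_modelWords le_rfl _ _
  · rw [hco]
    exact mem_modelWords_termCodes hTs hD u y
  · have h1 := card_le_rpow_mul_modelCount hlt (hcodes.trans hcard).le
    rw [hcodes.trans hcard] at h1
    rw [Config.averageDelay, hco, length_modelWords]
    exact time_div_le hn hne.card_pos h1 (by positivity)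
      (workBound_le hlt (hcodes.trans hcard).le) ht hct
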